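/- Let $\mathcal A$ be the quasi-local $C^*$-algebra of the quantum spin chain $\bigotimes_{k\in\mathbb Z}M_d(\mathbb C)$, write $x^{(k)}$ for the copy of $x\in M_d(\mathbb C)$ at site $k$, and let $v_1,\dots,v_{d^2}$ be Hermitian matrices with $\mathrm{Tr}(v_\mu v_\nu)=\delta_{\mu\nu}$. *Microscopic dynamics.* Let $\varepsilon_\mu\in\mathbb R$, let $h=(h_{\mu\nu})\in M_{d^2}(\mathbb C)$ be Hermitian and let $C=(C_{\mu\nu})\in M_{d^2}(\mathbb C)$ be positive semidefinite. Put $V^{(N)}_\mu=\frac1{\sqrt N}\sum_{k=0}^{N-1}v_\mu^{(k)}$, $H^{(N)}=\sum_\mu\varepsilon_\mu\sum_{k=0}^{N-1}v^{(k)}_\mu+\sum_{\mu,\nu}h_{\mu\nu}\frac1N\sum_{k,\ell=0}^{N-1}v^{(k)}_\mu v^{(\ell)}_\nu$, and let $\gamma^{(N)}_t=e^{t\mathbb L^{(N)}}$, $t\ge0$, be generated by $$\mathbb L^{(N)}[x]=i[H^{(N)},x]+\sum_{\mu,\nu}\frac{C_{\mu\nu}}2\Big([V^{(N)}_\mu,x]\,V^{(N)}_\nu+V^{(N)}_\mu\,[x,V^{(N)}_\nu]\Big).$$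 *State and fluctuations.* Let $\omega$ be a translation-invariant state on $\mathcal A$ such that $\sum_{\ell\in\mathbb Z}|\omega(x^{(0)}y^{(\ell)})-\omega(x^{(0)})\,\omega(y^{(0)})|<\infty$ for all $x,y\in M_d(\mathbb C)$. For $r\in\mathbb R^{d^2}$ let $$F^{(N)}_\mu(t)=\frac1{\sqrt N}\sum_{k=0}^{N-1}\Big(v^{(k)}_\mu-\omega\big(\gamma^{(N)}_t[v_\mu^{(k)}]\big)\Big),\qquad W^{(N)}_t(r)=e^{i\,r\cdot F^{(N)}(t)},\qquad W^{(N)}(r)=W^{(N)}_0(r).$$ Assume that $\omega$ has normal fluctuations with covariance matrix $\Sigma$: for all $\mu,\nu$, $\frac12\omega\big(F^{(N)}_\mu(0)F^{(N)}_\nu(0)+F^{(N)}_\nu(0)F^{(N)}_\mu(0)\big)\to\Sigma_{\mu\nu}$, and $\omega(W^{(N)}(r))\to e^{-\frac12 r\cdot\Sigma r}$ for all $r\in\mathbb R^{d^2}$. For $a\in\mathbb R^{d^2}$ put $\sigma_{\mu\nu}(a)=-i\sum_\alpha\mathrm{Tr}([v_\mu,v_\nu]v_\alpha)\,a_\alpha$,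 and let $\vec\omega=(\omega(v_\alpha^{(0)}))_\alpha$ be the macroscopic averages at time $0$. Fix $t\ge0$. Then: 1. The macroscopic averages at time $t$, $\omega_\alpha(t)=\lim_N\omega\big(\gamma^{(N)}_t[\frac1N\sum_{k<N}v_\alpha^{(k)}]\big)$, exist in $\mathbb R$, and with $\vec\omega_t=(\omega_\alpha(t))_\alpha$ one has $-i\lim_N\omega\big(\gamma_t^{(N)}[\frac1N\sum_{k<N}[v_\mu,v_\nu]^{(k)}]\big)=\sigma_{\mu\nu}(\vec\omega_t)$. 2. $\Sigma+\frac i2\sigma(\vec\omega)\ge0$. Hence there is a Gaussian state $\Omega$ with $\Omega(W(r))=e^{-\frac12r\cdot\Sigma r}$ on the Weyl algebra with relations $W(r)W(s)=e^{-\frac i2r\cdot\sigma(\vec\omega)s}\,W(r+s)$. Let $\mathcal F$ be the closure, in the strong operator topology of the GNS representation of $\Omega$, of the linear span of the Weyl operators. 3. For all $r,s\in\mathbb R^{d^2}$ the mesoscopic limit $\Phi^{\vec\omega}_t[W(r)W(s)]$ of $\gamma^{(N)}_t[W^{(N)}_t(r)W^{(N)}_t(s)]$ exists, i.e. there is exactly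 one element $Y\in\mathcal F$ with $$\Omega\big(W(r_1)\,Y\,W(r_2)\big)=\lim_{N\to\infty}\omega\Big(W^{(N)}(r_1)\,\gamma^{(N)}_t\big[W^{(N)}_t(r)W^{(N)}_t(s)\big]\,W^{(N)}(r_2)\Big)\qquad\text{for all }r_1,r_2\in\mathbb R^{d^2};$$ $\Phi^{\vec\omega}_t[W(r)W(s)]$ denotes this $Y$. 4. For all $r,s\in\mathbb R^{d^2}$, $$\Phi^{\vec\omega}_t[W(r)W(s)]=e^{i\,s\cdot(\sigma(\vec\omega_t)r)}\;\Phi^{\vec\omega}_t[W(s)W(r)].$$ 5. If $\sigma(\vec\omega_t)\ne\sigma(\vec\omega)$, then $\Phi^{\vec\omega}_t$ does not act linearly on the fluctuation algebra: no linear map $L$ on the bounded operators of the GNS space satisfies $L(W(r)W(s))=\Phi^{\vec\omega}_t[W(r)W(s)]$ for all $r,s\in\mathbb R^{d^2}$. -/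

import Mathlib

open Filter Topology Matrix
open scoped ComplexOrder InnerProductSpace

noncomputable section

namespace SpinChain

/-- The Hilbert space `ℓ²` of the configurations `ℤ → {0, …, d - 1}` of the chain. It carries every
one-site matrix at every site, and (see `quasiLocal`) a faithful copy of `⨂_{k ∈ ℤ} M_d(ℂ)`. -/
abbrev ConfigSpace (d : ℕ) : Type := lp (fun _ : ℤ → Fin d => ℂ) 2

theorem memlp_pull {α : Type} (s : Set α) (g : α → α) (hg : Set.InjOn g s)
    (f : lp (fun _ : α => ℂ) 2) :
    Memℓp (s.indicator fun a => f (g a)) 2 ∧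
      (∑' a, ‖s.indicator (fun a => f (g a)) a‖ ^ (2 : ℝ)) ≤ ∑' a, ‖f a‖ ^ (2 : ℝ) := by
  have hs : Summable fun a => ‖f a‖ ^ (2 : ℝ) := by
    simpa using (lp.memℓp f).summable (by norm_num)
  have hinj : Function.Injective fun a : s => g a := fun a b h => Subtype.ext (hg a.2 b.2 h)
  have h1 : Summable fun a : s => ‖f (g a)‖ ^ (2 : ℝ) := hs.comp_injective hinj
  have h2 : (fun a => ‖s.indicator (fun a => f (g a)) a‖ ^ (2 : ℝ)) =
      s.indicator fun a => ‖f (g a)‖ ^ (2 : ℝ) := by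
    ext a
    by_cases ha : a ∈ s <;> simp [ha]
  constructor
  · refine (memℓp_gen_iff (by norm_num)).2 ?_
    have h3 : Summable (s.indicator fun a => ‖f (g a)‖ ^ (2 : ℝ)) :=
      summable_subtype_iff_indicator.1 h1
    rw [← h2] at h3
    simpa only [ENNReal.toReal_ofNat] using h3
  · rw [h2, ← tsum_subtype]
    exact Summable.tsum_le_tsum_of_inj _ hinj (fun _ _ => by positivity) (fun _ => le_rfl) h1 hs

/-- The bounded operator `f ↦ 1_s · (f ∘ g)` for `g` injective on `s`. -/
def pullOp {α : Type} (s : Set α) (g : α → α) (hg : Set.InjOn g s) :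
    lp (fun _ : α => ℂ) 2 →L[ℂ] lp (fun _ : α => ℂ) 2 :=
  LinearMap.mkContinuous
    { toFun := fun f => ⟨s.indicator fun a => f (g a), (memlp_pull s g hg f).1⟩
      map_add' := fun f h => by
        ext a
        change s.indicator (fun a => (f + h) (g a)) a =
          s.indicator (fun a => f (g a)) a + s.indicator (fun a => h (g a)) a
        by_cases ha : a ∈ s <;> simp [ha]
      map_smul' := fun c f => by
        ext a
        by_cases ha : a ∈ s <;> simp [ha] } 1 (by
    intro f
    rw [one_mul, ← Real.rpow_le_rpow_iff (norm_nonneg _) (norm_nonneg _)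
      (by norm_num : (0 : ℝ) < 2)]
    have h := (memlp_pull s g hg f).2
    have e := lp.norm_rpow_eq_tsum (p := 2) (by norm_num) f
    have e' := lp.norm_rpow_eq_tsum (p := 2) (by norm_num)
      (⟨s.indicator fun a => f (g a), (memlp_pull s g hg f).1⟩ : lp (fun _ : α => ℂ) 2)
    simp only [ENNReal.toReal_ofNat] at e e'
    simp only [LinearMap.coe_mk, AddHom.coe_mk]
    rw [e, e']
    exact h)

theorem pullOp_apply {α : Type} (s : Set α) (g : α → α) (hg : Set.InjOn g s)
    (f : lp (fun _ : α => ℂ) 2) (a : α) :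
    pullOp s g hg f a = s.indicator (fun a => f (g a)) a := rfl

theorem injOn_update {d : ℕ} (k : ℤ) (a b : Fin d) :
    Set.InjOn (fun η : ℤ → Fin d => Function.update η k b) {η | η k = a} := by
  intro η hη η' hη' h
  funext j
  by_cases hj : j = k
  · subst hj; exact hη.trans hη'.symm
  · simpa [hj] using congrFun h j

/-- The one-site operator `x^{(k)}`: the matrix `x` acting on the `k`-th tensor factor, i.e.
`(x^{(k)} f) η = ∑ b, x (η k) b * f (η with η k replaced by b)`. -/
def siteOp {d : ℕ} (k : ℤ) (x : Matrix (Fin d) (Fin d) ℂ) :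
    ConfigSpace d →L[ℂ] ConfigSpace d :=
  ∑ a, ∑ b, x a b • pullOp {η : ℤ → Fin d | η k = a} (fun η => Function.update η k b)
    (injOn_update k a b)

theorem siteOp_apply {d : ℕ} (k : ℤ) (x : Matrix (Fin d) (Fin d) ℂ) (f : ConfigSpace d)
    (η : ℤ → Fin d) : siteOp k x f η = ∑ b, x (η k) b * f (Function.update η k b) := by
  simp only [siteOp, _root_.sum_apply, _root_.smul_apply]
  simp only [lp.coeFn_sum, Finset.sum_apply, lp.coeFn_smul, Pi.smul_apply, pullOp_apply, smul_eq_mul,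
    Set.indicator_apply, Set.mem_ofPred_eq]
  rw [Finset.sum_comm]
  simp

/-- The quasi-local algebra of the chain: the norm closure of the `*`-algebra generated by all
one-site matrices. Copies at different sites commute, so the generated `*`-algebra is a copy of
the algebraic tensor product `⨂_{k ∈ ℤ} M_d(ℂ)`; as that has exactly one `C*`-norm, this is the
standard quasi-local algebra. -/
def quasiLocal (d : ℕ) : StarSubalgebra ℂ (ConfigSpace d →L[ℂ] ConfigSpace d) :=
  (StarAlgebra.adjoin ℂ {T | ∃ (k : ℤ) (x : Matrix (Fin d) (Fin d) ℂ),
    T = siteOp k x}).topologicalClosure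

/-- The quasi-local algebra as a type. -/
def QuasiLocal (d : ℕ) : Type := quasiLocal d

instance (d : ℕ) : IsClosed (quasiLocal d : Set (ConfigSpace d →L[ℂ] ConfigSpace d)) :=
  StarSubalgebra.isClosed_topologicalClosure _

instance (d : ℕ) : CStarAlgebra (QuasiLocal d) :=
  inferInstanceAs (CStarAlgebra (quasiLocal d))

variable {d : ℕ}
/-- The copy `x^{(k)}` of the matrix `x` at the site `k`. -/
def site (k : ℤ) (x : Matrix (Fin d) (Fin d) ℂ) : QuasiLocal d :=
  ⟨siteOp k x, StarSubalgebra.le_topologicalClosure _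
    (StarAlgebra.subset_adjoin ℂ _ ⟨k, x, rfl⟩)⟩


theorem pullOp_comp {α : Type} (g g' : α → α) (hg : Set.InjOn g Set.univ)
    (hg' : Set.InjOn g' Set.univ) (h : ∀ a, g' (g a) = a) :
    pullOp Set.univ g hg * pullOp Set.univ g' hg' = 1 := by
  ext f a
  simp [pullOp_apply, h]

theorem star_pullOp {α : Type} (e : α ≃ α) :
    star (pullOp Set.univ e e.injective.injOn) =
      pullOp Set.univ e.symm e.symm.injective.injOn := by
  symm
  rw [ContinuousLinearMap.star_eq_adjoint, ContinuousLinearMap.eq_adjoint_iff]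
  intro f g
  rw [lp.inner_eq_tsum, lp.inner_eq_tsum, ← e.tsum_eq]
  simp [pullOp_apply]

/-- The shift of configurations. -/
def shiftEquiv (d : ℕ) : (ℤ → Fin d) ≃ (ℤ → Fin d) where
  toFun η j := η (j + 1)
  invFun η j := η (j - 1)
  left_inv η := by funext j; simp
  right_inv η := by funext j; simp

/-- The shift as a unitary operator. -/
def shiftUnitary (d : ℕ) : unitary (ConfigSpace d →L[ℂ] ConfigSpace d) :=
  ⟨pullOp Set.univ (shiftEquiv d) (shiftEquiv d).injective.injOn, by
    rw [Unitary.mem_iff, star_pullOp]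
    exact ⟨pullOp_comp _ _ _ _ (shiftEquiv d).apply_symm_apply,
      pullOp_comp _ _ _ _ (shiftEquiv d).symm_apply_apply⟩⟩

/-- Conjugation by the shift. -/
def shiftConj (d : ℕ) : (ConfigSpace d →L[ℂ] ConfigSpace d) ≃⋆ₐ[ℂ]
    (ConfigSpace d →L[ℂ] ConfigSpace d) :=
  Unitary.conjStarAlgAut ℂ _ (shiftUnitary d)

theorem shiftConj_siteOp (k : ℤ) (x : Matrix (Fin d) (Fin d) ℂ) :
    shiftConj d (siteOp k x) = siteOp (k + 1) x := by
  ext f η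
  have h : ∀ b, (shiftEquiv d).symm (Function.update (shiftEquiv d η) k b) =
      Function.update η (k + 1) b := by
    intro b
    funext j
    by_cases hj : j = k + 1
    · subst hj; simp [shiftEquiv]
    · have : j - 1 ≠ k := fun h => hj (by omega)
      simp [shiftEquiv, hj, this]
  rw [shiftConj, Unitary.conjStarAlgAut_apply, shiftUnitary]
  simp only [star_pullOp]
  change pullOp Set.univ (shiftEquiv d) (shiftEquiv d).injective.injOn (siteOp k x
    (pullOp Set.univ (shiftEquiv d).symm (shiftEquiv d).symm.injective.injOn f)) η = _
  simp only [pullOp_apply, siteOp_apply, Set.indicator_univ, h]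
  rfl

theorem shiftConj_mem {T : ConfigSpace d →L[ℂ] ConfigSpace d} (hT : T ∈ quasiLocal d) :
    shiftConj d T ∈ quasiLocal d := by
  have hc : Continuous (shiftConj d) := by
    have : (shiftConj d : _ → ConfigSpace d →L[ℂ] ConfigSpace d) = fun T =>
      (shiftUnitary d : ConfigSpace d →L[ℂ] ConfigSpace d) * T *
        star (shiftUnitary d : ConfigSpace d →L[ℂ] ConfigSpace d) := by
      funext T
      exact Unitary.conjStarAlgAut_apply _ _
    rw [this]
    fun_prop
  have h1 : (quasiLocal d) ≤ (quasiLocal d).comap (shiftConj d : _ →⋆ₐ[ℂ] _) := by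
    refine StarSubalgebra.topologicalClosure_minimal ?_ ?_
    · refine StarAlgebra.adjoin_le ?_
      rintro _ ⟨k, x, rfl⟩
      show shiftConj d (siteOp k x) ∈ quasiLocal d
      rw [shiftConj_siteOp]
      exact (site (k + 1) x).2
    · exact (StarSubalgebra.isClosed_topologicalClosure _).preimage hc
  exact h1 hT

/-- The translation automorphism of the quasi-local algebra, `x^{(k)} ↦ x^{(k + 1)}`. -/
def translation (d : ℕ) : QuasiLocal d →⋆ₐ[ℂ] QuasiLocal d :=
  StarAlgHom.codRestrict ((shiftConj d : (ConfigSpace d →L[ℂ] ConfigSpace d) →⋆ₐ[ℂ]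
    (ConfigSpace d →L[ℂ] ConfigSpace d)).comp (quasiLocal d).subtype) (quasiLocal d)
    fun T => shiftConj_mem T.2

theorem translation_site (k : ℤ) (x : Matrix (Fin d) (Fin d) ℂ) :
    translation d (site k x) = site (k + 1) x :=
  Subtype.ext (shiftConj_siteOp k x)

end SpinChain

namespace SpinChain

/-- The data of a Gaussian (quasi-free) state on the Weyl algebra over `ℝ^p`: the symplectic matrix
`σ`, the covariance matrix `Σ`, and the positivity `Σ + (i / 2) σ ≥ 0` which makes
`W(r) ↦ exp (-½ r · Σ r)` a state; it includes that `Σ` is symmetric and `σ` antisymmetric. -/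
structure GaussianState (p : ℕ) where
  symp : Matrix (Fin p) (Fin p) ℝ
  cov : Matrix (Fin p) (Fin p) ℝ
  pos : (Matrix.of fun i j => (cov i j : ℂ) + Complex.I / 2 * (symp i j : ℂ)).PosSemidef

namespace GaussianState
variable {p : ℕ} (Q : GaussianState p)

theorem cov_symm (i j : Fin p) : Q.cov j i = Q.cov i j := by
  have h := congrArg Complex.re (Q.pos.isHermitian.apply i j)
  simpa using h

theorem symp_antisymm (i j : Fin p) : Q.symp j i = -Q.symp i j := by
  have h := congrArg Complex.im (Q.pos.isHermitian.apply i j)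
  simp at h
  linarith

theorem dot_cov_comm (r s : Fin p → ℝ) : r ⬝ᵥ Q.cov *ᵥ s = s ⬝ᵥ Q.cov *ᵥ r := by
  have : Q.covᵀ = Q.cov := by ext i j; exact Q.cov_symm i j
  rw [dotProduct_mulVec, ← mulVec_transpose, this, dotProduct_comm]

theorem dot_symp_comm (r s : Fin p → ℝ) : r ⬝ᵥ Q.symp *ᵥ s = -(s ⬝ᵥ Q.symp *ᵥ r) := by
  have : Q.sympᵀ = -Q.symp := by ext i j; exact Q.symp_antisymm i j
  rw [dotProduct_mulVec, ← mulVec_transpose, this, dotProduct_comm, neg_mulVec, dotProduct_neg]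

/-- The kernel `Ω(W(r)* W(s)) = exp ((i / 2) r · σ s - ½ (s - r) · Σ (s - r))`. -/
def kernel : Matrix (Fin p → ℝ) (Fin p → ℝ) ℂ := Matrix.of fun r s =>
  Complex.exp (Complex.I / 2 * ((r ⬝ᵥ Q.symp *ᵥ s : ℝ) : ℂ)
    - (((s - r) ⬝ᵥ Q.cov *ᵥ (s - r) : ℝ) : ℂ) / 2)

/-- The positive sesquilinear form `r · Σ s + (i / 2) r · σ s`. -/
def bilin : Matrix (Fin p → ℝ) (Fin p → ℝ) ℂ := Matrix.of fun r s =>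
  ((r ⬝ᵥ Q.cov *ᵥ s : ℝ) : ℂ) + Complex.I / 2 * ((r ⬝ᵥ Q.symp *ᵥ s : ℝ) : ℂ)

theorem posSemidef_of_finset {X : Type} {M : Matrix X X ℂ}
    (h : ∀ s : Finset X, (M.submatrix ((↑) : s → X) (↑)).PosSemidef) : M.PosSemidef := by
  classical
  refine ⟨?_, fun x => ?_⟩
  · ext a b
    exact congrFun (congrFun (h {a, b}).isHermitian ⟨a, by simp⟩) ⟨b, by simp⟩
  · simpa [Finsupp.sum, ← Finset.sum_attach x.support, ← Finset.subtype_mem_eq_attach,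
      ← Finsupp.subtypeDomain_apply, ← Finsupp.support_subtypeDomain] using
      (h x.support).2 (x.subtypeDomain (· ∈ x.support))

theorem bilin_posSemidef : Q.bilin.PosSemidef := by
  refine posSemidef_of_finset fun s => ?_
  have h := Q.pos.conjTranspose_mul_mul_same
    (Matrix.of fun (i : Fin p) (r : s) => ((r : Fin p → ℝ) i : ℂ))
  convert h using 1
  ext r t
  simp only [submatrix_apply, bilin, of_apply, mul_apply, conjTranspose_apply, Complex.star_def,
    Complex.conj_ofReal, dotProduct, mulVec, Complex.ofReal_sum, Complex.ofReal_mul,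
    Finset.mul_sum, Finset.sum_mul, ← Finset.sum_add_distrib]
  rw [Finset.sum_comm]
  refine Finset.sum_congr rfl fun i _ => Finset.sum_congr rfl fun j _ => ?_
  ring

theorem rankOne_posSemidef {X : Type} (a : X → ℂ) : (vecMulVec (star a) a).PosSemidef :=
  posSemidef_of_finset fun s => posSemidef_vecMulVec_star_self fun x : s => a x

theorem posSemidef_exp {X : Type} {M : Matrix X X ℂ} (hM : M.PosSemidef) :
    (Matrix.of fun x y => Complex.exp (M x y)).PosSemidef := by
  have hpow : ∀ n : ℕ, (Matrix.of fun x y => M x y ^ n).PosSemidef := by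
    intro n
    induction n with
    | zero =>
      have h := rankOne_posSemidef (X := X) (fun _ => 1)
      have e : (Matrix.of fun x y => M x y ^ 0) = vecMulVec (star fun _ : X => (1 : ℂ)) fun _ => 1 := by
        ext; simp [vecMulVec_apply]
      exact e ▸ h
    | succ n ih =>
      have e : (Matrix.of fun x y => M x y ^ (n + 1)) = (Matrix.of fun x y => M x y ^ n) ⊙ M := by
        ext; simp [pow_succ]
      exact e ▸ ih.hadamard hM
  refine ⟨?_, fun f => ?_⟩
  · ext x y
    have h := hM.isHermitian.apply x y
    simp only [Complex.star_def] at h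
    simp only [conjTranspose_apply, of_apply, Complex.star_def, ← Complex.exp_conj, h]
  · have hs : HasSum (fun n : ℕ => ((n.factorial : ℂ))⁻¹ * (f.sum fun i xi => f.sum fun j xj =>
        star xi * (Matrix.of fun x y => M x y ^ n) i j * xj))
        (f.sum fun i xi => f.sum fun j xj =>
          star xi * (Matrix.of fun x y => Complex.exp (M x y)) i j * xj) := by
      simp only [Finsupp.sum, of_apply, Finset.mul_sum]
      refine hasSum_sum fun i _ => hasSum_sum fun j _ => ?_
      have h := NormedSpace.expSeries_div_hasSum_exp (M i j)
      rw [← Complex.exp_eq_exp_ℂ] at h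
      have h2 := (h.mul_left (star (f i))).mul_right (f j)
      have e : (fun n : ℕ => ((n.factorial : ℂ))⁻¹ * (star (f i) * M i j ^ n * f j)) =
          fun n : ℕ => star (f i) * (M i j ^ n / (n.factorial : ℂ)) * f j := by
        funext n; ring
      rw [e]
      exact h2
    refine hs.nonneg fun n => mul_nonneg ?_ ((hpow n).2 f)
    rw [← Complex.ofReal_natCast, ← Complex.ofReal_inv]
    exact Complex.zero_le_real.2 (by positivity)

theorem kernel_posSemidef : Q.kernel.PosSemidef := by
  have h := (rankOne_posSemidef fun r : Fin p → ℝ =>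
    ((Real.exp (-(r ⬝ᵥ Q.cov *ᵥ r) / 2) : ℝ) : ℂ)).hadamard (posSemidef_exp Q.bilin_posSemidef)
  refine (?_ : Q.kernel = _) ▸ h
  ext r s
  have e : (s - r) ⬝ᵥ Q.cov *ᵥ (s - r) = s ⬝ᵥ Q.cov *ᵥ s - 2 * (r ⬝ᵥ Q.cov *ᵥ s)
      + r ⬝ᵥ Q.cov *ᵥ r := by
    simp only [mulVec_sub, sub_dotProduct, dotProduct_sub]
    rw [Q.dot_cov_comm s r]; ring
  simp only [kernel, bilin, hadamard_apply, of_apply, vecMulVec_apply, Pi.star_apply,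
    Complex.star_def, Complex.conj_ofReal]
  simp only [Complex.ofReal_exp, ← Complex.exp_add, e]
  congr 1
  push_cast
  ring

/-- The GNS space before completion: formal linear combinations of the vectors `W(r) Ω`. -/
def PreGNS (_ : GaussianState p) : Type := (Fin p → ℝ) →₀ ℂ

instance : AddCommGroup Q.PreGNS := inferInstanceAs (AddCommGroup ((Fin p → ℝ) →₀ ℂ))
instance : Module ℂ Q.PreGNS := inferInstanceAs (Module ℂ ((Fin p → ℝ) →₀ ℂ))

/-- The GNS scalar product. -/
@[reducible]
def preGNSCore : PreInnerProductSpace.Core ℂ ((Fin p → ℝ) →₀ ℂ) where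
  inner f g := f.sum fun r a => g.sum fun s b => star a * Q.kernel r s * b
  conj_inner_symm f g := by
    simp only [Finsupp.sum, map_sum, map_mul, Complex.star_def, Complex.conj_conj]
    rw [Finset.sum_comm]
    refine Finset.sum_congr rfl fun r _ => Finset.sum_congr rfl fun s _ => ?_
    have h := Q.kernel_posSemidef.isHermitian.apply r s
    rw [Complex.star_def] at h
    rw [h]; ring
  re_inner_nonneg f := (Complex.nonneg_iff.1 (Q.kernel_posSemidef.2 f)).1
  add_left f g h := by
    refine Finsupp.sum_add_index' (fun _ => by simp) (fun r a b => ?_)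
    simp [add_mul, Finsupp.sum_add]
  smul_left f g c := by
    refine (Finsupp.sum_smul_index (fun _ => by simp)).trans ?_
    simp [Finsupp.sum, Finset.mul_sum, mul_assoc]

instance : PreInnerProductSpace.Core ℂ Q.PreGNS := Q.preGNSCore

instance : SeminormedAddCommGroup Q.PreGNS :=
  InnerProductSpace.Core.toSeminormedAddCommGroup (𝕜 := ℂ)
instance : InnerProductSpace ℂ Q.PreGNS := InnerProductSpace.ofCore _

theorem inner_preGNS (f g : Q.PreGNS) : ⟪f, g⟫_ℂ =
    Finsupp.sum f fun r a => Finsupp.sum g fun s b => star a * Q.kernel r s * b := rfl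

/-- The GNS Hilbert space of the Gaussian state. -/
abbrev Space : Type := UniformSpace.Completion Q.PreGNS

/-- The vector `W(s) Ω`. -/
def delta (s : Fin p → ℝ) : Q.PreGNS := Finsupp.single s (1 : ℂ)

theorem inner_delta (r s : Fin p → ℝ) : ⟪Q.delta r, Q.delta s⟫_ℂ = Q.kernel r s := by
  rw [inner_preGNS]
  simp [delta]

/-- The phase in the Weyl relations. -/
def weylPhase (r s : Fin p → ℝ) : ℂ := Complex.exp (-(Complex.I / 2) * ((r ⬝ᵥ Q.symp *ᵥ s : ℝ) : ℂ))

/-- The Weyl operator on the vectors `W(s) Ω`. -/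
def preWeylₗ (r : Fin p → ℝ) : Q.PreGNS →ₗ[ℂ] Q.PreGNS :=
  Finsupp.linearCombination ℂ fun s => Q.weylPhase r s • Q.delta (r + s)

theorem preWeylₗ_delta (r s : Fin p → ℝ) :
    Q.preWeylₗ r (Q.delta s) = Q.weylPhase r s • Q.delta (r + s) := by
  exact (Finsupp.linearCombination_single ℂ 1 s).trans (one_smul ℂ _)

theorem span_delta : Submodule.span ℂ (Set.range Q.delta) = ⊤ := by
  refine eq_top_iff.2 fun f _ => ?_
  have h : f = Finsupp.sum f fun s c => c • Q.delta s := by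
    refine Eq.symm ?_
    have : ∀ s (c : ℂ), c • Q.delta s = (Finsupp.single s c : (Fin p → ℝ) →₀ ℂ) := by
      intro s c
      exact (Finsupp.smul_single _ _ _).trans (by simp)
    simp only [this]
    exact Finsupp.sum_single f
  rw [h]
  exact Submodule.sum_mem _ fun s _ => Submodule.smul_mem _ _ (Submodule.subset_span ⟨s, rfl⟩)

theorem inner_preWeyl (r : Fin p → ℝ) (f g : Q.PreGNS) :
    ⟪Q.preWeylₗ r f, Q.preWeylₗ r g⟫_ℂ = ⟪f, g⟫_ℂ := by
  have hf : f ∈ Submodule.span ℂ (Set.range Q.delta) := by rw [span_delta]; trivial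
  have hg : g ∈ Submodule.span ℂ (Set.range Q.delta) := by rw [span_delta]; trivial
  induction hf, hg using Submodule.span_induction₂ with
  | mem_mem x y hx hy =>
    obtain ⟨s, rfl⟩ := hx
    obtain ⟨t, rfl⟩ := hy
    rw [preWeylₗ_delta, preWeylₗ_delta, inner_smul_left, inner_smul_right, inner_delta,
      inner_delta, weylPhase, weylPhase, ← Complex.exp_conj]
    simp only [kernel, of_apply, ← Complex.exp_add]
    congr 1
    simp only [mulVec_add, add_dotProduct, dotProduct_add, add_sub_add_left_eq_sub,
      Q.dot_symp_comm s r]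
    have h0 : r ⬝ᵥ Q.symp *ᵥ r = 0 := by have := Q.dot_symp_comm r r; linarith
    have h2 : (starRingEnd ℂ) (Complex.I / 2) = -(Complex.I / 2) := by
      rw [map_div₀, Complex.conj_I, Complex.conj_ofNat, neg_div]
    simp only [map_mul, map_neg, h2, Complex.conj_ofReal, h0]
    push_cast
    ring
  | zero_left y hy => simp
  | zero_right y hy => simp
  | add_left x y z _ _ _ h1 h2 => simp [inner_add_left, h1, h2]
  | add_right x y z _ _ _ h1 h2 => simp [inner_add_right, h1, h2]
  | smul_left c x y _ _ h => simp [inner_smul_left, h]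
  | smul_right c x y _ _ h => simp [inner_smul_right, h]

/-- The Weyl operator before completion. -/
def preWeyl (r : Fin p → ℝ) : Q.PreGNS →L[ℂ] Q.PreGNS :=
  (Q.preWeylₗ r).mkContinuous 1 fun f => by
    rw [one_mul, norm_eq_sqrt_re_inner (𝕜 := ℂ), norm_eq_sqrt_re_inner (𝕜 := ℂ) f,
      inner_preWeyl]

/-- The Weyl operator `W(r)` on the GNS space. -/
def weyl (r : Fin p → ℝ) : Q.Space →L[ℂ] Q.Space := (Q.preWeyl r).completion

/-- The cyclic vector of the GNS representation. -/
def vacuum : Q.Space := ((Q.delta 0 : Q.PreGNS) : Q.Space)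

/-- The expectation in the Gaussian state. -/
def expect (X : Q.Space →L[ℂ] Q.Space) : ℂ := ⟪Q.vacuum, X Q.vacuum⟫_ℂ

theorem weyl_delta (r s : Fin p → ℝ) :
    Q.weyl r (Q.delta s : Q.Space) = (Q.weylPhase r s • (Q.delta (r + s) : Q.Space) : Q.Space) := by
  rw [weyl, ContinuousLinearMap.completion_apply_coe, ← UniformSpace.Completion.coe_smul]
  exact congrArg _ (Q.preWeylₗ_delta r s)

theorem weyl_vacuum (r : Fin p → ℝ) : Q.weyl r Q.vacuum = (Q.delta r : Q.Space) := by
  rw [vacuum, weyl_delta]; simp [weylPhase]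

theorem ext_delta {T U : Q.Space →L[ℂ] Q.Space}
    (h : ∀ s, T (Q.delta s : Q.Space) = U (Q.delta s : Q.Space)) : T = U := by
  ext x
  induction x using UniformSpace.Completion.induction_on with
  | hp => exact isClosed_eq T.continuous U.continuous
  | ih f =>
    have hf : f ∈ Submodule.span ℂ (Set.range Q.delta) := by rw [span_delta]; trivial
    induction hf using Submodule.span_induction with
    | mem x hx => obtain ⟨s, rfl⟩ := hx; exact h s
    | zero => simp [UniformSpace.Completion.coe_zero]
    | add x y _ _ h1 h2 => simp [UniformSpace.Completion.coe_add, h1, h2]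
    | smul c x _ h1 => simp [UniformSpace.Completion.coe_smul, h1]

/-- The Weyl relations. -/
theorem weyl_mul (r s : Fin p → ℝ) : Q.weyl r * Q.weyl s =
    Complex.exp (-(Complex.I / 2) * ((r ⬝ᵥ Q.symp *ᵥ s : ℝ) : ℂ)) • Q.weyl (r + s) := by
  refine Q.ext_delta fun t => ?_
  change Q.weyl r (Q.weyl s (Q.delta t : Q.Space)) =
    Complex.exp (-(Complex.I / 2) * ((r ⬝ᵥ Q.symp *ᵥ s : ℝ) : ℂ)) •
      Q.weyl (r + s) (Q.delta t : Q.Space)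
  rw [weyl_delta, weyl_delta, map_smul, weyl_delta, smul_smul, smul_smul, add_assoc]
  congr 1
  simp only [weylPhase, ← Complex.exp_add, mulVec_add, add_dotProduct, dotProduct_add]
  congr 1
  push_cast
  ring

theorem weyl_zero : Q.weyl 0 = 1 := by
  refine Q.ext_delta fun t => ?_
  simp [weyl_delta, weylPhase]

theorem star_weyl (r : Fin p → ℝ) : star (Q.weyl r) = Q.weyl (-r) := by
  rw [ContinuousLinearMap.star_eq_adjoint]
  have h1 : ∀ x y, ⟪Q.weyl r x, Q.weyl r y⟫_ℂ = ⟪x, y⟫_ℂ := by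
    intro x y
    induction x, y using UniformSpace.Completion.induction_on₂ with
    | hp => apply isClosed_eq <;> fun_prop
    | ih f g =>
      simp only [weyl, ContinuousLinearMap.completion_apply_coe, UniformSpace.Completion.inner_coe]
      exact Q.inner_preWeyl r f g
  have h2 : Q.weyl r * Q.weyl (-r) = 1 := by
    have h0 : r ⬝ᵥ Q.symp *ᵥ r = 0 := by have := Q.dot_symp_comm r r; linarith
    rw [weyl_mul, add_neg_cancel, weyl_zero]
    simp [mulVec_neg, h0]
  symm
  rw [ContinuousLinearMap.eq_adjoint_iff]
  intro x y
  rw [← h1, ← mul_apply_eq_comp, h2, one_apply_eq_self]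

/-- The Gaussian state on the Weyl operators. -/
theorem expect_weyl (r : Fin p → ℝ) :
    Q.expect (Q.weyl r) = Complex.exp (-((r ⬝ᵥ Q.cov *ᵥ r : ℝ) : ℂ) / 2) := by
  rw [expect, weyl_vacuum, vacuum, UniformSpace.Completion.inner_coe, inner_delta]
  simp [kernel, neg_div]

/-- The vacuum is cyclic for the Weyl operators. -/
theorem cyclic : Dense (Submodule.span ℂ (Set.range fun r => Q.weyl r Q.vacuum) : Set Q.Space) := by
  have h : (fun r => Q.weyl r Q.vacuum) =
      (UniformSpace.Completion.toComplₗᵢ : Q.PreGNS →ₗᵢ[ℂ] Q.Space).toLinearMap ∘ Q.delta := by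
    funext r; exact Q.weyl_vacuum r
  rw [h, Set.range_comp, ← Submodule.map_span, span_delta, Submodule.map_top]
  exact UniformSpace.Completion.denseRange_coe

/-- The algebra of quantum fluctuations: the closure, for the strong operator topology (pointwise
convergence on the GNS space), of the linear span of the Weyl operators. -/
def fluctuationAlgebra : Set (Q.Space →L[ℂ] Q.Space) :=
  {X | (X : Q.Space → Q.Space) ∈ closure ((fun Y : Q.Space →L[ℂ] Q.Space => (Y : Q.Space → Q.Space)) ''
    (Submodule.span ℂ (Set.range Q.weyl)))}

end GaussianState
end SpinChain

namespace SpinChain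

variable {d : ℕ}

/-- The defining properties of a Hermitian orthonormal basis of `M_d(ℂ)` for the Hilbert-Schmidt
scalar product (there are as many elements as the dimension `d ^ 2`). -/
structure IsHermitianOrthonormal (v : Fin (d ^ 2) → Matrix (Fin d) (Fin d) ℂ) : Prop where
  isHermitian : ∀ μ, (v μ).IsHermitian
  trace_mul : ∀ μ ν, (v μ * v ν).trace = if μ = ν then 1 else 0

/-- A state: a positive, normalised linear functional on the quasi-local algebra. -/
structure IsState (ω : QuasiLocal d →ₗ[ℂ] ℂ) : Prop where
  nonneg : ∀ a, 0 ≤ ω (star a * a)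
  map_one : ω 1 = 1

/-- Invariance of the state under translations of the chain. -/
def IsTranslationInvariant (ω : QuasiLocal d →ₗ[ℂ] ℂ) : Prop :=
  ∀ a, ω (translation d a) = ω a

/-- `L¹`-clustering: two-point correlations of one-site observables are absolutely summable. -/
def L1Clustering (ω : QuasiLocal d →ₗ[ℂ] ℂ) : Prop :=
  ∀ x y : Matrix (Fin d) (Fin d) ℂ,
    Summable fun l : ℤ => ‖ω (site 0 x * site l y) - ω (site 0 x) * ω (site 0 y)‖

/-- The sum of the copies of `x` at the sites `0, …, N - 1`. -/
def total (N : ℕ) (x : Matrix (Fin d) (Fin d) ℂ) : QuasiLocal d :=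
  ∑ k ∈ Finset.range N, site (k : ℤ) x

/-- The mean-field observable `(1 / N) ∑_{k < N} x^{(k)}`. -/
def meanField (N : ℕ) (x : Matrix (Fin d) (Fin d) ℂ) : QuasiLocal d :=
  (N : ℂ)⁻¹ • total N x

/-- The collective operator `(1 / √N) ∑_{k < N} x^{(k)}`. -/
def collective (N : ℕ) (x : Matrix (Fin d) (Fin d) ℂ) : QuasiLocal d :=
  ((Real.sqrt N : ℝ) : ℂ)⁻¹ • total N x

/-- The Hamiltonian
`∑_μ ε_μ ∑_k v_μ^{(k)} + ∑_{μν} h_{μν} (1 / N) (∑_k v_μ^{(k)}) (∑_l v_ν^{(l)})`. -/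
def hamiltonian (v : Fin (d ^ 2) → Matrix (Fin d) (Fin d) ℂ) (ε : Fin (d ^ 2) → ℝ)
    (h : Matrix (Fin (d ^ 2)) (Fin (d ^ 2)) ℂ) (N : ℕ) : QuasiLocal d :=
  (∑ μ, (ε μ : ℂ) • total N (v μ)) +
    ∑ μ, ∑ ν, h μ ν • ((N : ℂ)⁻¹ • (total N (v μ) * total N (v ν)))

/-- The commutator `x ↦ [a, x]` as a bounded linear map. -/
def commL (a : QuasiLocal d) : QuasiLocal d →L[ℂ] QuasiLocal d :=
  ContinuousLinearMap.mul ℂ (QuasiLocal d) a - (ContinuousLinearMap.mul ℂ (QuasiLocal d)).flip a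

theorem commL_apply (a x : QuasiLocal d) : commL a x = a * x - x * a := rfl

/-- The bounded linear map `x ↦ [a, x] b + a [x, b]`. -/
def dissL (a b : QuasiLocal d) : QuasiLocal d →L[ℂ] QuasiLocal d :=
  (ContinuousLinearMap.mul ℂ (QuasiLocal d)).flip b ∘L commL a -
    ContinuousLinearMap.mul ℂ (QuasiLocal d) a ∘L commL b

theorem dissL_apply (a b x : QuasiLocal d) :
    dissL a b x = (a * x - x * a) * b + a * (x * b - b * x) := by
  change (a * x - x * a) * b - a * (b * x - x * b) = _
  noncomm_ring

/-- The Lindblad generator (in the Heisenberg picture) of the chain of size `N`. -/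
def lindbladian (v : Fin (d ^ 2) → Matrix (Fin d) (Fin d) ℂ) (ε : Fin (d ^ 2) → ℝ)
    (h C : Matrix (Fin (d ^ 2)) (Fin (d ^ 2)) ℂ) (N : ℕ) : QuasiLocal d →L[ℂ] QuasiLocal d :=
  Complex.I • commL (hamiltonian v ε h N) +
    ∑ μ, ∑ ν, (C μ ν / 2) • dissL (collective N (v μ)) (collective N (v ν))

theorem lindbladian_apply (v : Fin (d ^ 2) → Matrix (Fin d) (Fin d) ℂ) (ε : Fin (d ^ 2) → ℝ)
    (h C : Matrix (Fin (d ^ 2)) (Fin (d ^ 2)) ℂ) (N : ℕ) (x : QuasiLocal d) :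
    lindbladian v ε h C N x =
      Complex.I • (hamiltonian v ε h N * x - x * hamiltonian v ε h N) +
      ∑ μ, ∑ ν, (C μ ν / 2) •
        ((collective N (v μ) * x - x * collective N (v μ)) * collective N (v ν) +
          collective N (v μ) * (x * collective N (v ν) - collective N (v ν) * x)) := by
  simp [lindbladian, commL_apply, dissL_apply]

/-- The microscopic dynamics `γ_t = exp (t 𝕃)` of the chain of size `N`. -/
def dynamics (v : Fin (d ^ 2) → Matrix (Fin d) (Fin d) ℂ) (ε : Fin (d ^ 2) → ℝ)
    (h C : Matrix (Fin (d ^ 2)) (Fin (d ^ 2)) ℂ) (N : ℕ) (t : ℝ) :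
    QuasiLocal d →L[ℂ] QuasiLocal d :=
  NormedSpace.exp ((t : ℂ) • lindbladian v ε h C N)

/-- The local fluctuation `(1 / √N) ∑_{k < N} (x^{(k)} - φ (x^{(k)}))`, centred with respect to the
mean values given by `φ`. -/
def localFluct (φ : QuasiLocal d → ℂ) (N : ℕ) (x : Matrix (Fin d) (Fin d) ℂ) : QuasiLocal d :=
  ((Real.sqrt N : ℝ) : ℂ)⁻¹ • ∑ k ∈ Finset.range N, (site (k : ℤ) x - φ (site (k : ℤ) x) • 1)

/-- The local exponential `exp (i ∑_μ r_μ F_μ)` of the fluctuations of the `v_μ`, centred with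
respect to `φ`. -/
def localWeyl (v : Fin (d ^ 2) → Matrix (Fin d) (Fin d) ℂ) (φ : QuasiLocal d → ℂ) (N : ℕ)
    (r : Fin (d ^ 2) → ℝ) : QuasiLocal d :=
  NormedSpace.exp (Complex.I • ∑ μ, (r μ : ℂ) • localFluct φ N (v μ))

/-- The fluctuations of the `v_μ` in the state `ω` are normal (jointly Gaussian in the limit), with
covariance matrix `S`. -/
structure NormalFluctuations (v : Fin (d ^ 2) → Matrix (Fin d) (Fin d) ℂ)
    (ω : QuasiLocal d →ₗ[ℂ] ℂ) (S : Matrix (Fin (d ^ 2)) (Fin (d ^ 2)) ℝ) : Prop where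
  covariance : ∀ μ ν, Tendsto (fun N : ℕ => ω (localFluct ω N (v μ) * localFluct ω N (v ν) +
    localFluct ω N (v ν) * localFluct ω N (v μ)) / 2) atTop (𝓝 (S μ ν : ℂ))
  gaussian : ∀ r : Fin (d ^ 2) → ℝ, Tendsto (fun N : ℕ => ω (localWeyl v ω N r)) atTop
    (𝓝 (Complex.exp (-((r ⬝ᵥ S *ᵥ r : ℝ) : ℂ) / 2)))

/-- The matrix `σ_{μν}(a) = -i ∑_α Tr([v_μ, v_ν] v_α) a_α`, for a vector `a` of values of the
macroscopic averages; it is real as the traces are imaginary for Hermitian `v_μ`. -/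
def symplecticMatrix (v : Fin (d ^ 2) → Matrix (Fin d) (Fin d) ℂ) (a : Fin (d ^ 2) → ℝ) :
    Matrix (Fin (d ^ 2)) (Fin (d ^ 2)) ℝ :=
  Matrix.of fun μ ν =>
    (-Complex.I * ∑ α, ((v μ * v ν - v ν * v μ) * v α).trace * (a α : ℂ)).re

/-- The macroscopic averages at time `0`, which by translation invariance are the one-site
expectations `ω (v_α^{(0)})`. -/
def initialAverages (v : Fin (d ^ 2) → Matrix (Fin d) (Fin d) ℂ) (ω : QuasiLocal d →ₗ[ℂ] ℂ) :
    Fin (d ^ 2) → ℝ :=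
  fun α => (ω (site 0 (v α))).re

/-- `Y` is the mesoscopic limit of the sequence `X`: an element of the quantum fluctuation algebra
all of whose matrix elements between Weyl operators are the limits of the microscopic ones. -/
structure IsMesoscopicLimit (v : Fin (d ^ 2) → Matrix (Fin d) (Fin d) ℂ)
    (ω : QuasiLocal d →ₗ[ℂ] ℂ) (Q : GaussianState (d ^ 2)) (X : ℕ → QuasiLocal d)
    (Y : Q.Space →L[ℂ] Q.Space) : Prop where
  mem : Y ∈ Q.fluctuationAlgebra
  tendsto : ∀ r₁ r₂ : Fin (d ^ 2) → ℝ,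
    Tendsto (fun N => ω (localWeyl v ω N r₁ * X N * localWeyl v ω N r₂)) atTop
      (𝓝 (Q.expect (Q.weyl r₁ * Y * Q.weyl r₂)))

/-- The local exponentials `W_t^{(N)}(r)` of the fluctuations at time `t`, which are centred with
respect to the evolved state `ω ∘ γ_t`. -/
def localWeylAt (v : Fin (d ^ 2) → Matrix (Fin d) (Fin d) ℂ) (ε : Fin (d ^ 2) → ℝ)
    (h C : Matrix (Fin (d ^ 2)) (Fin (d ^ 2)) ℂ) (ω : QuasiLocal d →ₗ[ℂ] ℂ) (t : ℝ) (N : ℕ)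
    (r : Fin (d ^ 2) → ℝ) : QuasiLocal d :=
  localWeyl v (fun a => ω (dynamics v ε h C N t a)) N r

end SpinChain

end

/-!
A chain of `N` sites enters only through its collective operators `V_μ = N^{-1/2} ∑ k, v_μ^{(k)}`.
With `n = √N` they satisfy `[V_α, V_β] = (i / n) ∑ γ, k_{αβγ} V_γ`, have norm `O(n)`, and the
generator is built from the commutators with them (`IsMFSystem`, `isMFSystem_chain`). Everything
about the dynamics is proved for such mean-field systems, with errors `=O[⊤]` that are uniform in
`n` and in the time `s ∈ [0, t]`.

**Fluctuations stay bounded.** For unitary `b` the functional `φ_s(x) = ω(b* γ_s(x) b)` is a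
state, because `γ_s` is a limit of Kraus maps (`dynamics_mem_closure`). If the centring `a` of the
fluctuations `F_μ = V_μ - n a_μ` follows the drift, the sum of the second moments `φ_s(F_μ ^ 2)`
obeys a linear differential inequality with constants independent of `n`
(`isBigO_deriv_secondMoment`), and Grönwall's inequality gives uniform bounds (`sBig_evolved`).
With the exact averages as centring this shows that they solve the mean-field equation `a' =
meanFieldVF a` up to `O(n^{-2})`, hence converge to its solution at this rate
(`exists_meanField_limit`); so they can be replaced by the solution at the cost of a phase `exp (i
O(1 / n))` in the local exponentials.

**Local exponentials are transported.** In `exp (-i r·F) 𝕃[exp (i r·F)]` the terms of order `n`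
are those of the mean-field drift, the terms linear in `F` define a linear flow of the label `r`
(`labelVF`), and the terms of order zero are numbers (`rate`). So if `a` and `r` follow these
flows, `f(s) ω(A* γ_s(exp (i r(s)·F)) B)`, where `f` solves `f' = -rate · f`, has a derivative of
order `1 / n` (`isBigO_gen_expI`). This is where two-positivity of `γ_s` is used: it bounds the
mixed functional `ω(A* γ_s(x* y) B)` by two states (`cross_cauchy_schwarz`, `IsCross`). Thus
`γ_t(exp (i q·F))` acts in the limit as a non-zero multiple of `W(T q)`
(`exists_mesoscopic_limit`).

**Weyl relations.** Products of two local exponentials satisfy the Weyl relation up to `O(1 / n)`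
(`isBigO_expI_mul_expI`), with the symplectic form given by the averages in the state at hand. At
time zero this yields the matrix elements of the Weyl operators of the Gaussian state. At time `t`
it shows that `Φ_t[W(r) W(s)] = exp (i s·σ(ω_t) r / 2) z(r + s) W(T (r + s))`, which is an element
of the fluctuation algebra, unique as the vacuum is cyclic. The relation under exchange of `r` and
`s` is then immediate, and a linear map `L` as in the last claim would have to respect the phases
of both `σ(ω_0)` and `σ(ω_t)`, which forces `σ(ω_t) = σ(ω_0)` (`GaussianState.symp_eq_of_linear`).
-/

noncomputable section

namespace SpinChain

open Asymptotics

/-! ### States and their seminorms -/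

section States
variable {A : Type*} [CStarAlgebra A]

/-- A positive normalised linear functional on a unital `C*`-algebra. -/
structure IsPosUnital (φ : A →ₗ[ℂ] ℂ) : Prop where
  nonneg : ∀ a, 0 ≤ φ (star a * a)
  map_one : φ 1 = 1

namespace IsPosUnital
variable {φ : A →ₗ[ℂ] ℂ} (hφ : IsPosUnital φ)
include hφ

theorem conj_apply_star_mul (a b : A) : starRingEnd ℂ (φ (star b * a)) = φ (star a * b) := by
  have h2 := (Complex.nonneg_iff.1 (hφ.nonneg a)).2
  have h3 := (Complex.nonneg_iff.1 (hφ.nonneg b)).2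
  have h4 := (Complex.nonneg_iff.1 (hφ.nonneg (a + b))).2
  have h5 := (Complex.nonneg_iff.1 (hφ.nonneg (a + Complex.I • b))).2
  simp only [star_add, star_smul, add_mul, mul_add, map_add, smul_mul_assoc, mul_smul_comm,
    map_smul, smul_eq_mul, Complex.add_im, Complex.mul_im, Complex.mul_re, Complex.star_def,
    Complex.conj_I, Complex.neg_re, Complex.neg_im, Complex.I_re, Complex.I_im] at h4 h5
  apply Complex.ext
  · simp only [Complex.conj_re]; linarith
  · simp only [Complex.conj_im]; linarith

theorem map_star (a : A) : φ (star a) = starRingEnd ℂ (φ a) := by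
  simpa using (hφ.conj_apply_star_mul a 1).symm

theorem im_eq_zero {a : A} (ha : star a = a) : (φ a).im = 0 := by
  have h := congrArg Complex.im (hφ.map_star a)
  rw [ha, Complex.conj_im] at h
  linarith

/-- The scalar product `(a, b) ↦ φ (a* b)` of the GNS construction. -/
@[reducible]
def core : PreInnerProductSpace.Core ℂ A where
  inner a b := φ (star a * b)
  conj_inner_symm a b := hφ.conj_apply_star_mul a b
  re_inner_nonneg a := (Complex.nonneg_iff.1 (hφ.nonneg a)).1
  add_left a b c := by simp [add_mul]
  smul_left a b c := by simp

end IsPosUnital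

/-- The GNS seminorm `‖a‖_φ = φ (a* a) ^ (1 / 2)`. -/
def snorm (φ : A →ₗ[ℂ] ℂ) (a : A) : ℝ := √(φ (star a * a)).re

theorem snorm_nonneg (φ : A →ₗ[ℂ] ℂ) (a : A) : 0 ≤ snorm φ a := Real.sqrt_nonneg _

theorem snorm_smul (φ : A →ₗ[ℂ] ℂ) (c : ℂ) (a : A) : snorm φ (c • a) = ‖c‖ * snorm φ a := by
  have e : φ (star (c • a) * (c • a)) = ((‖c‖ ^ 2 : ℝ) : ℂ) * φ (star a * a) := by
    simp only [star_smul, smul_mul_assoc, mul_smul_comm, map_smul, smul_eq_mul, ← mul_assoc]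
    congr 1
    rw [Complex.star_def, ← Complex.normSq_eq_norm_sq, Complex.normSq_eq_conj_mul_self, mul_comm]
  rw [snorm, e, Complex.re_ofReal_mul, Real.sqrt_mul (by positivity),
    Real.sqrt_sq (norm_nonneg c), snorm]

namespace IsPosUnital
variable {φ : A →ₗ[ℂ] ℂ} (hφ : IsPosUnital φ)
include hφ

theorem re_nonneg (a : A) : 0 ≤ (φ (star a * a)).re := (Complex.nonneg_iff.1 (hφ.nonneg a)).1

theorem sq_snorm (a : A) : snorm φ a ^ 2 = (φ (star a * a)).re := Real.sq_sqrt (hφ.re_nonneg a)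

theorem cauchy_schwarz (a b : A) : ‖φ (star a * b)‖ ≤ snorm φ a * snorm φ b :=
  let := hφ.core
  InnerProductSpace.Core.norm_inner_le_norm (𝕜 := ℂ) a b

theorem snorm_add_le (a b : A) : snorm φ (a + b) ≤ snorm φ a + snorm φ b := by
  let := hφ.core
  let := InnerProductSpace.Core.toSeminormedAddCommGroup (𝕜 := ℂ) (F := A)
  exact norm_add_le a b

theorem snorm_sum_le {κ : Type*} (s : Finset κ) (f : κ → A) :
    snorm φ (∑ i ∈ s, f i) ≤ ∑ i ∈ s, snorm φ (f i) := by
  classical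
  induction s using Finset.induction_on with
  | empty => simp [snorm]
  | insert i s hi ih =>
    rw [Finset.sum_insert hi, Finset.sum_insert hi]
    exact (hφ.snorm_add_le _ _).trans (by gcongr)

/-- `x* x ≤ ‖x‖ ^ 2` in the GNS representation. -/
theorem apply_conj_le (x y : A) :
    (φ (star y * (star x * x) * y)).re ≤ ‖x‖ ^ 2 * (φ (star y * y)).re := by
  let := CStarAlgebra.spectralOrder A
  let := CStarAlgebra.spectralOrderedRing A
  have h : (star x * x) ≤ algebraMap ℝ A (‖x‖ ^ 2) := CStarAlgebra.star_mul_le_algebraMap_norm_sq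
  obtain ⟨z, hz⟩ := CStarAlgebra.nonneg_iff_eq_star_mul_self.1 (sub_nonneg.2 h)
  have h1 := hφ.re_nonneg (z * y)
  have e : star (z * y) * (z * y) =
      ((‖x‖ ^ 2 : ℝ) : ℂ) • (star y * y) - star y * (star x * x) * y := by
    calc star (z * y) * (z * y) = star y * (star z * z) * y := by rw [star_mul]; noncomm_ring
      _ = _ := by
        rw [← hz, Algebra.algebraMap_eq_smul_one, Complex.coe_smul]
        simp [mul_sub, sub_mul]
  rw [e, map_sub, map_smul, smul_eq_mul, Complex.sub_re, Complex.re_ofReal_mul] at h1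
  linarith

theorem snorm_mul_le (x y : A) : snorm φ (x * y) ≤ ‖x‖ * snorm φ y := by
  rw [snorm, snorm, ← Real.sqrt_sq (norm_nonneg x), ← Real.sqrt_mul (by positivity)]
  refine Real.sqrt_le_sqrt ?_
  have := hφ.apply_conj_le x y
  convert this using 3
  rw [star_mul]; noncomm_ring

theorem snorm_one : snorm φ 1 = 1 := by simp [snorm, hφ.map_one]

theorem snorm_le_norm (x : A) : snorm φ x ≤ ‖x‖ := by
  simpa [hφ.snorm_one] using hφ.snorm_mul_le x 1

theorem norm_apply_le_snorm (x : A) : ‖φ x‖ ≤ snorm φ x := by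
  simpa [hφ.snorm_one] using hφ.cauchy_schwarz 1 x

theorem norm_apply_le (x : A) : ‖φ x‖ ≤ ‖x‖ := (hφ.norm_apply_le_snorm x).trans (hφ.snorm_le_norm x)

theorem continuous : Continuous φ :=
  (φ.mkContinuous 1 fun x => by simpa using hφ.norm_apply_le x).continuous

end IsPosUnital

/-! ### Limits of Kraus maps and Lindblad semigroups -/

/-- The completely positive maps `x ↦ ∑ i, B_i* x B_i`. -/
def krausMaps (A : Type*) [CStarAlgebra A] : Set (A →L[ℂ] A) :=
  {φ | ∃ (κ : Type) (_ : Fintype κ) (B : κ → A), ∀ x, φ x = ∑ i, star (B i) * x * B i}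

theorem one_mem_krausMaps : (1 : A →L[ℂ] A) ∈ krausMaps A :=
  ⟨Unit, inferInstance, fun _ => 1, fun x => by simp⟩

theorem mul_mem_krausMaps {φ ψ : A →L[ℂ] A} (hφ : φ ∈ krausMaps A) (hψ : ψ ∈ krausMaps A) :
    φ * ψ ∈ krausMaps A := by
  obtain ⟨κ, _, B, hB⟩ := hφ
  obtain ⟨κ', _, B', hB'⟩ := hψ
  refine ⟨κ × κ', inferInstance, fun i => B' i.2 * B i.1, fun x => ?_⟩
  rw [Fintype.sum_prod_type]
  show φ (ψ x) = _
  rw [hB, hB']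
  simp only [Finset.mul_sum, Finset.sum_mul, star_mul, mul_assoc]

theorem add_mem_krausMaps {φ ψ : A →L[ℂ] A} (hφ : φ ∈ krausMaps A) (hψ : ψ ∈ krausMaps A) :
    φ + ψ ∈ krausMaps A := by
  obtain ⟨κ, _, B, hB⟩ := hφ
  obtain ⟨κ', _, B', hB'⟩ := hψ
  refine ⟨κ ⊕ κ', inferInstance, Sum.elim B B', fun x => ?_⟩
  rw [Fintype.sum_sum_type]
  show φ x + ψ x = _
  rw [hB, hB']
  simp

theorem smul_mem_krausMaps {φ : A →L[ℂ] A} (hφ : φ ∈ krausMaps A) {c : ℝ} (hc : 0 ≤ c) :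
    (c : ℂ) • φ ∈ krausMaps A := by
  obtain ⟨κ, _, B, hB⟩ := hφ
  refine ⟨κ, inferInstance, fun i => ((√c : ℝ) : ℂ) • B i, fun x => ?_⟩
  show (c : ℂ) • φ x = _
  rw [hB, Finset.smul_sum]
  refine Finset.sum_congr rfl fun i _ => ?_
  simp only [star_smul, smul_mul_assoc, mul_smul_comm, smul_smul, Complex.star_def,
    Complex.conj_ofReal, ← Complex.ofReal_mul, Real.mul_self_sqrt hc]

theorem pow_mem_krausMaps {φ : A →L[ℂ] A} (hφ : φ ∈ krausMaps A) (n : ℕ) :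
    φ ^ n ∈ krausMaps A := by
  induction n with
  | zero => exact one_mem_krausMaps
  | succ n ih => rw [pow_succ]; exact mul_mem_krausMaps ih hφ

theorem star_map_of_mem_closure {φ : A →L[ℂ] A} (hφ : φ ∈ closure (krausMaps A)) (x : A) :
    φ (star x) = star (φ x) := by
  have hc : IsClosed {φ : A →L[ℂ] A | φ (star x) = star (φ x)} :=
    isClosed_eq (by fun_prop) (by fun_prop)
  refine closure_minimal ?_ hc hφ
  rintro ψ ⟨κ, _, B, hB⟩
  simp only [Set.mem_ofPred_eq, hB, star_sum, star_mul, star_star, mul_assoc]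

/-- Two-positivity of a limit of Kraus maps, in the form of a Cauchy–Schwarz inequality between
two different vector functionals. -/
theorem cross_cauchy_schwarz {ω : A →ₗ[ℂ] ℂ} (hω : IsPosUnital ω) {φ : A →L[ℂ] A}
    (hφ : φ ∈ closure (krausMaps A)) (a b x y : A) :
    ‖ω (star a * φ (star x * y) * b)‖ ≤
      √(ω (star a * φ (star x * x) * a)).re * √(ω (star b * φ (star y * y) * b)).re := by
  have := hω.continuous
  have hc : IsClosed {φ : A →L[ℂ] A | ‖ω (star a * φ (star x * y) * b)‖ ≤
      √(ω (star a * φ (star x * x) * a)).re * √(ω (star b * φ (star y * y) * b)).re} :=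
    isClosed_le (by fun_prop) (by fun_prop)
  refine closure_minimal ?_ hc hφ
  rintro ψ ⟨κ, _, B, hB⟩
  have e : ∀ a b x y : A, ω (star a * ψ (star x * y) * b) =
      ∑ i, ω (star (x * B i * a) * (y * B i * b)) := by
    intro a b x y
    rw [hB, Finset.mul_sum, Finset.sum_mul, map_sum]
    refine Finset.sum_congr rfl fun i _ => ?_
    simp only [star_mul, mul_assoc]
  simp only [Set.mem_ofPred_eq, e, Complex.re_sum, ← hω.sq_snorm]
  refine (norm_sum_le _ _).trans ?_
  refine (Finset.sum_le_sum fun i _ => hω.cauchy_schwarz _ _).trans ?_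
  exact Real.sum_mul_le_sqrt_mul_sqrt _ _ _

theorem nonneg_of_mem_closure {ω : A →ₗ[ℂ] ℂ} (hω : IsPosUnital ω) {φ : A →L[ℂ] A}
    (hφ : φ ∈ closure (krausMaps A)) (a x : A) : 0 ≤ ω (star a * φ (star x * x) * a) := by
  have := hω.continuous
  have hc : IsClosed {φ : A →L[ℂ] A | 0 ≤ ω (star a * φ (star x * x) * a)} :=
    isClosed_le (by fun_prop) (by fun_prop)
  refine closure_minimal ?_ hc hφ
  rintro ψ ⟨κ, _, B, hB⟩
  simp only [Set.mem_ofPred_eq, hB, Finset.mul_sum, Finset.sum_mul, map_sum]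
  refine Finset.sum_nonneg fun i _ => ?_
  have := hω.nonneg (x * B i * a)
  simpa only [star_mul, mul_assoc] using this

/-- The telescoping estimate for the difference of two powers. -/
theorem norm_pow_sub_pow_le {𝔅 : Type*} [NormedRing 𝔅] [NormOneClass 𝔅] {a b : 𝔅} {M : ℝ}
    (hM : 1 ≤ M) (ha : ‖a‖ ≤ M) (hb : ‖b‖ ≤ M) (n : ℕ) :
    ‖a ^ n - b ^ n‖ ≤ n * M ^ n * ‖a - b‖ := by
  induction n with
  | zero => simp
  | succ n ih =>
    have e : a ^ (n + 1) - b ^ (n + 1) = a ^ n * (a - b) + (a ^ n - b ^ n) * b := by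
      rw [pow_succ, pow_succ]; noncomm_ring
    have h1 : ‖a ^ n * (a - b)‖ ≤ M ^ (n + 1) * ‖a - b‖ := by
      refine (norm_mul_le _ _).trans ?_
      gcongr
      exact ((norm_pow_le a n).trans (pow_le_pow_left₀ (norm_nonneg _) ha n)).trans
        (pow_le_pow_right₀ hM n.le_succ)
    have h2 : ‖(a ^ n - b ^ n) * b‖ ≤ (n * M ^ n * ‖a - b‖) * M :=
      (norm_mul_le _ _).trans (by gcongr)
    rw [e]
    refine (norm_add_le _ _).trans ((add_le_add h1 h2).trans (le_of_eq ?_))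
    push_cast; ring

theorem hasDerivAt_exp_smul {𝔅 : Type*} [NormedRing 𝔅] [NormedAlgebra ℂ 𝔅] [CompleteSpace 𝔅]
    (L : 𝔅) (t : ℝ) : HasDerivAt (fun h : ℝ => NormedSpace.exp ((h : ℂ) • L))
      (NormedSpace.exp ((t : ℂ) • L) * L) t := by
  have h1 : HasDerivAt (fun h : ℝ => (h : ℂ)) 1 t := Complex.ofRealCLM.hasDerivAt
  have h2 := (hasDerivAt_exp_smul_const (𝕂 := ℂ) L (t : ℂ)).scomp t h1
  rwa [one_smul] at h2

/-- A Chernoff product formula: `exp (t L)` is the limit of `T (t / n) ^ n` if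
`T h = 1 + h L + o(h)`. -/
theorem exp_mem_closure_of_pow {𝔅 : Type*} [NormedRing 𝔅] [NormedAlgebra ℂ 𝔅] [CompleteSpace 𝔅]
    [NormOneClass 𝔅]
    (S : Set 𝔅) (L : 𝔅) (T : ℝ → 𝔅) (hT : ∀ h, 0 ≤ h → ∀ n : ℕ, T h ^ n ∈ S)
    (hTL : HasDerivAt T L 0) (hT0 : T 0 = 1) {t : ℝ} (ht : 0 ≤ t) :
    NormedSpace.exp ((t : ℂ) • L) ∈ closure S := by
  let _ : NormedAlgebra ℚ 𝔅 := NormedAlgebra.restrictScalars ℚ ℂ 𝔅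
  set E : ℝ → 𝔅 := fun h => NormedSpace.exp ((h : ℂ) • L) with hE
  have hE0 : E 0 = 1 := by simp [hE]
  have hEL : HasDerivAt E L 0 := by
    have := hasDerivAt_exp_smul L 0
    rwa [Complex.ofReal_zero, zero_smul ℂ L, NormedSpace.exp_zero, one_mul] at this
  obtain ⟨c, hc, hTc⟩ := hTL.isBigO_sub.exists_pos
  obtain ⟨c', hc', hEc⟩ := hEL.isBigO_sub.exists_pos
  have hlim : Tendsto (fun n : ℕ => t / n) atTop (𝓝 0) := tendsto_const_div_atTop_nhds_zero_nat t
  have hD : (fun h => T h - E h) =o[𝓝 0] fun h : ℝ => h := by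
    have := hasDerivAt_iff_isLittleO_nhds_zero.1 (hTL.sub hEL)
    simpa [hT0, hE0] using this
  have hD' := hD.comp_tendsto hlim
  refine mem_closure_of_tendsto (f := fun n : ℕ => T (t / n) ^ n) (b := atTop) ?_
    (Eventually.of_forall fun n => hT _ (by positivity) n)
  rw [tendsto_iff_norm_sub_tendsto_zero]
  have hbound : ∀ᶠ n : ℕ in atTop, ‖T (t / n) ^ n - NormedSpace.exp ((t : ℂ) • L)‖ ≤
      Real.exp ((c + c') * t) * (n * ‖T (t / n) - E (t / n)‖) := by
    filter_upwards [hlim.eventually hTc.bound, hlim.eventually hEc.bound, eventually_gt_atTop 0]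
      with n h1 h2 hn
    have hn' : (0 : ℝ) < n := Nat.cast_pos.2 hn
    have htn : 0 ≤ t / n := by positivity
    have key : ∀ (x : 𝔅) (b : ℝ), b ≤ c + c' → ‖x - 1‖ ≤ b * ‖t / n - 0‖ →
        ‖x‖ ≤ Real.exp ((c + c') * (t / n)) := by
      intro x b hb hx
      have : ‖x‖ ≤ ‖x - 1‖ + 1 := by
        simpa using norm_add_le (x - 1) 1
      rw [sub_zero, Real.norm_of_nonneg htn] at hx
      have h3 := Real.add_one_le_exp ((c + c') * (t / n))
      nlinarith
    have hEn : NormedSpace.exp ((t : ℂ) • L) = E (t / n) ^ n := by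
      rw [hE]
      simp only
      rw [← NormedSpace.exp_nsmul, ← Nat.cast_smul_eq_nsmul ℂ, smul_smul]
      congr 2
      push_cast
      field_simp
    rw [hEn]
    refine (norm_pow_sub_pow_le (M := Real.exp ((c + c') * (t / n)))
      (Real.one_le_exp (by positivity))
      (key _ c (by linarith) (by rw [← hT0]; exact h1))
      (key _ c' (by linarith) (by rw [← hE0]; exact h2)) n).trans (le_of_eq ?_)
    rw [← Real.exp_nat_mul]
    have : (n : ℝ) * ((c + c') * (t / n)) = (c + c') * t := by field_simp
    rw [this]; ring
  refine squeeze_zero' (Eventually.of_forall fun _ => norm_nonneg _) hbound ?_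
  rw [← mul_zero (Real.exp ((c + c') * t))]
  refine Tendsto.const_mul _ ?_
  have h1 : (fun n : ℕ => T (t / n) - E (t / n)) =o[atTop] fun n : ℕ => (n : ℝ)⁻¹ := by
    refine hD'.trans_isBigO (Asymptotics.IsBigO.of_bound |t| (Eventually.of_forall fun n => ?_))
    simp [div_eq_mul_inv]
  refine h1.norm_left.tendsto_div_nhds_zero.congr fun n => ?_
  rw [div_inv_eq_mul, mul_comm]

/-- The semigroup generated by a map in Lindblad form `x ↦ K* x + x K + ∑ i, B_i* x B_i` consists
of limits of Kraus maps. -/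
theorem exp_mem_closure_krausMaps [Nontrivial A] {κ : Type} [Fintype κ] (K : A) (B : κ → A)
    (L : A →L[ℂ] A) (hL : ∀ x, L x = star K * x + x * K + ∑ i, star (B i) * x * B i)
    {t : ℝ} (ht : 0 ≤ t) : NormedSpace.exp ((t : ℂ) • L) ∈ closure (krausMaps A) := by
  set Ψ : A →L[ℂ] A := L - (ContinuousLinearMap.mul ℂ A (star K) +
    (ContinuousLinearMap.mul ℂ A).flip K) with hΨ
  set Θ : A →L[ℂ] A := ContinuousLinearMap.mul ℂ A (star K) ∘L (ContinuousLinearMap.mul ℂ A).flip K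
    with hΘ
  have hΨk : Ψ ∈ krausMaps A := ⟨κ, inferInstance, B, fun x => by
    have : Ψ x = L x - (star K * x + x * K) := rfl
    rw [this, hL]; abel⟩
  refine exp_mem_closure_of_pow (krausMaps A) L
    (fun h => 1 + (h : ℂ) • L + ((h : ℂ) * h) • Θ) (fun h hh n => ?_) ?_ ?_ ht
  · refine pow_mem_krausMaps ?_ n
    have e : 1 + (h : ℂ) • L + ((h : ℂ) * h) • Θ =
        ContinuousLinearMap.mul ℂ A (star (1 + (h : ℂ) • K)) ∘L
          (ContinuousLinearMap.mul ℂ A).flip (1 + (h : ℂ) • K) + (h : ℂ) • Ψ := by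
      ext x
      change x + (h : ℂ) • L x + ((h : ℂ) * h) • (star K * (x * K)) =
        star (1 + (h : ℂ) • K) * (x * (1 + (h : ℂ) • K)) +
          (h : ℂ) • (L x - (star K * x + x * K))
      simp only [star_add, star_one, star_smul, Complex.star_def, Complex.conj_ofReal, mul_add,
        add_mul, mul_one, one_mul, smul_mul_assoc, mul_smul_comm, smul_sub, smul_add, smul_smul]
      abel
    rw [e]
    refine add_mem_krausMaps ⟨Unit, inferInstance, fun _ => 1 + (h : ℂ) • K, fun x => ?_⟩
      (smul_mem_krausMaps hΨk hh)
    rw [Fintype.sum_unique, mul_assoc]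
    rfl
  · have h1 : HasDerivAt (fun h : ℝ => (h : ℂ)) 1 0 := Complex.ofRealCLM.hasDerivAt
    have h2 := (((h1.smul_const L).const_add 1).add ((h1.mul h1).smul_const Θ))
    rw [Complex.ofReal_zero, mul_zero, zero_mul, add_zero, zero_smul ℂ Θ, one_smul ℂ L,
      add_zero] at h2
    exact h2
  · rw [Complex.ofReal_zero, mul_zero (0 : ℂ), zero_smul ℂ L, zero_smul ℂ Θ, add_zero, add_zero]

end States

/-! ### Exponentials of self-adjoint elements -/

section Exp
variable {A : Type*} [CStarAlgebra A]

/-- The exponential `exp (i R)`. -/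
def expI (R : A) : A := NormedSpace.exp (Complex.I • R)

theorem expI_zero : expI (0 : A) = 1 := by
  let _ : NormedAlgebra ℚ A := NormedAlgebra.restrictScalars ℚ ℂ A
  simp [expI]

theorem expI_neg_mul_expI (R : A) : expI (-R) * expI R = 1 := by
  let _ : NormedAlgebra ℚ A := NormedAlgebra.restrictScalars ℚ ℂ A
  rw [expI, expI, ← NormedSpace.exp_add_of_commute, smul_neg, neg_add_cancel, NormedSpace.exp_zero]
  rw [smul_neg]
  exact (Commute.refl _).neg_left

theorem expI_mul_expI_neg (R : A) : expI R * expI (-R) = 1 := by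
  simpa using expI_neg_mul_expI (-R)

theorem star_expI {R : A} (hR : IsSelfAdjoint R) : star (expI R) = expI (-R) := by
  rw [expI, expI, NormedSpace.star_exp, star_smul, hR.star_eq]
  simp

theorem star_expI_mul_self {R : A} (hR : IsSelfAdjoint R) : star (expI R) * expI R = 1 := by
  rw [star_expI hR, expI_neg_mul_expI]

theorem norm_expI_le {R : A} (hR : IsSelfAdjoint R) : ‖expI R‖ ≤ 1 := by
  rcases subsingleton_or_nontrivial A with _ | _
  · rw [Subsingleton.elim (expI R) 0, norm_zero]; exact zero_le_one
  · have h := CStarRing.norm_star_mul_self (x := expI R)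
    rw [star_expI_mul_self hR, CStarRing.norm_one] at h
    nlinarith [norm_nonneg (expI R)]

theorem expI_add_smul_one (R : A) (c : ℂ) :
    expI (R + c • 1) = Complex.exp (Complex.I * c) • expI R := by
  let _ : NormedAlgebra ℚ A := NormedAlgebra.restrictScalars ℚ ℂ A
  have h : Commute (Complex.I • R) (Complex.I • c • (1 : A)) := by
    rw [smul_smul, ← Algebra.algebraMap_eq_smul_one]
    exact (Algebra.commutes' _ _).symm
  rw [expI, smul_add, NormedSpace.exp_add_of_commute h, smul_smul,
    ← Algebra.algebraMap_eq_smul_one, ← NormedSpace.algebraMap_exp_comm (𝕂 := ℂ),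
    Algebra.algebraMap_eq_smul_one, mul_smul_comm, mul_one, Complex.exp_eq_exp_ℂ, expI]

theorem hasDerivAt_expI_smul (R : A) (u : ℝ) :
    HasDerivAt (fun u : ℝ => expI ((u : ℂ) • R)) (expI ((u : ℂ) • R) * Complex.I • R) u := by
  have h := hasDerivAt_exp_smul (Complex.I • R) u
  simp only [expI, smul_comm Complex.I]
  exact h

theorem commute_expI_smul (R : A) (u : ℂ) : expI (u • R) * R = R * expI (u • R) := by
  have h : Commute R (Complex.I • u • R) := ((Commute.refl R).smul_right _).smul_right _
  let _ : NormedAlgebra ℚ A := NormedAlgebra.restrictScalars ℚ ℂ A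
  exact h.exp_right.symm

/-- The flow `V ↦ exp (-i u R) V exp (i u R)`. -/
def conjFlow (R V : A) (u : ℝ) : A := expI (-((u : ℂ) • R)) * V * expI ((u : ℂ) • R)

theorem isSelfAdjoint_ofReal_smul {R : A} (hR : IsSelfAdjoint R) (u : ℝ) :
    IsSelfAdjoint ((u : ℂ) • R) := by
  rw [IsSelfAdjoint, star_smul, hR.star_eq, Complex.star_def, Complex.conj_ofReal]

theorem norm_conjFlow_le {R : A} (hR : IsSelfAdjoint R) (V : A) (u : ℝ) :
    ‖conjFlow R V u‖ ≤ ‖V‖ := by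
  have h1 := norm_expI_le (isSelfAdjoint_ofReal_smul hR u)
  have h2 := norm_expI_le (isSelfAdjoint_ofReal_smul hR u).neg
  calc ‖conjFlow R V u‖ ≤ ‖expI (-((u : ℂ) • R))‖ * ‖V‖ * ‖expI ((u : ℂ) • R)‖ := norm_mul₃_le
    _ ≤ 1 * ‖V‖ * 1 := by gcongr
    _ = ‖V‖ := by ring

theorem hasDerivAt_conjFlow (R V : A) (u : ℝ) :
    HasDerivAt (conjFlow R V) (conjFlow R (-Complex.I • ⁅R, V⁆) u) u := by
  have h1 := hasDerivAt_expI_smul R u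
  have h2 := hasDerivAt_expI_smul (-R) u
  have h := (h2.mul_const V).mul h1
  simp only [smul_neg] at h
  refine HasDerivAt.congr_deriv (f := conjFlow R V) h ?_
  rw [mul_smul_comm, mul_smul_comm, commute_expI_smul R]
  simp only [conjFlow, Ring.lie_def, neg_smul, mul_neg, neg_mul, smul_mul_assoc,
    mul_smul_comm, mul_sub, sub_mul, smul_sub, mul_assoc]
  abel

theorem conjFlow_zero (R V : A) : conjFlow R V 0 = V := by simp [conjFlow, expI_zero]

theorem conjFlow_smul (R V : A) (c : ℂ) (u : ℝ) : conjFlow R (c • V) u = c • conjFlow R V u := by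
  simp [conjFlow]

theorem norm_le_of_hasDerivAt_of_zero {E : Type*} [NormedAddCommGroup E] [NormedSpace ℝ E]
    {f f' : ℝ → E} {C : ℝ} (h0 : f 0 = 0) (hf : ∀ u ∈ Set.Icc (0 : ℝ) 1, HasDerivAt f (f' u) u)
    (hC : ∀ u ∈ Set.Icc (0 : ℝ) 1, ‖f' u‖ ≤ C) {u : ℝ} (hu : u ∈ Set.Icc (0 : ℝ) 1) :
    ‖f u‖ ≤ C := by
  have h := norm_image_sub_le_of_norm_deriv_le_segment' (f := f) (f' := f') (C := C)
    (fun x hx => (hf x hx).hasDerivWithinAt) (fun x hx => hC x (Set.Ico_subset_Icc_self hx)) u hu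
  have hC0 : 0 ≤ C := (norm_nonneg _).trans (hC 0 (by simp))
  rw [h0, sub_zero, sub_zero] at h
  nlinarith [hu.1, hu.2]

theorem hasDerivAt_ofReal_sq_half (u : ℝ) :
    HasDerivAt (fun h : ℝ => (h : ℂ) ^ 2 / 2) (u : ℂ) u := by
  have h1 : HasDerivAt (fun h : ℝ => (h : ℂ)) 1 u := Complex.ofRealCLM.hasDerivAt
  refine ((h1.pow 2).div_const 2).congr_deriv ?_
  simp

theorem norm_conjFlow_sub_le {R : A} (hR : IsSelfAdjoint R) (V : A) {u : ℝ}
    (hu : u ∈ Set.Icc (0 : ℝ) 1) : ‖conjFlow R V u - V‖ ≤ ‖⁅R, V⁆‖ := by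
  refine norm_le_of_hasDerivAt_of_zero (f := fun u => conjFlow R V u - V) (by simp [conjFlow_zero])
    (fun u _ => (hasDerivAt_conjFlow R V u).sub_const V) (fun u _ => ?_) hu
  refine (norm_conjFlow_le hR _ u).trans (le_of_eq ?_)
  rw [norm_smul]; simp

theorem norm_conjFlow_sub_sub_le {R : A} (hR : IsSelfAdjoint R) (V : A) {u : ℝ}
    (hu : u ∈ Set.Icc (0 : ℝ) 1) :
    ‖conjFlow R V u - (V - (u : ℂ) • Complex.I • ⁅R, V⁆)‖ ≤ ‖⁅R, ⁅R, V⁆⁆‖ := by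
  have h1 : ∀ u : ℝ, HasDerivAt (fun h : ℝ => (h : ℂ)) 1 u := fun u => Complex.ofRealCLM.hasDerivAt
  refine norm_le_of_hasDerivAt_of_zero
    (f := fun u => conjFlow R V u - (V - (u : ℂ) • Complex.I • ⁅R, V⁆)) (by simp [conjFlow_zero])
    (fun u _ => (hasDerivAt_conjFlow R V u).sub
      (((h1 u).smul_const (Complex.I • ⁅R, V⁆)).const_sub V)) (fun u hu => ?_) hu
  refine le_trans (le_of_eq ?_) (norm_conjFlow_sub_le hR ⁅R, V⁆ hu)
  have : conjFlow R (-Complex.I • ⁅R, V⁆) u - -((1 : ℂ) • Complex.I • ⁅R, V⁆) =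
      -Complex.I • (conjFlow R ⁅R, V⁆ u - ⁅R, V⁆) := by
    rw [conjFlow_smul, one_smul, smul_sub, neg_smul, neg_smul, sub_neg_eq_add]
  rw [this, norm_smul]; simp

theorem norm_conjFlow_sub_sub_sub_le {R : A} (hR : IsSelfAdjoint R) (V : A) {u : ℝ}
    (hu : u ∈ Set.Icc (0 : ℝ) 1) :
    ‖conjFlow R V u - (V - (u : ℂ) • Complex.I • ⁅R, V⁆ - ((u : ℂ) ^ 2 / 2) • ⁅R, ⁅R, V⁆⁆)‖ ≤
      ‖⁅R, ⁅R, ⁅R, V⁆⁆⁆‖ := by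
  have h1 : ∀ u : ℝ, HasDerivAt (fun h : ℝ => (h : ℂ)) 1 u := fun u => Complex.ofRealCLM.hasDerivAt
  have h2 := hasDerivAt_ofReal_sq_half
  refine norm_le_of_hasDerivAt_of_zero
    (f := fun u => conjFlow R V u -
      (V - (u : ℂ) • Complex.I • ⁅R, V⁆ - ((u : ℂ) ^ 2 / 2) • ⁅R, ⁅R, V⁆⁆))
    (by simp [conjFlow_zero])
    (fun u _ => (hasDerivAt_conjFlow R V u).sub
      ((((h1 u).smul_const (Complex.I • ⁅R, V⁆)).const_sub V).sub
        ((h2 u).smul_const ⁅R, ⁅R, V⁆⁆))) (fun u hu => ?_) hu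
  refine le_trans (le_of_eq ?_) (norm_conjFlow_sub_sub_le hR ⁅R, V⁆ hu)
  have : conjFlow R (-Complex.I • ⁅R, V⁆) u -
      (-((1 : ℂ) • Complex.I • ⁅R, V⁆) - (u : ℂ) • ⁅R, ⁅R, V⁆⁆) =
      -Complex.I • (conjFlow R ⁅R, V⁆ u - (⁅R, V⁆ - (u : ℂ) • Complex.I • ⁅R, ⁅R, V⁆⁆)) := by
    rw [conjFlow_smul]
    simp only [smul_sub, smul_smul]
    have : -Complex.I * (u * Complex.I) = u := by linear_combination (-u : ℂ) * Complex.I_mul_I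
    rw [this]; module
  rw [this, norm_smul]; simp

/-- The derivative of `s ↦ exp (i R s)` in logarithmic form: `exp (-i R) d/ds exp (i R)` is
`i R' + ½ [R, R']` up to a double commutator. -/
theorem exists_hasDerivWithinAt_expI {R : ℝ → A} {R' : A} {S : Set ℝ} {s : ℝ}
    (hR : HasDerivWithinAt R R' S s) (hs : IsSelfAdjoint (R s)) (hs' : IsSelfAdjoint R') :
    ∃ Z : A, HasDerivWithinAt (fun s => expI (R s)) (expI (R s) * Z) S s ∧
      ‖Z - (Complex.I • R' + (1 / 2 : ℂ) • ⁅R s, R'⁆)‖ ≤ ‖⁅R s, ⁅R s, R'⁆⁆‖ := by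
  let _ : NormedAlgebra ℚ A := NormedAlgebra.restrictScalars ℚ ℂ A
  set Q := R s with hQ
  have hd : HasFDerivAt (expI : A → A)
      ((fderiv ℂ (NormedSpace.exp : A → A) (Complex.I • Q)).restrictScalars ℝ ∘L
        (Complex.I • ContinuousLinearMap.id ℝ A)) Q := by
    have h1 : HasFDerivAt (NormedSpace.exp : A → A)
        ((fderiv ℂ (NormedSpace.exp : A → A) (Complex.I • Q)).restrictScalars ℝ) (Complex.I • Q) :=
      (NormedSpace.exp_analytic (𝕂 := ℂ) (Complex.I • Q)).differentiableAt.hasFDerivAt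
        |>.restrictScalars ℝ
    exact h1.comp Q ((hasFDerivAt_id (𝕜 := ℝ) Q).const_smul Complex.I)
  set D : A →L[ℝ] A := (fderiv ℂ (NormedSpace.exp : A → A) (Complex.I • Q)).restrictScalars ℝ ∘L
        (Complex.I • ContinuousLinearMap.id ℝ A) with hDdef
  refine ⟨expI (-Q) * D R', ?_, ?_⟩
  · have h := hd.comp_hasDerivWithinAt s hR
    rw [← mul_assoc, expI_mul_expI_neg, one_mul]
    exact h
  set Y := Complex.I • R' + (1 / 2 : ℂ) • ⁅Q, R'⁆ with hY
  set T := ‖⁅Q, ⁅Q, R'⁆⁆‖ with hT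
  -- the derivative in question is the one along the segment `ε ↦ Q + ε R'`
  have hline : HasDerivAt (fun ε : ℝ => expI (-Q) * expI (Q + (ε : ℂ) • R') - 1 - (ε : ℂ) • Y)
      (expI (-Q) * D R' - Y) 0 := by
    have h1 : HasDerivAt (fun h : ℝ => (h : ℂ)) 1 0 := Complex.ofRealCLM.hasDerivAt
    have h2 : HasDerivAt (fun ε : ℝ => Q + (ε : ℂ) • R') R' 0 := by
      simpa using (h1.smul_const R').const_add Q
    have hd' : HasFDerivAt (expI : A → A) D (Q + ((0 : ℝ) : ℂ) • R') := by simpa using hd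
    have h3 := hd'.comp_hasDerivAt (0 : ℝ) h2
    have h4 := ((h3.const_mul (expI (-Q))).sub_const 1).sub (h1.smul_const Y)
    rw [one_smul] at h4
    exact h4
  have hbound : ∀ ε : ℝ, 0 ≤ ε →
      ‖expI (-Q) * expI (Q + (ε : ℂ) • R') - 1 - (ε : ℂ) • Y‖ ≤ ε * (T + ε * ‖R'‖ ^ 2) := by
    intro ε hε
    set P := Q + (ε : ℂ) • R' with hP
    have hPs : IsSelfAdjoint P := hs.add (isSelfAdjoint_ofReal_smul hs' ε)
    set y : ℝ → A := fun u => expI (-((u : ℂ) • Q)) * expI ((u : ℂ) • P) with hy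
    have hyd : ∀ u : ℝ, HasDerivAt y (((ε : ℂ) * Complex.I) • (conjFlow Q R' u * y u)) u := by
      intro u
      have h1 := hasDerivAt_expI_smul P u
      have h2 := hasDerivAt_expI_smul (-Q) u
      have h := h2.mul h1
      simp only [smul_neg] at h
      refine HasDerivAt.congr_deriv (f := y) h ?_
      have e1 : conjFlow Q R' u * y u = expI (-((u : ℂ) • Q)) * R' * expI ((u : ℂ) • P) := by
        simp only [conjFlow, hy]
        rw [mul_assoc _ (expI ((u : ℂ) • Q)), ← mul_assoc (expI ((u : ℂ) • Q)),
          expI_mul_expI_neg, one_mul]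
      rw [e1, mul_smul_comm, mul_smul_comm, commute_expI_smul P, hP]
      simp only [mul_neg, neg_mul, smul_mul_assoc, mul_smul_comm, add_mul, mul_add,
        smul_add, smul_smul, mul_assoc]
      rw [mul_comm Complex.I]
      abel
    have hys : ∀ u : ℝ, ‖y u‖ ≤ 1 := fun u => by
      have h1 := norm_expI_le (isSelfAdjoint_ofReal_smul hPs u)
      have h2 := norm_expI_le (isSelfAdjoint_ofReal_smul hs u).neg
      calc ‖y u‖ ≤ ‖expI (-((u : ℂ) • Q))‖ * ‖expI ((u : ℂ) • P)‖ := norm_mul_le _ _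
        _ ≤ 1 * 1 := by gcongr
        _ = 1 := one_mul 1
    have hy0 : y 0 = 1 := by simp [hy, expI_zero]
    have hcoef : ‖(ε : ℂ) * Complex.I‖ = ε := by simp [abs_of_nonneg hε]
    have hy1 : ∀ u ∈ Set.Icc (0 : ℝ) 1, ‖y u - 1‖ ≤ ε * ‖R'‖ := fun u hu => by
      refine norm_le_of_hasDerivAt_of_zero (f := fun u => y u - 1) (by simp [hy0])
        (fun u _ => (hyd u).sub_const 1) (fun u _ => ?_) hu
      rw [norm_smul, hcoef]
      gcongr
      exact (norm_mul_le _ _).trans ((mul_le_mul (norm_conjFlow_le hs R' u) (hys u)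
        (norm_nonneg _) (norm_nonneg _)).trans (by simp))
    have h1 : ∀ u : ℝ, HasDerivAt (fun h : ℝ => (h : ℂ)) 1 u := fun u =>
      Complex.ofRealCLM.hasDerivAt
    have h2 := hasDerivAt_ofReal_sq_half
    have key : ‖y 1 - 1 - (ε : ℂ) • (((1 : ℝ) : ℂ) • Complex.I • R' +
        ((((1 : ℝ) : ℂ) ^ 2 / 2) • ⁅Q, R'⁆))‖ ≤ ε * (T + ε * ‖R'‖ ^ 2) := by
      refine norm_le_of_hasDerivAt_of_zero (f := fun u => y u - 1 - (ε : ℂ) •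
        ((u : ℂ) • Complex.I • R' + (((u : ℂ) ^ 2 / 2) • ⁅Q, R'⁆))) (by simp [hy0])
        (fun u _ => ((hyd u).sub_const 1).sub ((((h1 u).smul_const (Complex.I • R')).add
          ((h2 u).smul_const ⁅Q, R'⁆)).const_smul (ε : ℂ))) (fun u hu => ?_) (by simp)
      have e : ((ε : ℂ) * Complex.I) • (conjFlow Q R' u * y u) -
          (ε : ℂ) • ((1 : ℂ) • Complex.I • R' + (u : ℂ) • ⁅Q, R'⁆) =
          ((ε : ℂ) * Complex.I) • ((conjFlow Q R' u - (R' - (u : ℂ) • Complex.I • ⁅Q, R'⁆)) +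
            conjFlow Q R' u * (y u - 1)) := by
        simp only [mul_smul, smul_add, smul_sub, mul_sub, mul_one, one_smul]
        rw [smul_comm (u : ℂ) Complex.I, smul_smul Complex.I Complex.I, Complex.I_mul_I]
        module
      rw [e, norm_smul, hcoef]
      gcongr
      refine (norm_add_le _ _).trans (add_le_add (norm_conjFlow_sub_sub_le hs R' hu) ?_)
      refine (norm_mul_le _ _).trans ((mul_le_mul (norm_conjFlow_le hs R' u) (hy1 u hu)
        (norm_nonneg _) (norm_nonneg _)).trans (le_of_eq (by ring)))
    convert key using 4
    · simp [hy]
    · simp [hY]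
  have hslope := (hasDerivAt_iff_tendsto_slope_zero.1 hline).mono_left
    (nhdsWithin_mono _ (fun x (hx : 0 < x) => hx.ne') : 𝓝[>] (0 : ℝ) ≤ 𝓝[≠] 0)
  have hR0 : Tendsto (fun ε : ℝ => T + ε * ‖R'‖ ^ 2) (𝓝[>] 0) (𝓝 T) := by
    have : Continuous fun ε : ℝ => T + ε * ‖R'‖ ^ 2 := by fun_prop
    simpa using (this.tendsto 0).mono_left nhdsWithin_le_nhds
  refine le_of_tendsto_of_tendsto hslope.norm hR0 ?_
  filter_upwards [self_mem_nhdsWithin] with ε hε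
  have hε' : (0 : ℝ) < ε := hε
  have := hbound ε hε'.le
  simp only [zero_add, Complex.ofReal_zero, zero_smul, add_zero, expI_neg_mul_expI, sub_self,
    sub_zero]
  rw [norm_smul, norm_inv, Real.norm_of_nonneg hε'.le, inv_mul_le_iff₀ hε']
  exact this

/-- The derivative behind the Baker–Campbell–Hausdorff formula. -/
theorem hasDerivAt_bch (R S : A) (u : ℝ) :
    HasDerivAt (fun u : ℝ => expI ((u : ℂ) • R) * expI ((u : ℂ) • S) * expI (-((u : ℂ) • (R + S))))
      (expI ((u : ℂ) • R) * expI ((u : ℂ) • S) * (Complex.I • (conjFlow S R u - R)) *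
        expI (-((u : ℂ) • (R + S)))) u := by
  have h := ((hasDerivAt_expI_smul R u).mul (hasDerivAt_expI_smul S u)).mul
    (hasDerivAt_expI_smul (-(R + S)) u)
  simp only [smul_neg] at h
  refine h.congr_deriv ?_
  have e1 : expI ((u : ℂ) • S) * conjFlow S R u = R * expI ((u : ℂ) • S) := by
    rw [conjFlow, ← mul_assoc, ← mul_assoc, expI_mul_expI_neg, one_mul]
  have e2 : expI (-((u : ℂ) • (R + S))) * (R + S) = (R + S) * expI (-((u : ℂ) • (R + S))) := by
    have := commute_expI_smul (R + S) (-(u : ℂ))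
    rwa [neg_smul] at this
  simp only [mul_smul_comm, smul_mul_assoc, mul_neg, Pi.mul_apply]
  generalize expI (-((u : ℂ) • (R + S))) = X at e2 ⊢
  rw [e2, mul_assoc (expI ((u : ℂ) • R)) (expI ((u : ℂ) • S)) (conjFlow S R u - R), mul_sub, e1]
  simp only [mul_sub, sub_mul, mul_add, add_mul, smul_sub, smul_add, mul_assoc, smul_mul_assoc]
  abel

end Exp

/-! ### Ordinary differential equations -/

section ODE
variable {ι : Type*} [Fintype ι]

/-- The coordinatewise truncation of a vector to the cube `[-M, M]^ι`. -/
def clamp (M : ℝ) (x : ι → ℝ) : ι → ℝ := fun i => max (-M) (min M (x i))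

theorem clamp_eq_self {M : ℝ} {x : ι → ℝ} (h : ‖x‖ ≤ M) : clamp M x = x := by
  funext i
  have := abs_le.1 ((norm_le_pi_norm x i).trans h)
  rw [clamp, min_eq_right this.2, max_eq_right this.1]

theorem norm_clamp_le {M : ℝ} (hM : 0 ≤ M) (x : ι → ℝ) : ‖clamp M x‖ ≤ M :=
  (pi_norm_le_iff_of_nonneg hM).2 fun _ =>
    abs_le.2 ⟨le_max_left _ _, max_le (by linarith) (min_le_left _ _)⟩

theorem lipschitzWith_clamp (M : ℝ) : LipschitzWith 1 (clamp M : (ι → ℝ) → ι → ℝ) := by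
  refine LipschitzWith.of_dist_le_mul fun x y => ?_
  rw [NNReal.coe_one, one_mul]
  refine (dist_pi_le_iff dist_nonneg).2 fun i => ?_
  refine le_trans ?_ (dist_le_pi_dist x y i)
  simp only [clamp, Real.dist_eq]
  refine (abs_max_sub_max_le_max _ _ _ _).trans ?_
  rw [sub_self, abs_zero]
  refine max_le (abs_nonneg _) ((abs_min_sub_min_le_max _ _ _ _).trans ?_)
  rw [sub_self, abs_zero]
  exact max_le (abs_nonneg _) le_rfl

/-- A bounded Lipschitz vector field has a solution on the whole interval. -/
theorem exists_solution_of_bounded {E : Type*} [NormedAddCommGroup E] [NormedSpace ℝ E]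
    [CompleteSpace E] (f : ℝ → E → E) {t : ℝ} (ht : 0 ≤ t) (x₀ : E) {K : NNReal} {L : ℝ}
    (hK : ∀ s ∈ Set.Icc 0 t, LipschitzWith K (f s))
    (hc : ∀ x, ContinuousOn (fun s => f s x) (Set.Icc 0 t))
    (hL : ∀ s ∈ Set.Icc 0 t, ∀ x, ‖f s x‖ ≤ L) :
    ∃ x : ℝ → E, x 0 = x₀ ∧ ∀ s ∈ Set.Icc 0 t, HasDerivWithinAt x (f s (x s)) (Set.Icc 0 t) s := by
  have hL0 : 0 ≤ L := (norm_nonneg _).trans (hL 0 ⟨le_rfl, ht⟩ 0)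
  have h : IsPicardLindelof f (⟨0, le_rfl, ht⟩ : Set.Icc 0 t) x₀ ⟨L * t, by positivity⟩ 0
      ⟨L, hL0⟩ K :=
    { lipschitzOnWith := fun s hs => (hK s hs).lipschitzOnWith
      continuousOn := fun x _ => hc x
      norm_le := fun s hs x _ => hL s hs x
      mul_max_le := by
        rw [sub_zero, sub_self, max_eq_left ht, NNReal.coe_zero, sub_zero]
        exact le_rfl }
  exact h.exists_eq_forall_mem_Icc_hasDerivWithinAt₀

/-- An autonomous smooth vector field truncated outside a cube is bounded and Lipschitz. -/
theorem exists_lipschitz_clamp {E : Type*} [NormedAddCommGroup E] [NormedSpace ℝ E]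
    {f : (ι → ℝ) → E} (hf : ContDiff ℝ 1 f) {M : ℝ}
    (hM : 0 ≤ M) : ∃ (K : NNReal) (L : ℝ), LipschitzWith K (fun x => f (clamp M x)) ∧
      ∀ x, ‖f (clamp M x)‖ ≤ L := by
  have hcomp : IsCompact (Metric.closedBall (0 : ι → ℝ) M) := isCompact_closedBall _ _
  have hmem : ∀ x : ι → ℝ, clamp M x ∈ Metric.closedBall (0 : ι → ℝ) M := fun x => by
    simpa using norm_clamp_le hM x
  obtain ⟨L, hL⟩ := hcomp.exists_bound_of_continuousOn hf.continuous.continuousOn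
  obtain ⟨K, hK⟩ := hf.contDiffOn.exists_lipschitzOnWith (n := 1) (by simp) (convex_closedBall _ _)
    hcomp
  refine ⟨K, L, ?_, fun x => hL _ (hmem x)⟩
  have := hK.comp (lipschitzWith_clamp M).lipschitzOnWith (s := Set.univ) (fun x _ => hmem x)
  rw [lipschitzOnWith_univ, mul_one] at this
  exact this

/-- Linear equations with continuous coefficients, with a prescribed value at the final time. -/
theorem exists_linear_solution (G : ℝ → ι → ι → ℝ) {t : ℝ} (ht : 0 ≤ t)
    (hG : ∀ i j, ContinuousOn (fun s => G s i j) (Set.Icc 0 t)) (q : ι → ℝ) :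
    ∃ r : ℝ → ι → ℝ, r t = q ∧ ∀ s ∈ Set.Icc 0 t,
      HasDerivWithinAt r (fun j => ∑ i, G s i j * r s i) (Set.Icc 0 t) s := by
  choose B hB using fun i j => isCompact_Icc.exists_bound_of_continuousOn (hG i j)
  set C := ∑ i, ∑ j, |B i j| with hC
  have hC0 : 0 ≤ C := by positivity
  set f : ℝ → (ι → ℝ) → (ι → ℝ) := fun u x => fun j => -∑ i, G (t - u) i j * x i with hf
  have hmem : ∀ u ∈ Set.Icc 0 t, t - u ∈ Set.Icc 0 t := fun u hu =>
    ⟨by linarith [hu.2], by linarith [hu.1]⟩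
  have hfb : ∀ u ∈ Set.Icc 0 t, ∀ x, ‖f u x‖ ≤ C * ‖x‖ := by
    intro u hu x
    refine (pi_norm_le_iff_of_nonneg (by positivity)).2 fun j => ?_
    rw [hf]
    simp only [norm_neg]
    refine (norm_sum_le _ _).trans ?_
    rw [hC, Finset.sum_mul]
    refine Finset.sum_le_sum fun i _ => ?_
    rw [norm_mul]
    refine mul_le_mul ?_ (norm_le_pi_norm x i) (norm_nonneg _) (by positivity)
    exact (hB i j _ (hmem u hu)).trans ((le_abs_self _).trans
      (Finset.single_le_sum (f := fun j => |B i j|) (fun _ _ => abs_nonneg _) (Finset.mem_univ j)))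
  have hfsub : ∀ u x y, f u x - f u y = f u (x - y) := by
    intro u x y
    funext j
    simp only [hf, Pi.sub_apply, mul_sub, Finset.sum_sub_distrib]
    ring
  set M := ‖q‖ * Real.exp (C * t) with hM
  have hM0 : 0 ≤ M := by positivity
  have hflip : ∀ u ∈ Set.Icc 0 t, LipschitzWith ⟨C, hC0⟩ (f u) := fun u hu =>
    LipschitzWith.of_dist_le_mul fun x y => by
      rw [dist_eq_norm, dist_eq_norm, hfsub]; exact hfb u hu _
  obtain ⟨x, hx0, hx⟩ := exists_solution_of_bounded (fun u x => f u (clamp M x)) ht q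
    (K := ⟨C, hC0⟩) (L := C * M)
    (fun u hu => by
      have := (hflip u hu).comp (lipschitzWith_clamp M)
      exact this.weaken (mul_one _).le)
    (fun x => by
      refine continuousOn_pi.2 fun j => (continuousOn_finsetSum _ fun i _ => ?_).neg
      exact ((hG i j).comp (by fun_prop) hmem).mul continuousOn_const)
    (fun u hu x => (hfb u hu _).trans (by gcongr; exact norm_clamp_le hM0 x))
  have hclamp : ∀ y : ι → ℝ, ‖clamp M y‖ ≤ ‖y‖ := fun y => by
    have h0 : clamp M (0 : ι → ℝ) = 0 := clamp_eq_self (by simpa using hM0)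
    have := (lipschitzWith_clamp M).dist_le_mul y 0
    simpa [h0] using this
  have hxb : ∀ u ∈ Set.Icc 0 t, ‖x u‖ ≤ M := by
    intro u hu
    have := norm_le_gronwallBound_of_norm_deriv_right_le (f := x)
      (f' := fun u => f u (clamp M (x u))) (δ := ‖q‖) (K := C) (ε := 0) (a := 0) (b := t)
      (fun u hu => (hx u hu).continuousWithinAt)
      (fun u hu => ((hx u (Set.Ico_subset_Icc_self hu)).mono_of_mem_nhdsWithin
        (Icc_mem_nhdsGE_of_mem hu)))
      (by rw [hx0]) (fun u hu => by
        rw [add_zero]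
        exact (hfb u (Set.Ico_subset_Icc_self hu) _).trans (by gcongr; exact hclamp _)) u hu
    refine this.trans ?_
    rw [gronwallBound_ε0, sub_zero, hM]
    gcongr
    exact hu.2
  refine ⟨fun s => x (t - s), by simp [hx0], fun s hs => ?_⟩
  have h1 : HasDerivWithinAt (fun s : ℝ => t - s) (-1) (Set.Icc 0 t) s := by
    simpa using (hasDerivWithinAt_id s (Set.Icc 0 t)).const_sub t
  have h2 := (hx (t - s) (hmem s hs)).scomp s h1 hmem
  refine h2.congr_deriv ?_
  rw [clamp_eq_self (hxb _ (hmem s hs))]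
  funext j
  simp [hf]

end ODE

/-! ### Collective operators with mean-field commutation relations -/

section Commutator
variable {A : Type*} [CStarAlgebra A]

theorem commutator_smul_right (x y : A) (c : ℂ) : ⁅x, c • y⁆ = c • ⁅x, y⁆ := by
  simp [Ring.lie_def, smul_sub]

theorem commutator_smul_left (x y : A) (c : ℂ) : ⁅c • x, y⁆ = c • ⁅x, y⁆ := by
  simp [Ring.lie_def, smul_sub]

theorem commutator_add_right (x y z : A) : ⁅x, y + z⁆ = ⁅x, y⁆ + ⁅x, z⁆ := by
  simp only [Ring.lie_def]; noncomm_ring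

theorem commutator_sub_right (x y z : A) : ⁅x, y - z⁆ = ⁅x, y⁆ - ⁅x, z⁆ := by
  simp only [Ring.lie_def]; noncomm_ring

theorem commutator_add_left (x y z : A) : ⁅x + y, z⁆ = ⁅x, z⁆ + ⁅y, z⁆ := by
  simp only [Ring.lie_def]; noncomm_ring

theorem commutator_smul_one_right (x : A) (c : ℂ) : ⁅x, c • (1 : A)⁆ = 0 := by
  simp [Ring.lie_def]

theorem commutator_smul_one_left (x : A) (c : ℂ) : ⁅c • (1 : A), x⁆ = 0 := by
  simp [Ring.lie_def]

theorem commutator_sum_right {κ : Type*} (s : Finset κ) (x : A) (y : κ → A) :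
    ⁅x, ∑ i ∈ s, y i⁆ = ∑ i ∈ s, ⁅x, y i⁆ := by
  simp [Ring.lie_def, Finset.mul_sum, Finset.sum_mul]

theorem commutator_sum_left {κ : Type*} (s : Finset κ) (x : A) (y : κ → A) :
    ⁅∑ i ∈ s, y i, x⁆ = ∑ i ∈ s, ⁅y i, x⁆ := by
  simp [Ring.lie_def, Finset.mul_sum, Finset.sum_mul]

theorem commutator_swap (x y : A) : ⁅x, y⁆ = -⁅y, x⁆ := by simp [Ring.lie_def]

end Commutator

/-- The parameters of a mean-field Lindblad generator: structure constants `k` of the collective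
operators, `[V_α, V_β] = (i / n) ∑ γ, k_{αβγ} V_γ`, the external field `ε`, and the coefficients
`p`, `q` of the two-body terms `p_{μν} [V_μ, ·] V_ν` and `q_{μν} V_μ [V_ν, ·]`. The matrix
`-i (p + qᵀ)` is real; it is called `g`. -/
structure MFParams (ι : Type*) where
  k : ι → ι → ι → ℝ
  ε : ι → ℝ
  g : ι → ι → ℝ
  p : ι → ι → ℂ
  q : ι → ι → ℂ
  add_eq : ∀ μ ν, p μ ν + q ν μ = Complex.I * g μ ν

section MeanField
variable {ι : Type*} [Fintype ι]

/-- A mean-field system of size `n ^ 2`: collective operators `V` whose commutators are of order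
`1 / n` relative to the `V`, and a Lindblad generator `L`. -/
structure IsMFSystem {A : Type*} [CStarAlgebra A] (P : MFParams ι) (K n : ℝ) (V : ι → A)
    (L : A →L[ℂ] A) : Prop where
  one_le : 1 ≤ n
  sa : ∀ μ, IsSelfAdjoint (V μ)
  comm : ∀ α β, ⁅V α, V β⁆ = (Complex.I / n) • ∑ γ, (P.k α β γ : ℂ) • V γ
  norm_le : ∀ μ, ‖V μ‖ ≤ K * n
  gen : ∀ X, L X = ∑ μ, (Complex.I * P.ε μ * n) • ⁅V μ, X⁆ +
    ∑ μ, ∑ ν, (P.p μ ν • (⁅V μ, X⁆ * V ν) + P.q μ ν • (V μ * ⁅V ν, X⁆))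
  cp : ∀ s : ℝ, 0 ≤ s → NormedSpace.exp ((s : ℂ) • L) ∈ closure (krausMaps A)

namespace MFParams
variable (P : MFParams ι)

/-- The bracket of vectors given by the structure constants. -/
def br (r c : ι → ℝ) : ι → ℝ := fun γ => ∑ α, ∑ μ, r α * c μ * P.k α μ γ

/-- The effective field `ε_μ + ∑ ν, g_{μν} a_ν` in the mean-field state `a`. -/
def field (a : ι → ℝ) : ι → ℝ := fun μ => P.ε μ + ∑ ν, P.g μ ν * a ν

theorem br_smul_left (x : ℝ) (r c : ι → ℝ) : P.br (x • r) c = x • P.br r c := by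
  funext γ
  simp only [br, Pi.smul_apply, smul_eq_mul, Finset.mul_sum]
  exact Finset.sum_congr rfl fun _ _ => Finset.sum_congr rfl fun _ _ => by ring

variable [DecidableEq ι]

/-- The vector field of the macroscopic mean-field dynamics. -/
def meanFieldVF (a : ι → ℝ) : ι → ℝ := fun α => P.br (Pi.single α 1) (P.field a) ⬝ᵥ a

theorem br_single (α : ι) (c : ι → ℝ) (γ : ι) :
    P.br (Pi.single α 1) c γ = ∑ μ, c μ * P.k α μ γ := by
  rw [br, Finset.sum_eq_single α]
  · simp
  · intro β _ h; simp [h]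
  · simp

theorem sum_mul_br_single (r c a : ι → ℝ) :
    ∑ α, r α * (P.br (Pi.single α 1) c ⬝ᵥ a) = P.br r c ⬝ᵥ a := by
  simp only [dotProduct, br_single, Finset.mul_sum]
  rw [Finset.sum_comm]
  simp only [br, Finset.sum_mul, Finset.mul_sum]
  exact Finset.sum_congr rfl fun _ _ => Finset.sum_congr rfl fun _ _ =>
    Finset.sum_congr rfl fun _ _ => by ring

end MFParams

variable {A : Type*} [CStarAlgebra A]

/-- The fluctuation operator `∑ γ, c_γ (V_γ - n a_γ)`, centred at the mean values `n a_γ`. -/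
def fluc (n : ℝ) (V : ι → A) (a : ι → ℝ) (c : ι → ℝ) : A :=
  ∑ γ, (c γ : ℂ) • (V γ - ((n * a γ : ℝ) : ℂ) • 1)

theorem fluc_add (n : ℝ) (V : ι → A) (a c c' : ι → ℝ) :
    fluc n V a (c + c') = fluc n V a c + fluc n V a c' := by
  simp [fluc, add_smul, Finset.sum_add_distrib]

theorem fluc_smul (n : ℝ) (V : ι → A) (a c : ι → ℝ) (x : ℝ) :
    fluc n V a (x • c) = (x : ℂ) • fluc n V a c := by
  simp [fluc, mul_smul, Finset.smul_sum]

theorem fluc_eq (n : ℝ) (V : ι → A) (a c : ι → ℝ) :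
    fluc n V a c = ∑ γ, (c γ : ℂ) • V γ - ((n * (c ⬝ᵥ a) : ℝ) : ℂ) • 1 := by
  simp only [fluc, smul_sub, Finset.sum_sub_distrib, smul_smul, ← Finset.sum_smul, dotProduct,
    Finset.mul_sum]
  congr 2
  push_cast
  exact Finset.sum_congr rfl fun _ _ => by ring

theorem fluc_single [DecidableEq ι] (n : ℝ) (V : ι → A) (a : ι → ℝ) (μ : ι) :
    fluc n V a (Pi.single μ 1) = V μ - ((n * a μ : ℝ) : ℂ) • 1 := by
  rw [fluc, Finset.sum_eq_single μ]
  · simp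
  · intro γ _ h; simp [h]
  · simp

theorem fluc_eq_sum_single [DecidableEq ι] (n : ℝ) (V : ι → A) (a c : ι → ℝ) :
    fluc n V a c = ∑ γ, (c γ : ℂ) • fluc n V a (Pi.single γ 1) := by
  simp only [fluc_single]; rfl

namespace IsMFSystem
variable {P : MFParams ι} {K n : ℝ} {V : ι → A} {L : A →L[ℂ] A} (h : IsMFSystem P K n V L)
include h

theorem n_pos : 0 < n := one_pos.trans_le h.one_le

theorem n_ne_zero : (n : ℂ) ≠ 0 := Complex.ofReal_ne_zero.2 h.n_pos.ne'

theorem isSelfAdjoint_fluc (a c : ι → ℝ) : IsSelfAdjoint (fluc n V a c) := by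
  have h1 : ∀ x : ℝ, ∀ y : A, IsSelfAdjoint y → IsSelfAdjoint ((x : ℂ) • y) := fun x y hy =>
    isSelfAdjoint_ofReal_smul hy x
  exact isSelfAdjoint_sum _ fun γ _ => h1 _ _ ((h.sa γ).sub (h1 _ _ (IsSelfAdjoint.one A)))

/-- The commutation relations of the fluctuations: the commutator is a number up to a relative
correction of order `1 / n`. -/
theorem commutator_fluc (a r c : ι → ℝ) : ⁅fluc n V a r, fluc n V a c⁆ =
    (Complex.I / n) • fluc n V a (P.br r c) + (Complex.I * ((P.br r c ⬝ᵥ a : ℝ) : ℂ)) • 1 := by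
  have hn := h.n_ne_zero
  have e : ⁅fluc n V a r, fluc n V a c⁆ = (Complex.I / n) • ∑ γ, (P.br r c γ : ℂ) • V γ := by
    rw [fluc_eq n V a r, fluc_eq n V a c, commutator_sub_right, commutator_smul_one_right, sub_zero,
      sub_eq_add_neg, commutator_add_left, ← neg_smul, commutator_smul_one_left, add_zero]
    simp only [commutator_sum_right, commutator_sum_left, commutator_smul_left,
      commutator_smul_right, h.comm, Finset.smul_sum, smul_smul, MFParams.br, Complex.ofReal_sum,
      Finset.sum_smul]
    rw [Finset.sum_comm]
    conv_rhs => rw [Finset.sum_comm]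
    refine Finset.sum_congr rfl fun α _ => ?_
    rw [Finset.sum_comm]
    refine Finset.sum_congr rfl fun γ _ => Finset.sum_congr rfl fun μ _ => ?_
    congr 1
    push_cast; ring
  rw [e, fluc_eq, smul_sub, smul_smul]
  have : Complex.I / n * ((n * (P.br r c ⬝ᵥ a) : ℝ) : ℂ) =
      Complex.I * ((P.br r c ⬝ᵥ a : ℝ) : ℂ) := by
    push_cast; field_simp
  rw [this, sub_add_cancel]

theorem gen_one : L 1 = 0 := by
  have h1 : ∀ x : A, ⁅x, (1 : A)⁆ = 0 := fun x => by simp [Ring.lie_def]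
  simp [h.gen, h1]

theorem exp_one (s : ℝ) : NormedSpace.exp ((s : ℂ) • L) 1 = 1 := by
  have hd : ∀ s : ℝ, HasDerivAt (fun s : ℝ => NormedSpace.exp ((s : ℂ) • L) 1) 0 s := fun s => by
    have h1 := hasDerivAt_exp_smul L s
    have h2 := ((ContinuousLinearMap.apply ℂ A (1 : A)).restrictScalars ℝ).hasFDerivAt
      |>.comp_hasDerivAt s h1
    refine h2.congr_deriv ?_
    show NormedSpace.exp ((s : ℂ) • L) (L 1) = 0
    rw [h.gen_one, map_zero]
  have := is_const_of_deriv_eq_zero (fun s => (hd s).differentiableAt) (fun s => (hd s).deriv) s 0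
  let _ : NormedAlgebra ℚ (A →L[ℂ] A) := NormedAlgebra.restrictScalars ℚ ℂ _
  simpa [zero_smul ℂ L] using this

/-- The generator commutes with the involution, as the semigroup does. -/
theorem gen_star (X : A) : L (star X) = star (L X) := by
  have hd : ∀ X : A,
      HasDerivAt (fun s : ℝ => NormedSpace.exp ((s : ℂ) • L) X) (L X) 0 := fun X => by
    have h1 := hasDerivAt_exp_smul L 0
    have h2 := ((ContinuousLinearMap.apply ℂ A X).restrictScalars ℝ).hasFDerivAt
      |>.comp_hasDerivAt 0 h1
    refine h2.congr_deriv ?_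
    show NormedSpace.exp (((0 : ℝ) : ℂ) • L) (L X) = L X
    let _ : NormedAlgebra ℚ (A →L[ℂ] A) := NormedAlgebra.restrictScalars ℚ ℂ _
    rw [Complex.ofReal_zero, zero_smul ℂ L, NormedSpace.exp_zero]; rfl
  have h1 := (hd (star X)).hasDerivWithinAt (s := Set.Ici 0)
  have h2 := (hd X).star
  have h3 : HasDerivWithinAt (fun s : ℝ => NormedSpace.exp ((s : ℂ) • L) (star X)) (star (L X))
      (Set.Ici 0) 0 := h2.hasDerivWithinAt.congr
    (fun s hs => star_map_of_mem_closure (h.cp s hs) X) (star_map_of_mem_closure (h.cp 0 le_rfl) X)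
  exact (uniqueDiffWithinAt_Ici 0).eq_deriv _ h1 h3

/-- The generator in terms of centred operators: centring the two-body terms at `n a` produces a
contribution of order `n` to the effective field. -/
theorem gen_centred [DecidableEq ι] (a : ι → ℝ) (X : A) :
    L X = (Complex.I * n) • ⁅fluc n V a (P.field a), X⁆ + ∑ μ, ∑ ν,
      (P.p μ ν • (⁅fluc n V a (Pi.single μ 1), X⁆ * fluc n V a (Pi.single ν 1)) +
        P.q μ ν • (fluc n V a (Pi.single μ 1) * ⁅fluc n V a (Pi.single ν 1), X⁆)) := by
  have e1 : ∀ μ, ⁅fluc n V a (Pi.single μ 1), X⁆ = ⁅V μ, X⁆ := fun μ => by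
    rw [fluc_single, sub_eq_add_neg, ← neg_smul, commutator_add_left, commutator_smul_one_left,
      add_zero]
  have e2 : ⁅fluc n V a (P.field a), X⁆ = ∑ μ, (P.field a μ : ℂ) • ⁅V μ, X⁆ := by
    rw [fluc_eq_sum_single, commutator_sum_left]
    simp only [commutator_smul_left, e1]
  have e3 : ∑ μ, ∑ ν, (P.p μ ν • (⁅V μ, X⁆ * V ν) + P.q μ ν • (V μ * ⁅V ν, X⁆)) =
      ∑ μ, ∑ ν, (P.p μ ν • (⁅V μ, X⁆ * fluc n V a (Pi.single ν 1)) +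
        P.q μ ν • (fluc n V a (Pi.single μ 1) * ⁅V ν, X⁆)) +
      ∑ μ, ∑ ν, ((Complex.I * P.g μ ν) * (n * a ν)) • ⁅V μ, X⁆ := by
    have : ∑ μ, ∑ ν, ((Complex.I * P.g μ ν) * (n * a ν)) • ⁅V μ, X⁆ =
        ∑ μ, ∑ ν, ((P.p μ ν * (n * a ν)) • ⁅V μ, X⁆ + (P.q μ ν * (n * a μ)) • ⁅V ν, X⁆) := by
      simp only [← P.add_eq, add_mul, add_smul, Finset.sum_add_distrib]
      congr 1
      exact Finset.sum_comm
    rw [this]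
    simp only [← Finset.sum_add_distrib]
    refine Finset.sum_congr rfl fun μ _ => Finset.sum_congr rfl fun ν _ => ?_
    simp only [fluc_single, mul_sub, sub_mul, smul_sub, mul_smul_comm, smul_mul_assoc, mul_one,
      one_mul, smul_smul]
    push_cast
    abel
  simp only [e1]
  rw [h.gen, e3, e2, Finset.smul_sum, ← add_assoc, add_right_comm]
  congr 1
  rw [← Finset.sum_add_distrib]
  refine Finset.sum_congr rfl fun μ _ => ?_
  rw [← Finset.sum_smul, ← add_smul, smul_smul, MFParams.field]
  congr 1
  push_cast
  rw [mul_add, Finset.mul_sum]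
  congr 1
  · ring
  · exact Finset.sum_congr rfl fun _ _ => by ring

/-- The failure of the Leibniz rule for the generator. -/
theorem gen_mul (X Y : A) : L (X * Y) = L X * Y + X * L Y +
    ∑ μ, ∑ ν, (P.p μ ν - P.q μ ν) • (⁅V μ, X⁆ * ⁅Y, V ν⁆) := by
  have e0 : ∑ μ, (Complex.I * P.ε μ * n) • ⁅V μ, X * Y⁆ =
      (∑ μ, (Complex.I * P.ε μ * n) • ⁅V μ, X⁆) * Y +
        X * ∑ μ, (Complex.I * P.ε μ * n) • ⁅V μ, Y⁆ := by
    rw [Finset.sum_mul, Finset.mul_sum, ← Finset.sum_add_distrib]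
    refine Finset.sum_congr rfl fun μ _ => ?_
    rw [smul_mul_assoc, mul_smul_comm, ← smul_add]
    congr 1
    simp only [Ring.lie_def]; noncomm_ring
  have e1 : ∑ μ, ∑ ν, (P.p μ ν • (⁅V μ, X * Y⁆ * V ν) + P.q μ ν • (V μ * ⁅V ν, X * Y⁆)) =
      (∑ μ, ∑ ν, (P.p μ ν • (⁅V μ, X⁆ * V ν) + P.q μ ν • (V μ * ⁅V ν, X⁆))) * Y +
      X * (∑ μ, ∑ ν, (P.p μ ν • (⁅V μ, Y⁆ * V ν) + P.q μ ν • (V μ * ⁅V ν, Y⁆))) +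
      ∑ μ, ∑ ν, (P.p μ ν - P.q μ ν) • (⁅V μ, X⁆ * ⁅Y, V ν⁆) := by
    simp only [Finset.sum_mul, Finset.mul_sum, ← Finset.sum_add_distrib]
    refine Finset.sum_congr rfl fun μ _ => Finset.sum_congr rfl fun ν _ => ?_
    simp only [Ring.lie_def, add_mul, mul_add, smul_mul_assoc, mul_smul_comm, sub_smul, mul_sub,
      sub_mul, smul_sub, mul_assoc]
    abel
  rw [h.gen, h.gen, h.gen, e0, e1, add_mul, mul_add]
  abel

end IsMFSystem

end MeanField

/-! ### Uniform estimates for families of mean-field systems -/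

section Families
variable {J : Type*} {A : Type*} [CStarAlgebra A]

/-- Uniform bounds in the GNS seminorms of a family of states. The filter `⊤` on the index set makes
`=O[⊤]` a bound on all members of the family, not an asymptotic one. -/
def SBig (φ : J → A →ₗ[ℂ] ℂ) (X : J → A) (S : J → ℝ) : Prop :=
  (fun j => snorm (φ j) (X j)) =O[⊤] S

namespace SBig
variable {φ : J → A →ₗ[ℂ] ℂ} (hφ : ∀ j, IsPosUnital (φ j)) {X Y Z : J → A} {S f : J → ℝ}

theorem congr (hX : SBig φ X S) (hXY : ∀ j, X j = Y j) : SBig φ Y S :=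
  (funext hXY : X = Y) ▸ hX

include hφ

theorem add (hX : SBig φ X S) (hY : SBig φ Y S) : SBig φ (fun j => X j + Y j) S := by
  refine IsBigO.trans (IsBigO.of_norm_le fun j => ?_) (IsBigO.add hX hY)
  rw [Real.norm_of_nonneg (snorm_nonneg _ _)]
  exact (hφ j).snorm_add_le _ _

theorem sum {κ : Type*} (s : Finset κ) {X : κ → J → A} (hX : ∀ i ∈ s, SBig φ (X i) S) :
    SBig φ (fun j => ∑ i ∈ s, X i j) S := by
  refine IsBigO.trans (IsBigO.of_norm_le fun j => ?_) (IsBigO.fun_sum hX)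
  rw [Real.norm_of_nonneg (snorm_nonneg _ _)]
  exact (hφ j).snorm_sum_le _ _

theorem mul (hZ : Z =O[⊤] f) (hX : SBig φ X S) :
    SBig φ (fun j => Z j * X j) fun j => f j * S j := by
  refine IsBigO.trans (IsBigO.of_norm_le fun j => ?_) (hZ.norm_left.mul hX)
  rw [Real.norm_of_nonneg (snorm_nonneg _ _)]
  exact (hφ j).snorm_mul_le _ _

theorem bdd_mul (hZ : Z =O[⊤] fun _ => (1 : ℝ)) (hX : SBig φ X S) :
    SBig φ (fun j => Z j * X j) S := by
  simpa using mul hφ hZ hX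

theorem of_isBigO (hX : X =O[⊤] S) : SBig φ X S := by
  refine IsBigO.trans (IsBigO.of_norm_le fun j => ?_) hX.norm_left
  rw [Real.norm_of_nonneg (snorm_nonneg _ _)]
  exact (hφ j).snorm_le_norm _

omit hφ in
theorem smul {c : J → ℂ} (hc : c =O[⊤] f) (hX : SBig φ X S) :
    SBig φ (fun j => c j • X j) fun j => f j * S j := by
  simp only [SBig, snorm_smul]
  exact hc.norm_left.mul hX

omit hφ in
theorem bdd_smul {c : J → ℂ} (hc : c =O[⊤] fun _ => (1 : ℝ)) (hX : SBig φ X S) :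
    SBig φ (fun j => c j • X j) S := by
  simpa using smul hc hX

end SBig

/-- A functional `Ψ` controlled by two states through a Cauchy–Schwarz inequality, such as
`x ↦ ω (a* γ(x) b)` for a completely positive unital `γ`. -/
structure IsCross (Ψ φ φ' : A →ₗ[ℂ] ℂ) : Prop where
  left : IsPosUnital φ
  right : IsPosUnital φ'
  bound : ∀ x y, ‖Ψ (star x * y)‖ ≤ snorm φ x * snorm φ' y

section Cross
variable {Ψ φ φ' : J → A →ₗ[ℂ] ℂ} (hΨ : ∀ j, IsCross (Ψ j) (φ j) (φ' j)) {f g : J → ℝ} {X Y : J → A}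
include hΨ

theorem IsCross.isBigO_star_mul (hX : SBig φ X f) (hY : SBig φ' Y g) :
    (fun j => Ψ j (star (X j) * Y j)) =O[⊤] fun j => f j * g j := by
  refine IsBigO.trans (IsBigO.of_norm_le fun j => ?_) (IsBigO.mul hX hY)
  exact (hΨ j).bound _ _

theorem IsCross.isBigO_right (hY : SBig φ' Y g) : (fun j => Ψ j (Y j)) =O[⊤] g := by
  have h1 : SBig φ (fun _ : J => (1 : A)) fun _ => 1 :=
    SBig.of_isBigO (fun j => (hΨ j).left) (isBigO_const_const _ one_ne_zero _)
  simpa using IsCross.isBigO_star_mul hΨ h1 hY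

end Cross

variable {ι : Type*} [Fintype ι] {P : MFParams ι} {K : ℝ} {n : J → ℝ} {V : J → ι → A}
  {L : J → A →L[ℂ] A}

theorem isBigO_dotProduct {r c : J → ι → ℝ} (hr : r =O[⊤] fun _ => (1 : ℝ))
    (hc : c =O[⊤] fun _ => (1 : ℝ)) :
    (fun j => r j ⬝ᵥ c j) =O[⊤] (fun _ => (1 : ℝ)) := by
  refine IsBigO.fun_sum fun i _ => ?_
  simpa using (isBigO_pi.1 hr i).mul (isBigO_pi.1 hc i)

theorem MFParams.isBigO_br (P : MFParams ι) {r c : J → ι → ℝ} (hr : r =O[⊤] fun _ => (1 : ℝ))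
    (hc : c =O[⊤] fun _ => (1 : ℝ)) : (fun j => P.br (r j) (c j)) =O[⊤] (fun _ => (1 : ℝ)) := by
  refine isBigO_pi.2 fun γ => IsBigO.fun_sum fun α _ => IsBigO.fun_sum fun μ _ => ?_
  have := ((isBigO_pi.1 hr α).mul (isBigO_pi.1 hc μ)).mul
    (isBigO_const_const (P.k α μ γ) (one_ne_zero' ℝ) ⊤)
  simpa using this

theorem MFParams.isBigO_field (P : MFParams ι) {a : J → ι → ℝ} (ha : a =O[⊤] fun _ => (1 : ℝ)) :
    (fun j => P.field (a j)) =O[⊤] (fun _ => (1 : ℝ)) := by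
  refine isBigO_pi.2 fun μ => IsBigO.add (isBigO_const_const _ one_ne_zero _)
    (IsBigO.fun_sum fun ν _ => ?_)
  exact (isBigO_pi.1 ha ν).const_mul_left _

theorem isBigO_ofReal_inv_n : (fun j => ((n j : ℂ))⁻¹) =O[⊤] fun j => (n j)⁻¹ := by
  simpa using Complex.isBigO_ofReal_left.2 (isBigO_refl (fun j => (n j)⁻¹) ⊤)

theorem isBigO_smul_one {c : J → ℝ} {f : J → ℝ} (hc : c =O[⊤] f) :
    (fun j => (c j : ℂ) • (1 : A)) =O[⊤] f := by
  have := (Complex.isBigO_ofReal_left.2 hc).smul (isBigO_const_const (1 : A) (one_ne_zero' ℝ) ⊤)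
  simpa using this

variable (h : ∀ j, IsMFSystem P K (n j) (V j) (L j))
include h

theorem n_mul_inv_n : (fun j => n j * (n j)⁻¹) = (fun _ => (1 : ℝ)) := by
  funext j; exact mul_inv_cancel₀ (h j).n_pos.ne'

theorem isBigO_V (μ : ι) : (fun j => V j μ) =O[⊤] n := by
  refine IsBigO.of_bound K (Eventually.of_forall fun j => ?_)
  rw [Real.norm_of_nonneg (h j).n_pos.le]
  exact (h j).norm_le μ

theorem isBigO_fluc {a c : J → ι → ℝ} (ha : a =O[⊤] fun _ => (1 : ℝ))
    (hc : c =O[⊤] fun _ => (1 : ℝ)) :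
    (fun j => fluc (n j) (V j) (a j) (c j)) =O[⊤] n := by
  refine IsBigO.fun_sum fun γ _ => ?_
  have h1 : (fun j => n j * a j γ) =O[⊤] n := by
    simpa using (isBigO_refl n ⊤).mul (isBigO_pi.1 ha γ)
  have := (Complex.isBigO_ofReal_left.2 (isBigO_pi.1 hc γ)).smul
    ((isBigO_V h γ).sub (isBigO_smul_one h1))
  simpa using this

theorem isBigO_inv_smul_fluc {a c : J → ι → ℝ} (ha : a =O[⊤] fun _ => (1 : ℝ))
    (hc : c =O[⊤] fun _ => (1 : ℝ)) :
    (fun j => ((n j : ℂ)⁻¹) • fluc (n j) (V j) (a j) (c j)) =O[⊤] (fun _ => (1 : ℝ)) := by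
  have := (isBigO_ofReal_inv_n (n := n)).smul (isBigO_fluc h ha hc)
  simp only [smul_eq_mul] at this
  rwa [show (fun j => (n j)⁻¹ * n j) = (fun _ => (1 : ℝ)) by
    simpa only [mul_comm] using n_mul_inv_n h] at this

section SBig
variable [DecidableEq ι] {φ : J → A →ₗ[ℂ] ℂ} {a : J → ι → ℝ} {S : J → ℝ}

omit h in
theorem sBig_fluc (hφ : ∀ j, IsPosUnital (φ j))
    (hF : ∀ μ, SBig φ (fun j => fluc (n j) (V j) (a j) (Pi.single μ 1)) S)
    {c : J → ι → ℝ} (hc : c =O[⊤] fun _ => (1 : ℝ)) :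
    SBig φ (fun j => fluc (n j) (V j) (a j) (c j)) S := by
  rw [show (fun j => fluc (n j) (V j) (a j) (c j)) = fun j => ∑ γ, (c j γ : ℂ) •
    fluc (n j) (V j) (a j) (Pi.single γ 1) from funext fun j => fluc_eq_sum_single _ _ _ _]
  exact SBig.sum hφ _ fun γ _ =>
    SBig.bdd_smul (Complex.isBigO_ofReal_left.2 (isBigO_pi.1 hc γ)) (hF γ)

end SBig

/-! ### Rotation of the fluctuations by the local exponentials -/

section Rotation
variable {a r c : J → ι → ℝ} (ha : a =O[⊤] fun _ => (1 : ℝ)) (hr : r =O[⊤] fun _ => (1 : ℝ))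
  (hc : c =O[⊤] fun _ => (1 : ℝ))

omit h in
theorem IsMFSystem.commutator_commutator_fluc {n : ℝ} {V : ι → A} {L : A →L[ℂ] A}
    (h : IsMFSystem P K n V L) (a r c : ι → ℝ) :
    ⁅fluc n V a r, ⁅fluc n V a r, fluc n V a c⁆⁆ =
      -(((n : ℂ)⁻¹ ^ 2) • fluc n V a (P.br r (P.br r c)) +
        ((n : ℂ)⁻¹ * ((P.br r (P.br r c) ⬝ᵥ a : ℝ) : ℂ)) • 1) := by
  rw [h.commutator_fluc a r c, commutator_add_right, commutator_smul_one_right, add_zero,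
    commutator_smul_right, h.commutator_fluc, smul_add, smul_smul, smul_smul, neg_add, ← neg_smul,
    ← neg_smul]
  congr 2
  · rw [div_mul_div_comm, Complex.I_mul_I, neg_div, inv_pow, sq, one_div]
  · rw [div_mul_eq_mul_div, ← mul_assoc, Complex.I_mul_I, div_eq_inv_mul]; ring

include ha hr hc

theorem isBigO_commutator_commutator :
    (fun j => ⁅fluc (n j) (V j) (a j) (r j), ⁅fluc (n j) (V j) (a j) (r j),
      fluc (n j) (V j) (a j) (c j)⁆⁆) =O[⊤] fun j => (n j)⁻¹ := by
  simp only [(h _).commutator_commutator_fluc]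
  have hc1 : (fun j => P.br (r j) (c j)) =O[⊤] (fun _ => (1 : ℝ)) := P.isBigO_br hr hc
  have hc2 : (fun j => P.br (r j) (P.br (r j) (c j))) =O[⊤] (fun _ => (1 : ℝ)) := P.isBigO_br hr hc1
  refine (IsBigO.add ?_ ?_).neg_left
  · have h1 := isBigO_inv_smul_fluc h ha hc2
    have h2 := (isBigO_ofReal_inv_n (n := n)).smul h1
    simpa [smul_smul, sq] using h2
  · have h1 := isBigO_dotProduct hc2 ha
    have h2 := isBigO_smul_one (A := A) h1
    have h3 := (isBigO_ofReal_inv_n (n := n)).smul h2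
    simpa only [smul_smul, smul_eq_mul, mul_one] using h3

/-- First-order expansion of the rotation of a fluctuation. -/
theorem isBigO_conjFlow_sub :
    (fun j => conjFlow (fluc (n j) (V j) (a j) (r j)) (fluc (n j) (V j) (a j) (c j)) 1 -
      fluc (n j) (V j) (a j) (c j) - ((P.br (r j) (c j) ⬝ᵥ a j : ℝ) : ℂ) • 1 -
      (n j : ℂ)⁻¹ • fluc (n j) (V j) (a j) (P.br (r j) (c j))) =O[⊤] fun j => (n j)⁻¹ := by
  refine IsBigO.trans (IsBigO.of_norm_le fun j => ?_)
    (isBigO_commutator_commutator h ha hr hc).norm_left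
  have := norm_conjFlow_sub_sub_le ((h j).isSelfAdjoint_fluc (a j) (r j))
    (fluc (n j) (V j) (a j) (c j)) (u := 1) (by simp)
  refine le_trans (le_of_eq ?_) this
  rw [(h j).commutator_fluc]
  congr 1
  have e1 : Complex.I * (Complex.I / n j) = -(n j : ℂ)⁻¹ := by
    rw [mul_div_assoc', Complex.I_mul_I, neg_div, one_div]
  have e2 : ∀ x : ℂ, Complex.I * (Complex.I * x) = -x := fun x => by
    rw [← mul_assoc, Complex.I_mul_I, neg_one_mul]
  rw [Complex.ofReal_one, one_smul, smul_add, smul_smul, smul_smul, e1, e2]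
  module

/-- Second-order expansion of the rotation of a fluctuation. -/
theorem isBigO_conjFlow_sub_sub :
    (fun j => conjFlow (fluc (n j) (V j) (a j) (r j)) (fluc (n j) (V j) (a j) (c j)) 1 -
      fluc (n j) (V j) (a j) (c j) - ((P.br (r j) (c j) ⬝ᵥ a j : ℝ) : ℂ) • 1 -
      (n j : ℂ)⁻¹ • fluc (n j) (V j) (a j) (P.br (r j) (c j)) -
      ((n j : ℂ)⁻¹ * ((P.br (r j) (P.br (r j) (c j)) ⬝ᵥ a j : ℝ) : ℂ) / 2) • 1 -
      ((n j : ℂ)⁻¹ ^ 2 / 2) • fluc (n j) (V j) (a j) (P.br (r j) (P.br (r j) (c j))))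
      =O[⊤] fun j => (n j)⁻¹ * (n j)⁻¹ := by
  have hc1 : (fun j => P.br (r j) (c j)) =O[⊤] (fun _ => (1 : ℝ)) := P.isBigO_br hr hc
  have hc2 : (fun j => P.br (r j) (P.br (r j) (c j))) =O[⊤] (fun _ => (1 : ℝ)) := P.isBigO_br hr hc1
  have htriple : (fun j => ⁅fluc (n j) (V j) (a j) (r j), ⁅fluc (n j) (V j) (a j) (r j),
      ⁅fluc (n j) (V j) (a j) (r j), fluc (n j) (V j) (a j) (c j)⁆⁆⁆) =O[⊤]
      fun j => (n j)⁻¹ * (n j)⁻¹ := by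
    have e : ∀ j, ⁅fluc (n j) (V j) (a j) (r j), ⁅fluc (n j) (V j) (a j) (r j),
        ⁅fluc (n j) (V j) (a j) (r j), fluc (n j) (V j) (a j) (c j)⁆⁆⁆ = (Complex.I / n j) •
        ⁅fluc (n j) (V j) (a j) (r j), ⁅fluc (n j) (V j) (a j) (r j),
          fluc (n j) (V j) (a j) (P.br (r j) (c j))⁆⁆ := fun j => by
      rw [(h j).commutator_fluc (a j) (r j) (c j), commutator_add_right,
        commutator_smul_one_right, add_zero, commutator_smul_right, commutator_smul_right]
    simp only [e]
    have h1 : (fun j => Complex.I / (n j : ℂ)) =O[⊤] fun j => (n j)⁻¹ := by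
      simpa [div_eq_mul_inv] using (isBigO_ofReal_inv_n (n := n)).const_mul_left Complex.I
    have h2 := isBigO_commutator_commutator h ha hr hc1
    exact h1.smul h2
  refine IsBigO.trans (IsBigO.of_norm_le fun j => ?_) htriple.norm_left
  have := norm_conjFlow_sub_sub_sub_le ((h j).isSelfAdjoint_fluc (a j) (r j))
    (fluc (n j) (V j) (a j) (c j)) (u := 1) (by simp)
  refine le_trans (le_of_eq ?_) this
  rw [(h j).commutator_commutator_fluc (a j) (r j) (c j), (h j).commutator_fluc (a j) (r j) (c j)]
  congr 1
  have e1 : Complex.I * (Complex.I / n j) = -(n j : ℂ)⁻¹ := by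
    rw [mul_div_assoc', Complex.I_mul_I, neg_div, one_div]
  have e2 : ∀ x : ℂ, Complex.I * (Complex.I * x) = -x := fun x => by
    rw [← mul_assoc, Complex.I_mul_I, neg_one_mul]
  rw [Complex.ofReal_one, one_smul, smul_add, smul_smul, smul_smul, e1, e2]
  module

end Rotation

end Families

/-! ### The generator on linear and quadratic functions of the fluctuations -/

section Generator
variable {J : Type*} {A : Type*} [CStarAlgebra A] {ι : Type*} [Fintype ι] [DecidableEq ι]

namespace MFParams
variable (P : MFParams ι)

/-- The linear vector field along which the label `r` of a Weyl operator is transported, in the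
mean-field state `a`. -/
def labelVF (a r : ι → ℝ) : ι → ℝ := fun γ =>
  -(P.br r (P.field a) γ + ∑ μ, P.g μ γ * (P.br r (Pi.single μ 1) ⬝ᵥ a))

/-- The logarithmic derivative of the scalar factor of a transported Weyl operator. -/
def rate (a r : ι → ℝ) : ℂ :=
  Complex.I / 2 * ((P.br r (P.br r (P.field a)) ⬝ᵥ a : ℝ) : ℂ) +
    ∑ μ, ∑ ν, P.q μ ν * (((P.br r (Pi.single ν 1) ⬝ᵥ a : ℝ) : ℂ) *
      ((P.br r (Pi.single μ 1) ⬝ᵥ a : ℝ) : ℂ)) +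
    Complex.I / 2 * ((P.br r (P.labelVF a r) ⬝ᵥ a : ℝ) : ℂ)

theorem isBigO_labelVF {a r : J → ι → ℝ} (ha : a =O[⊤] fun _ => (1 : ℝ))
    (hr : r =O[⊤] fun _ => (1 : ℝ)) :
    (fun j => P.labelVF (a j) (r j)) =O[⊤] fun _ => (1 : ℝ) := by
  have h1 : (fun j => P.br (r j) (P.field (a j))) =O[⊤] fun _ => (1 : ℝ) :=
    P.isBigO_br hr (P.isBigO_field ha)
  refine isBigO_pi.2 fun γ => ((isBigO_pi.1 h1 γ).add (IsBigO.fun_sum fun μ _ => ?_)).neg_left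
  have h2 : (fun j => P.br (r j) (Pi.single μ 1)) =O[⊤] fun _ => (1 : ℝ) :=
    P.isBigO_br hr (isBigO_const_const _ one_ne_zero _)
  exact (isBigO_dotProduct h2 ha).const_mul_left _

end MFParams

variable {P : MFParams ι} {K : ℝ} {n : J → ℝ} {V : J → ι → A} {L : J → A →L[ℂ] A}
  (h : ∀ j, IsMFSystem P K (n j) (V j) (L j))
include h

omit h in
theorem isBigO_single (μ : ι) :
    (fun _ : J => (Pi.single μ 1 : ι → ℝ)) =O[⊤] fun _ => (1 : ℝ) :=
  isBigO_const_const _ one_ne_zero _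

omit [DecidableEq ι] in
theorem isBigO_commutator_fluc {a r c : J → ι → ℝ} (ha : a =O[⊤] fun _ => (1 : ℝ))
    (hr : r =O[⊤] fun _ => (1 : ℝ)) (hc : c =O[⊤] fun _ => (1 : ℝ)) :
    (fun j => ⁅fluc (n j) (V j) (a j) (r j), fluc (n j) (V j) (a j) (c j)⁆) =O[⊤]
      fun _ => (1 : ℝ) := by
  have hb : (fun j => P.br (r j) (c j)) =O[⊤] fun _ => (1 : ℝ) := P.isBigO_br hr hc
  have h1 := isBigO_inv_smul_fluc h ha hb
  have h2 := isBigO_dotProduct hb ha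
  have h3 := isBigO_smul_one (A := A) h2
  have e : ∀ j, ⁅fluc (n j) (V j) (a j) (r j), fluc (n j) (V j) (a j) (c j)⁆ =
      Complex.I • ((n j : ℂ)⁻¹ • fluc (n j) (V j) (a j) (P.br (r j) (c j)) +
        ((P.br (r j) (c j) ⬝ᵥ a j : ℝ) : ℂ) • (1 : A)) := fun j => by
    rw [(h j).commutator_fluc, smul_add, smul_smul, smul_smul, div_eq_mul_inv]
  simp only [e]
  exact IsBigO.const_smul_left (h1.add h3) Complex.I

theorem isBigO_commutator_V {a c : J → ι → ℝ} (ha : a =O[⊤] fun _ => (1 : ℝ))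
    (hc : c =O[⊤] fun _ => (1 : ℝ)) (μ : ι) :
    (fun j => ⁅V j μ, fluc (n j) (V j) (a j) (c j)⁆) =O[⊤] fun _ => (1 : ℝ) := by
  have h1 := isBigO_commutator_fluc h ha (isBigO_single μ) hc
  refine h1.congr_left fun j => ?_
  rw [fluc_single, sub_eq_add_neg, ← neg_smul, commutator_add_left, commutator_smul_one_left,
    add_zero]

omit h in
/-- The generator on a fluctuation: the macroscopic drift `n · meanFieldVF` plus terms with a
fluctuation in each summand. -/
theorem IsMFSystem.gen_fluc {n : ℝ} {V : ι → A} {L : A →L[ℂ] A} (h : IsMFSystem P K n V L)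
    (a : ι → ℝ) (α : ι) :
    L (fluc n V a (Pi.single α 1)) - ((n * P.meanFieldVF a α : ℝ) : ℂ) • 1 =
      fluc n V a (P.br (Pi.single α 1) (P.field a)) + ∑ μ, ∑ ν,
      (P.p μ ν • (⁅fluc n V a (Pi.single μ 1), fluc n V a (Pi.single α 1)⁆
        * fluc n V a (Pi.single ν 1)) +
        P.q μ ν • (fluc n V a (Pi.single μ 1) *
          ⁅fluc n V a (Pi.single ν 1), fluc n V a (Pi.single α 1)⁆)) := by
  have hn := h.n_ne_zero
  rw [h.gen_centred a, add_sub_right_comm]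
  congr 1
  rw [commutator_swap, h.commutator_fluc, MFParams.meanFieldVF, smul_neg, smul_add, smul_smul,
    smul_smul]
  have e1 : Complex.I * (n : ℂ) * (Complex.I / n) = -1 := by
    rw [mul_div_assoc', mul_right_comm, Complex.I_mul_I]; field_simp
  rw [e1, mul_mul_mul_comm, Complex.I_mul_I]
  push_cast
  module

section State
variable {φ : J → A →ₗ[ℂ] ℂ} (hφ : ∀ j, IsPosUnital (φ j)) {a : J → ι → ℝ} {S : J → ℝ}
  (ha : a =O[⊤] fun _ => (1 : ℝ))
  (hF : ∀ μ, SBig φ (fun j => fluc (n j) (V j) (a j) (Pi.single μ 1)) S)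
include hφ ha hF

/-- The generator maps a fluctuation to its macroscopic drift `n · meanFieldVF` plus terms that are
dominated by fluctuations. -/
theorem sBig_gen_fluc (α : ι) :
    SBig φ (fun j => L j (fluc (n j) (V j) (a j) (Pi.single α 1)) -
      ((n j * P.meanFieldVF (a j) α : ℝ) : ℂ) • 1) S := by
  have hfield : (fun j => P.field (a j)) =O[⊤] fun _ => (1 : ℝ) := P.isBigO_field ha
  have hb : (fun j => P.br (Pi.single α 1) (P.field (a j))) =O[⊤] fun _ => (1 : ℝ) :=
    P.isBigO_br (isBigO_single α) hfield
  simp only [(h _).gen_fluc]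
  refine SBig.add hφ (sBig_fluc hφ hF hb) (SBig.sum hφ _ fun μ _ => SBig.sum hφ _ fun ν _ =>
    SBig.add hφ ?_ ?_)
  · have h1 := isBigO_commutator_fluc h ha (isBigO_single μ) (isBigO_single α)
    exact SBig.bdd_smul (isBigO_const_const _ one_ne_zero _) (SBig.bdd_mul hφ h1 (hF ν))
  · refine SBig.bdd_smul (isBigO_const_const _ one_ne_zero _) ?_
    have hc : (fun _ : J => P.br (Pi.single ν 1) (Pi.single α 1)) =O[⊤] fun _ => (1 : ℝ) :=
      isBigO_const_const _ one_ne_zero _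
    have e2 : ∀ j, fluc (n j) (V j) (a j) (Pi.single μ 1) *
        ⁅fluc (n j) (V j) (a j) (Pi.single ν 1), fluc (n j) (V j) (a j) (Pi.single α 1)⁆ =
        Complex.I • (((n j : ℂ)⁻¹ • fluc (n j) (V j) (a j) (Pi.single μ 1)) *
          fluc (n j) (V j) (a j) (P.br (Pi.single ν 1) (Pi.single α 1))) +
        (Complex.I * ((P.br (Pi.single ν 1) (Pi.single α 1) ⬝ᵥ a j : ℝ) : ℂ)) •
          fluc (n j) (V j) (a j) (Pi.single μ 1) := fun j => by
      rw [(h j).commutator_fluc, mul_add, mul_smul_comm, mul_smul_comm, mul_one, smul_mul_assoc,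
        smul_smul, div_eq_mul_inv]
    simp only [e2]
    refine SBig.add hφ (SBig.bdd_smul (isBigO_const_const _ one_ne_zero _)
      (SBig.bdd_mul hφ (isBigO_inv_smul_fluc h ha (isBigO_single μ)) (sBig_fluc hφ hF hc)))
      (SBig.bdd_smul ?_ (hF μ))
    exact (Complex.isBigO_ofReal_left.2 (isBigO_dotProduct hc ha)).const_mul_left _

end State

/-- The differential inequality for the second moments of the fluctuations. It needs that the
centring `a` has speed `a'` with `∑ μ, (meanFieldVF a - a')_μ φ(F_μ) = 0`. -/
theorem isBigO_deriv_secondMoment {φ : J → A →ₗ[ℂ] ℂ} (hφ : ∀ j, IsPosUnital (φ j))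
    {a a' : J → ι → ℝ} (ha : a =O[⊤] fun _ => (1 : ℝ))
    (hzero : ∀ j, ∑ μ, ((P.meanFieldVF (a j) μ - a' j μ : ℝ) : ℂ) *
      φ j (fluc (n j) (V j) (a j) (Pi.single μ 1)) = 0) :
    (fun j => ∑ μ, φ j (L j (fluc (n j) (V j) (a j) (Pi.single μ 1) *
        fluc (n j) (V j) (a j) (Pi.single μ 1)) -
      ((2 * n j * a' j μ : ℝ) : ℂ) • fluc (n j) (V j) (a j) (Pi.single μ 1))) =O[⊤]
    fun j => ∑ μ, (φ j (fluc (n j) (V j) (a j) (Pi.single μ 1) *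
        fluc (n j) (V j) (a j) (Pi.single μ 1))).re + 1 := by
  set F : ι → J → A := fun μ j => fluc (n j) (V j) (a j) (Pi.single μ 1) with hFdef
  have hsa : ∀ μ j, star (F μ j) = F μ j := fun μ j =>
    (h j).isSelfAdjoint_fluc (a j) (Pi.single μ 1)
  set G : J → ℝ := fun j => ∑ μ, (φ j (F μ j * F μ j)).re with hG
  have hpos : ∀ μ j, 0 ≤ (φ j (F μ j * F μ j)).re := fun μ j => by
    have := (hφ j).re_nonneg (F μ j); rwa [hsa] at this
  have hG0 : ∀ j, 0 ≤ G j := fun j => Finset.sum_nonneg fun μ _ => hpos μ j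
  have hF : ∀ μ, SBig φ (F μ) fun j => √(G j) := fun μ => by
    refine IsBigO.of_norm_le fun j => ?_
    rw [Real.norm_of_nonneg (snorm_nonneg _ _), snorm, hsa]
    exact Real.sqrt_le_sqrt (Finset.single_le_sum (f := fun μ => (φ j (F μ j * F μ j)).re)
      (fun μ _ => hpos μ j) (Finset.mem_univ μ))
  set Y : ι → J → A := fun μ j => L j (F μ j) - ((n j * P.meanFieldVF (a j) μ : ℝ) : ℂ) • 1 with hY
  have hYS : ∀ μ, SBig φ (Y μ) fun j => √(G j) := fun μ => sBig_gen_fluc h hφ ha hF μ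
  have hYsa : ∀ μ j, star (Y μ j) = Y μ j := fun μ j => by
    rw [hY]
    simp only [star_sub, star_smul, star_one, Complex.star_def, Complex.conj_ofReal,
      ← (h j).gen_star, hsa]
  have e : ∀ j, ∑ μ, φ j (L j (F μ j * F μ j) - ((2 * n j * a' j μ : ℝ) : ℂ) • F μ j) =
      ∑ μ, (φ j (star (Y μ j) * F μ j) + φ j (star (F μ j) * Y μ j) +
        ∑ α, ∑ β, (P.p α β - P.q α β) * φ j (⁅V j α, F μ j⁆ * ⁅F μ j, V j β⁆)) := by
    intro j
    have h0 := congrArg (fun x => (2 * n j : ℂ) * x) (hzero j)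
    simp only [mul_zero, Finset.mul_sum] at h0
    rw [← sub_eq_zero, ← Finset.sum_sub_distrib, ← h0]
    refine Finset.sum_congr rfl fun μ _ => ?_
    rw [(h j).gen_mul, hYsa, hsa]
    simp only [map_sub, map_add, map_sum, map_smul, smul_eq_mul, hY, sub_mul, mul_sub,
      smul_mul_assoc, mul_smul_comm, one_mul, mul_one]
    push_cast
    ring
  simp only [← hFdef] at *
  show (fun j => ∑ μ, φ j (L j (F μ j * F μ j) - ((2 * n j * a' j μ : ℝ) : ℂ) • F μ j)) =O[⊤]
    fun j => G j + 1
  simp only [e]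
  have hGG : (fun j => √(G j) * √(G j)) =O[⊤] fun j => G j + 1 := by
    refine IsBigO.of_bound' (Eventually.of_forall fun j => ?_)
    rw [Real.mul_self_sqrt (hG0 j), Real.norm_of_nonneg (hG0 j),
      Real.norm_of_nonneg (by linarith [hG0 j])]
    linarith
  have h1G : (fun _ => (1 : ℝ)) =O[⊤] fun j => G j + 1 := by
    refine IsBigO.of_bound' (Eventually.of_forall fun j => ?_)
    rw [norm_one, Real.norm_of_nonneg (by linarith [hG0 j])]
    linarith [hG0 j]
  have hcs : ∀ X X' : J → A, SBig φ X (fun j => √(G j)) → SBig φ X' (fun j => √(G j)) →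
      (fun j => φ j (star (X j) * X' j)) =O[⊤] fun j => G j + 1 := fun X X' hX hX' =>
    (IsBigO.trans (IsBigO.of_norm_le fun j => (hφ j).cauchy_schwarz _ _) (IsBigO.mul hX hX')).trans
      hGG
  refine IsBigO.fun_sum fun μ _ => IsBigO.add (IsBigO.add (hcs _ _ (hYS μ) (hF μ))
    (hcs _ _ (hF μ) (hYS μ))) (IsBigO.fun_sum fun α _ => IsBigO.fun_sum fun β _ =>
      IsBigO.const_mul_left ?_ _)
  have h1 := isBigO_commutator_V h ha (isBigO_single μ) α
  have h2 := isBigO_commutator_V h ha (isBigO_single μ) β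
  have h3 : (fun j => ⁅F μ j, V j β⁆) =O[⊤] fun _ => (1 : ℝ) :=
    h2.neg_left.congr_left fun j => (commutator_swap _ _).symm
  have h4 := h1.mul h3
  rw [mul_one] at h4
  exact (IsBigO.trans (IsBigO.of_norm_le fun j => (hφ j).norm_apply_le _) h4.norm_left).trans h1G

end Generator

/-! ### The generator on local exponentials -/

section Exponentials
variable {J : Type*} {A : Type*} [CStarAlgebra A] {ι : Type*} [Fintype ι] [DecidableEq ι]
variable {P : MFParams ι} {K : ℝ} {n : J → ℝ} {V : J → ι → A} {L : J → A →L[ℂ] A}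
  (h : ∀ j, IsMFSystem P K (n j) (V j) (L j))

theorem commutator_expI (R X : A) : ⁅X, expI R⁆ = expI R * (conjFlow R X 1 - X) := by
  have e : expI R * conjFlow R X 1 = X * expI R := by
    rw [conjFlow, Complex.ofReal_one, one_smul, ← mul_assoc, ← mul_assoc, expI_mul_expI_neg,
      one_mul]
  rw [mul_sub, e, Ring.lie_def]

theorem commutator_expI_eq_sub_mul (R X : A) : ⁅X, expI R⁆ = (X - conjFlow (-R) X 1) * expI R := by
  have e : conjFlow (-R) X 1 * expI R = expI R * X := by
    rw [conjFlow, Complex.ofReal_one, one_smul, neg_neg, mul_assoc, expI_neg_mul_expI, mul_one]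
  rw [sub_mul, e, Ring.lie_def]

theorem mul_expI (R X : A) : X * expI R = expI R * conjFlow R X 1 := by
  have := commutator_expI R X
  rw [Ring.lie_def, mul_sub] at this
  exact sub_left_inj.1 this

theorem isBigO_expI {R : J → A} (hR : ∀ j, IsSelfAdjoint (R j)) :
    (fun j => expI (R j)) =O[⊤] fun _ => (1 : ℝ) :=
  IsBigO.of_norm_le fun j => norm_expI_le (hR j)

omit [DecidableEq ι] in
theorem fluc_zero (n : ℝ) (V : ι → A) (a : ι → ℝ) : fluc n V a 0 = 0 := by
  simp [fluc]

omit [DecidableEq ι] in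
theorem fluc_neg (n : ℝ) (V : ι → A) (a c : ι → ℝ) : fluc n V a (-c) = -fluc n V a c := by
  rw [← neg_one_smul ℝ c, fluc_smul]; simp

/-- The label field `labelVF` is chosen so that the terms of `exp (-i r · F) 𝕃 exp (i r · F)` that
are linear in the fluctuations cancel. -/
theorem smul_fluc_labelVF (P : MFParams ι) (n : ℝ) (V : ι → A) (a r : ι → ℝ) :
    Complex.I • fluc n V a (P.labelVF a r) = -(Complex.I • fluc n V a (P.br r (P.field a)) +
      ∑ μ, ∑ ν, (P.p μ ν • ((P.br r (Pi.single μ 1) ⬝ᵥ a : ℝ) : ℂ) • fluc n V a (Pi.single ν 1) +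
        P.q μ ν • ((P.br r (Pi.single ν 1) ⬝ᵥ a : ℝ) : ℂ) • fluc n V a (Pi.single μ 1))) := by
  have e : P.labelVF a r = -(P.br r (P.field a) +
      ∑ μ, ∑ ν, (P.g μ ν * (P.br r (Pi.single μ 1) ⬝ᵥ a)) • (Pi.single ν 1 : ι → ℝ)) := by
    funext γ
    simp only [MFParams.labelVF, Pi.neg_apply, Pi.add_apply, Finset.sum_apply, Pi.smul_apply,
      Pi.single_apply, smul_eq_mul, mul_ite, mul_one, mul_zero, Finset.sum_ite_eq, Finset.mem_univ,
      if_true]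
  have e2 : ∀ κ : ι → ι → ℝ, fluc n V a (∑ μ, ∑ ν, κ μ ν • (Pi.single ν 1 : ι → ℝ)) =
      ∑ μ, ∑ ν, (κ μ ν : ℂ) • fluc n V a (Pi.single ν 1) := fun κ => by
    rw [fluc_eq_sum_single,
      Finset.sum_comm (f := fun μ ν => (κ μ ν : ℂ) • fluc n V a (Pi.single ν 1))]
    refine Finset.sum_congr rfl fun ν _ => ?_
    rw [← Finset.sum_smul]
    congr 1
    simp [Finset.sum_apply, Pi.single_apply]
  have e3 : ∑ μ, ∑ ν,
      (P.p μ ν • ((P.br r (Pi.single μ 1) ⬝ᵥ a : ℝ) : ℂ) • fluc n V a (Pi.single ν 1) +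
        P.q μ ν • ((P.br r (Pi.single ν 1) ⬝ᵥ a : ℝ) : ℂ) • fluc n V a (Pi.single μ 1)) =
      Complex.I • ∑ μ, ∑ ν, ((P.g μ ν * (P.br r (Pi.single μ 1) ⬝ᵥ a) : ℝ) : ℂ) •
        fluc n V a (Pi.single ν 1) := by
    simp only [Finset.sum_add_distrib]
    rw [Finset.sum_comm (f := fun μ ν => P.q μ ν • ((P.br r (Pi.single ν 1) ⬝ᵥ a : ℝ) : ℂ) •
      fluc n V a (Pi.single μ 1))]
    simp only [← Finset.sum_add_distrib, Finset.smul_sum]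
    refine Finset.sum_congr rfl fun μ _ => Finset.sum_congr rfl fun ν _ => ?_
    rw [smul_smul, smul_smul, smul_smul, ← add_smul, ← add_mul, P.add_eq]
    push_cast
    rw [mul_assoc]
  rw [e, fluc_neg, fluc_add, e2, e3, smul_neg, smul_add]

section State
variable {φ : J → A →ₗ[ℂ] ℂ} (hφ : ∀ j, IsPosUnital (φ j)) {a r c : J → ι → ℝ}
  (ha : a =O[⊤] fun _ => (1 : ℝ)) (hr : r =O[⊤] fun _ => (1 : ℝ))
  (hc : c =O[⊤] fun _ => (1 : ℝ))
  (hF : ∀ μ, SBig φ (fun j => fluc (n j) (V j) (a j) (Pi.single μ 1)) fun _ => 1)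

theorem sBig_inv_smul_fluc (hφ : ∀ j, IsPosUnital (φ j))
    (hF : ∀ μ, SBig φ (fun j => fluc (n j) (V j) (a j) (Pi.single μ 1)) fun _ => 1)
    (hc : c =O[⊤] fun _ => (1 : ℝ)) :
    SBig φ (fun j => (n j : ℂ)⁻¹ • fluc (n j) (V j) (a j) (c j)) fun j => (n j)⁻¹ := by
  have h1 := SBig.smul (isBigO_ofReal_inv_n (n := n)) (sBig_fluc hφ hF hc)
  simpa using h1

include h hφ ha hr hc hF

/-- Fluctuations stay bounded if the state is rotated by a local exponential. -/
theorem sBig_fluc_mul_expI :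
    SBig φ (fun j => fluc (n j) (V j) (a j) (c j) * expI (fluc (n j) (V j) (a j) (r j)))
      fun _ => 1 := by
  have hcomm := isBigO_commutator_fluc h ha hr hc
  have h1 : (fun j => conjFlow (fluc (n j) (V j) (a j) (r j)) (fluc (n j) (V j) (a j) (c j)) 1 -
      fluc (n j) (V j) (a j) (c j)) =O[⊤] fun _ => (1 : ℝ) :=
    IsBigO.trans (IsBigO.of_norm_le fun j => norm_conjFlow_sub_le
      ((h j).isSelfAdjoint_fluc (a j) (r j)) _ (by simp)) hcomm.norm_left
  have hW := isBigO_expI fun j => (h j).isSelfAdjoint_fluc (a j) (r j)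
  have h2 := SBig.bdd_mul hφ hW (SBig.add hφ (SBig.of_isBigO hφ h1) (sBig_fluc hφ hF hc))
  simp only [sub_add_cancel] at h2
  simpa only [mul_expI] using h2

theorem sBig_inv_smul_fluc_mul_expI :
    SBig φ (fun j => ((n j : ℂ)⁻¹ • fluc (n j) (V j) (a j) (c j)) *
      expI (fluc (n j) (V j) (a j) (r j))) fun j => (n j)⁻¹ := by
  have h1 := sBig_fluc_mul_expI h hφ ha hr hc hF
  have h2 := SBig.smul (isBigO_ofReal_inv_n (n := n)) h1
  simpa [smul_mul_assoc] using h2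

/-- To leading order a fluctuation is rotated by a number. -/
theorem sBig_conjFlow_sub :
    SBig φ (fun j => conjFlow (fluc (n j) (V j) (a j) (r j)) (fluc (n j) (V j) (a j) (c j)) 1 -
      fluc (n j) (V j) (a j) (c j) - ((P.br (r j) (c j) ⬝ᵥ a j : ℝ) : ℂ) • 1) fun j => (n j)⁻¹ := by
  have hb : (fun j => P.br (r j) (c j)) =O[⊤] fun _ => (1 : ℝ) := P.isBigO_br hr hc
  have h1 := SBig.add hφ (SBig.of_isBigO hφ (isBigO_conjFlow_sub h ha hr hc))
    (sBig_inv_smul_fluc hφ hF hb)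
  simpa only [sub_add_cancel] using h1

/-- The one-body part of the generator on a local exponential. -/
theorem sBig_smul_commutator_expI :
    SBig φ (fun j => (Complex.I * n j) • ⁅fluc (n j) (V j) (a j) (c j),
        expI (fluc (n j) (V j) (a j) (r j))⁆ - expI (fluc (n j) (V j) (a j) (r j)) *
      ((Complex.I * n j * ((P.br (r j) (c j) ⬝ᵥ a j : ℝ) : ℂ)) • 1 +
        Complex.I • fluc (n j) (V j) (a j) (P.br (r j) (c j)) +
        (Complex.I / 2 * ((P.br (r j) (P.br (r j) (c j)) ⬝ᵥ a j : ℝ) : ℂ)) • 1))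
      fun j => (n j)⁻¹ := by
  have hb : (fun j => P.br (r j) (c j)) =O[⊤] fun _ => (1 : ℝ) := P.isBigO_br hr hc
  have hb2 : (fun j => P.br (r j) (P.br (r j) (c j))) =O[⊤] fun _ => (1 : ℝ) := P.isBigO_br hr hb
  have hW := isBigO_expI fun j => (h j).isSelfAdjoint_fluc (a j) (r j)
  have h0 : (fun j => Complex.I * (n j : ℂ)) =O[⊤] n :=
    IsBigO.const_mul_left (Complex.isBigO_ofReal_left.2 (isBigO_refl n ⊤)) _
  have h1 : (fun j => n j * ((n j)⁻¹ * (n j)⁻¹)) = fun j => (n j)⁻¹ := by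
    funext j; rw [← mul_assoc, mul_inv_cancel₀ (h j).n_pos.ne', one_mul]
  have h2 := h0.smul (isBigO_conjFlow_sub_sub h ha hr hc)
  simp only [smul_eq_mul, h1] at h2
  have h3 := SBig.bdd_smul (c := fun _ => Complex.I / 2) (isBigO_const_const _ one_ne_zero _)
    (sBig_inv_smul_fluc hφ hF hb2)
  refine SBig.congr (SBig.bdd_mul hφ hW (SBig.add hφ (SBig.of_isBigO hφ h2) h3)) fun j => ?_
  have hn := (h j).n_ne_zero
  rw [commutator_expI, ← mul_smul_comm, ← mul_sub]
  congr 1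
  have e1 : Complex.I * (n j : ℂ) * ((n j : ℂ)⁻¹) = Complex.I := by field_simp
  have e2 : ∀ x : ℂ, Complex.I * (n j : ℂ) * ((n j : ℂ)⁻¹ * x / 2) = Complex.I / 2 * x :=
    fun x => by field_simp
  have e3 : Complex.I * (n j : ℂ) * ((n j : ℂ)⁻¹ ^ 2 / 2) = Complex.I / 2 * (n j : ℂ)⁻¹ := by
    field_simp
  simp only [smul_sub, smul_smul, e1, e2, e3]
  abel

end State

section Cross
variable {Ψ φ φ' : J → A →ₗ[ℂ] ℂ} (hΨ : ∀ j, IsCross (Ψ j) (φ j) (φ' j)) {a r c c' : J → ι → ℝ}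
  (ha : a =O[⊤] fun _ => (1 : ℝ)) (hr : r =O[⊤] fun _ => (1 : ℝ))
  (hc : c =O[⊤] fun _ => (1 : ℝ)) (hc' : c' =O[⊤] fun _ => (1 : ℝ))
  (hF : ∀ μ, SBig φ (fun j => fluc (n j) (V j) (a j) (Pi.single μ 1)) fun _ => 1)
  (hF' : ∀ μ, SBig φ' (fun j => fluc (n j) (V j) (a j) (Pi.single μ 1)) fun _ => 1)
include h hΨ ha hr hc hc' hF hF'

/-- A two-body term with the commutator on the left: the deviation of the commutator from a number
is of the order of a fluctuation divided by `n`, and faces a fluctuation on the right. -/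
theorem isBigO_commutator_expI_mul :
    (fun j => Ψ j (⁅fluc (n j) (V j) (a j) (c j), expI (fluc (n j) (V j) (a j) (r j))⁆ *
        fluc (n j) (V j) (a j) (c' j) - ((P.br (r j) (c j) ⬝ᵥ a j : ℝ) : ℂ) •
      (expI (fluc (n j) (V j) (a j) (r j)) * fluc (n j) (V j) (a j) (c' j)))) =O[⊤]
      fun j => (n j)⁻¹ := by
  have hb : (fun j => P.br (r j) (c j)) =O[⊤] fun _ => (1 : ℝ) := P.isBigO_br hr hc
  have hW := isBigO_expI fun j => (h j).isSelfAdjoint_fluc (a j) (r j)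
  have hY := SBig.bdd_mul (fun j => (hΨ j).right) hW (sBig_fluc (fun j => (hΨ j).right) hF' hc')
  have hX := sBig_inv_smul_fluc (fun j => (hΨ j).left) hF hb
  have h1 := IsCross.isBigO_star_mul hΨ hX hY
  have h2 := isBigO_conjFlow_sub h ha hr.neg_left hc
  have h3 := IsCross.isBigO_right hΨ (SBig.mul (fun j => (hΨ j).right) h2 hY)
  have h4 := h1.sub h3
  simp only [mul_one] at h4
  refine h4.congr_left fun j => ?_
  rw [← map_sub]
  congr 1
  have e : P.br (-r j) (c j) = -P.br (r j) (c j) := by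
    rw [← neg_one_smul ℝ (r j), P.br_smul_left, neg_one_smul]
  have hs : star ((n j : ℂ)⁻¹ • fluc (n j) (V j) (a j) (P.br (r j) (c j))) =
      (n j : ℂ)⁻¹ • fluc (n j) (V j) (a j) (P.br (r j) (c j)) := by
    rw [star_smul, ((h j).isSelfAdjoint_fluc _ _).star_eq, ← Complex.ofReal_inv, Complex.star_def,
      Complex.conj_ofReal]
  rw [hs, commutator_expI_eq_sub_mul, e, fluc_neg, fluc_neg, neg_dotProduct]
  simp only [sub_mul, smul_neg, Complex.ofReal_neg, neg_smul, neg_mul, smul_mul_assoc, one_mul,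
    mul_assoc]
  abel

/-- A two-body term with the commutator on the right. -/
theorem isBigO_mul_commutator_expI :
    (fun j => Ψ j (fluc (n j) (V j) (a j) (c' j) * ⁅fluc (n j) (V j) (a j) (c j),
        expI (fluc (n j) (V j) (a j) (r j))⁆ - (((P.br (r j) (c j) ⬝ᵥ a j : ℝ) : ℂ) •
      (expI (fluc (n j) (V j) (a j) (r j)) * fluc (n j) (V j) (a j) (c' j)) +
        (((P.br (r j) (c j) ⬝ᵥ a j : ℝ) : ℂ) * ((P.br (r j) (c' j) ⬝ᵥ a j : ℝ) : ℂ)) •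
        expI (fluc (n j) (V j) (a j) (r j))))) =O[⊤] fun j => (n j)⁻¹ := by
  have hb : (fun j => P.br (r j) (c j)) =O[⊤] fun _ => (1 : ℝ) := P.isBigO_br hr hc
  have hW := isBigO_expI fun j => (h j).isSelfAdjoint_fluc (a j) (r j)
  have hr' : ∀ j, IsPosUnital (φ' j) := fun j => (hΨ j).right
  have hX := sBig_fluc (fun j => (hΨ j).left) hF hc'
  have h1 := IsCross.isBigO_star_mul hΨ hX
    (SBig.bdd_mul hr' hW (sBig_conjFlow_sub h hr' ha hr hc hF'))
  have hs : (fun j => ((P.br (r j) (c j) ⬝ᵥ a j : ℝ) : ℂ)) =O[⊤] fun _ => (1 : ℝ) :=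
    Complex.isBigO_ofReal_left.2 (isBigO_dotProduct hb ha)
  have h2 := IsCross.isBigO_right hΨ (SBig.bdd_smul hs
    (SBig.bdd_mul hr' hW (sBig_conjFlow_sub h hr' ha hr hc' hF')))
  have h4 := IsBigO.add (by simpa only [one_mul] using h1) h2
  refine h4.congr_left fun j => ?_
  rw [← map_add]
  congr 1
  have e1 := mul_expI (fluc (n j) (V j) (a j) (r j)) (fluc (n j) (V j) (a j) (c' j))
  rw [((h j).isSelfAdjoint_fluc _ _).star_eq, commutator_expI]
  simp only [mul_sub, smul_sub, mul_smul_comm, mul_one, ← e1, smul_smul]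
  abel

omit hc hc' in
/-- If the centring `a` follows the macroscopic dynamics and the label `r` the linear
flow `labelVF`, then `exp (i r · F)` solves the backward evolution equation up to the numerical
factor `rate` and an error of order `1 / n`. -/
theorem isBigO_gen_expI {a' : J → ι → ℝ} (ha' : ∀ j, a' j = P.meanFieldVF (a j))
    {Z : J → A} (hZ : ∀ j, ‖Z j - (Complex.I • (fluc (n j) (V j) (a j) (P.labelVF (a j) (r j)) -
        ((n j * (r j ⬝ᵥ a' j) : ℝ) : ℂ) • 1) + (1 / 2 : ℂ) • ⁅fluc (n j) (V j) (a j) (r j),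
        fluc (n j) (V j) (a j) (P.labelVF (a j) (r j))⁆)‖ ≤
      ‖⁅fluc (n j) (V j) (a j) (r j), ⁅fluc (n j) (V j) (a j) (r j),
        fluc (n j) (V j) (a j) (P.labelVF (a j) (r j))⁆⁆‖) :
    (fun j => Ψ j (L j (expI (fluc (n j) (V j) (a j) (r j))) +
        expI (fluc (n j) (V j) (a j) (r j)) * Z j -
      P.rate (a j) (r j) • expI (fluc (n j) (V j) (a j) (r j)))) =O[⊤] fun j => (n j)⁻¹ := by
  have hr' : ∀ j, IsPosUnital (φ' j) := fun j => (hΨ j).right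
  have hfield : (fun j => P.field (a j)) =O[⊤] fun _ => (1 : ℝ) := P.isBigO_field ha
  have hlab : (fun j => P.labelVF (a j) (r j)) =O[⊤] fun _ => (1 : ℝ) := P.isBigO_labelVF ha hr
  have hb3 : (fun j => P.br (r j) (P.labelVF (a j) (r j))) =O[⊤] fun _ => (1 : ℝ) :=
    P.isBigO_br hr hlab
  have hW := isBigO_expI fun j => (h j).isSelfAdjoint_fluc (a j) (r j)
  have T1 := IsCross.isBigO_right hΨ (sBig_smul_commutator_expI h hr' ha hr hfield hF')
  have T2 := fun μ ν => isBigO_commutator_expI_mul h hΨ ha hr (isBigO_single μ) (isBigO_single ν)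
    hF hF'
  have T3 := fun μ ν => isBigO_mul_commutator_expI h hΨ ha hr (isBigO_single ν) (isBigO_single μ)
    hF hF'
  have hZ' := (IsBigO.of_norm_le hZ).trans
    (isBigO_commutator_commutator h ha hr hlab).norm_left
  have hD3 := SBig.bdd_smul (c := fun _ => Complex.I / 2) (isBigO_const_const _ one_ne_zero _)
    (sBig_inv_smul_fluc hr' hF' hb3)
  have T4 := IsCross.isBigO_right hΨ
    (SBig.bdd_mul hr' hW (SBig.add hr' (SBig.of_isBigO hr' hZ') hD3))
  have T := (T1.add (IsBigO.fun_sum fun μ (_ : μ ∈ Finset.univ) =>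
    IsBigO.fun_sum fun ν (_ : ν ∈ Finset.univ) => ((T2 μ ν).const_mul_left (P.p μ ν)).add
      ((T3 μ ν).const_mul_left (P.q μ ν)))).add T4
  refine T.congr_left fun j => ?_
  have e : ∀ (z : ℂ) (X : A), z * Ψ j X = Ψ j (z • X) := fun z X => ((Ψ j).map_smul z X).symm
  simp only [e, ← map_add, ← map_sum]
  congr 1
  rw [(h j).gen_centred (a j), (h j).commutator_fluc (a j) (r j) (P.labelVF (a j) (r j)), ha' j,
    smul_sub, smul_fluc_labelVF P]
  set W := expI (fluc (n j) (V j) (a j) (r j)) with hWdef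
  have e1 : r j ⬝ᵥ P.meanFieldVF (a j) = P.br (r j) (P.field (a j)) ⬝ᵥ a j :=
    P.sum_mul_br_single (r j) (P.field (a j)) (a j)
  rw [e1, MFParams.rate]
  have e2 : (1 / 2 : ℂ) * (Complex.I / n j) = Complex.I / 2 * (n j : ℂ)⁻¹ := by
    rw [div_eq_mul_inv, div_eq_mul_inv, div_eq_mul_inv]; ring
  have e3 : ∀ x : ℂ, (1 / 2 : ℂ) * (Complex.I * x) = Complex.I / 2 * x := fun x => by ring
  have e4 : ∀ x : ℂ, Complex.I * (n j * x) = Complex.I * n j * x := fun x => by ring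
  have e5 : ((n j * (P.br (r j) (P.field (a j)) ⬝ᵥ a j) : ℝ) : ℂ) =
    n j * ((P.br (r j) (P.field (a j)) ⬝ᵥ a j : ℝ) : ℂ) := by push_cast; rfl
  simp only [mul_add, mul_sub, mul_neg, mul_smul_comm, mul_one, add_smul, smul_add, smul_sub,
    Finset.mul_sum, Finset.sum_smul, Finset.sum_add_distrib, Finset.sum_sub_distrib,
    smul_smul, e2, e3, e4, e5, neg_add]
  abel

end Cross

end Exponentials

/-! ### Products of local exponentials -/

/-- A uniform bound on derivatives along a segment bounds the increments. -/
theorem isBigO_sub_of_hasDerivWithinAt {J E : Type*} [NormedAddCommGroup E] [NormedSpace ℝ E]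
    {t : ℝ} (ht : 0 ≤ t) {f f' : J → ℝ → E} {g : J → ℝ}
    (hf : ∀ j, ∀ s ∈ Set.Icc 0 t, HasDerivWithinAt (f j) (f' j s) (Set.Icc 0 t) s)
    (hg : (fun p : J × Set.Icc 0 t => f' p.1 p.2) =O[⊤] fun p => g p.1) :
    (fun j => f j t - f j 0) =O[⊤] g := by
  obtain ⟨C, hC⟩ := isBigO_top.1 hg
  refine isBigO_top.2 ⟨C * t, fun j => ?_⟩
  have h1 := norm_image_sub_le_of_norm_deriv_le_segment' (f := f j) (f' := f' j)
    (C := C * ‖g j‖) (hf j) (fun x hx => hC (j, ⟨x, Set.Ico_subset_Icc_self hx⟩)) t ⟨ht, le_rfl⟩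
  refine h1.trans (le_of_eq ?_)
  ring

theorem conjFlow_smul_left {A : Type*} [CStarAlgebra A] (R V : A) (u : ℝ) :
    conjFlow ((u : ℂ) • R) V 1 = conjFlow R V u := by
  simp [conjFlow]

section BCH
variable {J : Type*} {A : Type*} [CStarAlgebra A] {ι : Type*} [Fintype ι] [DecidableEq ι]
variable {P : MFParams ι} {K : ℝ} {n : J → ℝ} {V : J → ι → A} {L : J → A →L[ℂ] A}

/-- The Weyl relation holds for the local exponentials up to an error of order `1 / n`. -/
theorem isBigO_expI_mul_expI {Ψ φ φ' : J → A →ₗ[ℂ] ℂ} (h : ∀ j, IsMFSystem P K (n j) (V j) (L j))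
    (hΨ : ∀ j, IsCross (Ψ j) (φ j) (φ' j)) (hΨc : ∀ j, Continuous (Ψ j)) {a r s : J → ι → ℝ}
    (ha : a =O[⊤] fun _ => (1 : ℝ)) (hr : r =O[⊤] fun _ => (1 : ℝ)) (hs : s =O[⊤] fun _ => (1 : ℝ))
    (hF : ∀ μ, SBig φ' (fun j => fluc (n j) (V j) (a j) (Pi.single μ 1)) fun _ => 1) :
    (fun j => Ψ j (expI (fluc (n j) (V j) (a j) (r j)) * expI (fluc (n j) (V j) (a j) (s j)) -
      Complex.exp (Complex.I * ((P.br (s j) (r j) ⬝ᵥ a j : ℝ) : ℂ) / 2) •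
        expI (fluc (n j) (V j) (a j) (r j + s j)))) =O[⊤] fun j => (n j)⁻¹ := by
  set R : J → A := fun j => fluc (n j) (V j) (a j) (r j) with hR
  set S : J → A := fun j => fluc (n j) (V j) (a j) (s j) with hS
  set κ : J → ℂ := fun j => Complex.I * ((P.br (s j) (r j) ⬝ᵥ a j : ℝ) : ℂ) with hκ
  have hRS : ∀ j, fluc (n j) (V j) (a j) (r j + s j) = R j + S j := fun j => fluc_add _ _ _ _ _
  have hRsa : ∀ j, IsSelfAdjoint (R j) := fun j => (h j).isSelfAdjoint_fluc _ _
  have hSsa : ∀ j, IsSelfAdjoint (S j) := fun j => (h j).isSelfAdjoint_fluc _ _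
  have hphase : ∀ (x : ℝ) j, ‖Complex.exp ((x : ℂ) * κ j)‖ = 1 := fun x j => by
    rw [hκ, ← mul_assoc, mul_comm (x : ℂ), mul_assoc, ← Complex.ofReal_mul, mul_comm,
      Complex.norm_exp_ofReal_mul_I]
  set U : J → ℝ → A := fun j u =>
    expI ((u : ℂ) • R j) * expI ((u : ℂ) • S j) * expI (-((u : ℂ) • (R j + S j))) with hU
  set M : J → ℝ → A := fun j u => Complex.I • (conjFlow (S j) (R j) u - R j) - ((u : ℂ) * κ j) • 1
    with hM
  -- The derivative of the interpolation, before it is multiplied by `expI (R + S)`.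
  have hd : ∀ j, ∀ u : ℝ, HasDerivAt (fun u : ℝ => Complex.exp (-((u : ℂ) ^ 2 / 2 * κ j)) •
      (U j u * expI (R j + S j))) (Complex.exp (-((u : ℂ) ^ 2 / 2 * κ j)) •
      (expI ((u : ℂ) • R j) * expI ((u : ℂ) • S j) * M j u * expI (-((u : ℂ) • (R j + S j))) *
        expI (R j + S j))) u := fun j u => by
    have h1 := (((hasDerivAt_ofReal_sq_half u).mul_const (κ j)).neg.cexp).smul
      ((hasDerivAt_bch (R j) (S j) u).mul_const (expI (R j + S j)))
    refine h1.congr_deriv ?_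
    simp only [hM, mul_sub, sub_mul, mul_smul_comm, smul_mul_assoc, mul_one, smul_sub,
      smul_smul]
    module
  have hdΨ : ∀ j, ∀ u ∈ Set.Icc (0 : ℝ) 1, HasDerivWithinAt (fun u : ℝ => Ψ j
      (Complex.exp (-((u : ℂ) ^ 2 / 2 * κ j)) • (U j u * expI (R j + S j))))
      (Ψ j (Complex.exp (-((u : ℂ) ^ 2 / 2 * κ j)) •
      (expI ((u : ℂ) • R j) * expI ((u : ℂ) • S j) * M j u * expI (-((u : ℂ) • (R j + S j))) *
        expI (R j + S j)))) (Set.Icc 0 1) u := fun j u _ => by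
    have h1 := (((⟨Ψ j, hΨc j⟩ : A →L[ℂ] ℂ).restrictScalars ℝ).hasFDerivAt
      (x := (Complex.exp (-((u : ℂ) ^ 2 / 2 * κ j)) • (U j u * expI (R j + S j))))).comp_hasDerivAt
        u (hd j u)
    exact h1.hasDerivWithinAt
  have hbig : (fun p : J × Set.Icc (0 : ℝ) 1 => Ψ p.1
      (Complex.exp (-(((p.2 : ℝ) : ℂ) ^ 2 / 2 * κ p.1)) • (expI (((p.2 : ℝ) : ℂ) • R p.1) *
        expI (((p.2 : ℝ) : ℂ) • S p.1) * M p.1 p.2 * expI (-(((p.2 : ℝ) : ℂ) • (R p.1 + S p.1))) *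
        expI (R p.1 + S p.1)))) =O[⊤] fun p => (n p.1)⁻¹ := by
    have h' : ∀ p : J × Set.Icc (0 : ℝ) 1, IsMFSystem P K (n p.1) (V p.1) (L p.1) := fun p => h p.1
    have hΨ' : ∀ p : J × Set.Icc (0 : ℝ) 1, IsCross (Ψ p.1) (φ p.1) (φ' p.1) := fun p => hΨ p.1
    have hφ' : ∀ p : J × Set.Icc (0 : ℝ) 1, IsPosUnital (φ' p.1) := fun p => (hΨ p.1).right
    have htop : Tendsto (fun p : J × Set.Icc (0 : ℝ) 1 => p.1) ⊤ ⊤ := tendsto_top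
    have ha' : (fun p : J × Set.Icc (0 : ℝ) 1 => a p.1) =O[⊤] fun _ => (1 : ℝ) :=
      ha.comp_tendsto htop
    have hr' : (fun p : J × Set.Icc (0 : ℝ) 1 => r p.1) =O[⊤] fun _ => (1 : ℝ) :=
      hr.comp_tendsto htop
    have hs' : (fun p : J × Set.Icc (0 : ℝ) 1 => s p.1) =O[⊤] fun _ => (1 : ℝ) :=
      hs.comp_tendsto htop
    have hF' : ∀ μ, SBig (fun p : J × Set.Icc (0 : ℝ) 1 => φ' p.1)
        (fun p => fluc (n p.1) (V p.1) (a p.1) (Pi.single μ 1)) fun _ => 1 := fun μ =>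
      IsBigO.comp_tendsto (hF μ) htop
    have hu : (fun p : J × Set.Icc (0 : ℝ) 1 => (p.2 : ℝ)) =O[⊤] fun _ => (1 : ℝ) :=
      IsBigO.of_norm_le fun p => by
        rw [Real.norm_of_nonneg p.2.2.1]; exact p.2.2.2
    have hu' : (fun p : J × Set.Icc (0 : ℝ) 1 => 1 - (p.2 : ℝ)) =O[⊤] fun _ => (1 : ℝ) :=
      (isBigO_refl _ _).sub hu
    have hus : (fun p : J × Set.Icc (0 : ℝ) 1 => (p.2 : ℝ) • s p.1) =O[⊤] fun _ => (1 : ℝ) := by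
      simpa using hu.smul hs'
    have hur : (fun p : J × Set.Icc (0 : ℝ) 1 => (1 - (p.2 : ℝ)) • (r p.1 + s p.1)) =O[⊤]
        fun _ => (1 : ℝ) := by simpa using hu'.smul (hr'.add hs')
    have hb : (fun p : J × Set.Icc (0 : ℝ) 1 => P.br ((p.2 : ℝ) • s p.1) (r p.1)) =O[⊤]
        fun _ => (1 : ℝ) := P.isBigO_br hus hr'
    have hW := isBigO_expI fun p : J × Set.Icc (0 : ℝ) 1 =>
      (h p.1).isSelfAdjoint_fluc (a p.1) ((1 - (p.2 : ℝ)) • (r p.1 + s p.1))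
    have h1 := isBigO_conjFlow_sub h' ha' hus hr'
    have h2 := sBig_inv_smul_fluc_mul_expI h' hφ' ha' hur hb hF'
    have h3 := h1.mul hW
    simp only [mul_one] at h3
    have h4 := SBig.add hφ' (SBig.of_isBigO hφ' h3) h2
    have hc : (fun p : J × Set.Icc (0 : ℝ) 1 => Complex.exp (-(((p.2 : ℝ) : ℂ) ^ 2 / 2 * κ p.1)) *
        Complex.I) =O[⊤] fun _ => (1 : ℝ) := IsBigO.of_norm_le fun p => by
      have := hphase (-((p.2 : ℝ) ^ 2 / 2)) p.1
      push_cast at this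
      rw [norm_mul, Complex.norm_I, mul_one, ← neg_mul, this]
    have hW2 := (isBigO_expI fun p : J × Set.Icc (0 : ℝ) 1 =>
      isSelfAdjoint_ofReal_smul (hRsa p.1) (p.2 : ℝ)).mul
      (isBigO_expI fun p : J × Set.Icc (0 : ℝ) 1 => isSelfAdjoint_ofReal_smul (hSsa p.1) (p.2 : ℝ))
    simp only [mul_one] at hW2
    refine (IsCross.isBigO_right hΨ' (SBig.bdd_smul hc (SBig.bdd_mul hφ' hW2 h4))).congr_left
      fun p => ?_
    congr 1
    rw [← add_mul, sub_add_cancel, fluc_smul, conjFlow_smul_left, fluc_smul, mul_smul, hRS]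
    have e : expI (-(((p.2 : ℝ) : ℂ) • (R p.1 + S p.1))) * expI (R p.1 + S p.1) =
        expI (((1 - (p.2 : ℝ) : ℝ) : ℂ) • (R p.1 + S p.1)) := by
      let _ : NormedAlgebra ℚ A := NormedAlgebra.restrictScalars ℚ ℂ A
      rw [expI, expI, expI, ← NormedSpace.exp_add_of_commute]
      · congr 1; push_cast; module
      · rw [smul_neg]
        exact (((Commute.refl _).smul_left _).smul_left _).neg_left.smul_right _
    have e' : M p.1 p.2 = Complex.I • (conjFlow (S p.1) (R p.1) p.2 - R p.1 -
        (((p.2 : ℝ) • P.br (s p.1) (r p.1) ⬝ᵥ a p.1 : ℝ) : ℂ) • 1) := by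
      have e2 : Complex.I * (((p.2 : ℝ) • P.br (s p.1) (r p.1) ⬝ᵥ a p.1 : ℝ) : ℂ) =
          (p.2 : ℝ) * κ p.1 := by
        rw [smul_dotProduct, smul_eq_mul, Complex.ofReal_mul, hκ]; ring
      rw [smul_sub, smul_smul, e2]
    rw [mul_assoc _ _ (expI (R p.1 + S p.1)), e, e', P.br_smul_left]
    simp only [smul_mul_assoc, mul_smul_comm, mul_assoc]
    rfl
  have hfin := isBigO_sub_of_hasDerivWithinAt (g := fun j => (n j)⁻¹) zero_le_one hdΨ hbig
  have hc : (fun j => Complex.exp (κ j / 2)) =O[⊤] fun _ => (1 : ℝ) := IsBigO.of_norm_le fun j => by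
    have := hphase (1 / 2) j
    push_cast at this
    rw [div_eq_inv_mul, ← one_div, this]
  have h5 := hc.mul hfin
  simp only [one_mul] at h5
  refine h5.congr_left fun j => ?_
  have e1 : U j 1 * expI (R j + S j) = expI (R j) * expI (S j) := by
    simp only [hU, Complex.ofReal_one, one_smul]
    rw [mul_assoc, expI_neg_mul_expI, mul_one]
  have e0 : U j 0 * expI (R j + S j) = expI (R j + S j) := by
    simp [hU, expI_zero]
  rw [e1, e0, hRS, ← map_sub, ← smul_eq_mul, ← map_smul]
  congr 1
  rw [smul_sub, smul_smul, ← Complex.exp_add]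
  simp [hκ, hR, hS, div_eq_inv_mul]

end BCH

/-! ### Evolved functionals and the growth of the second moments -/

section Evolved
variable {A : Type*} [CStarAlgebra A]

theorem IsPosUnital.isCross {φ : A →ₗ[ℂ] ℂ} (hφ : IsPosUnital φ) : IsCross φ φ φ :=
  ⟨hφ, hφ, hφ.cauchy_schwarz⟩

/-- The functional `x ↦ ω (a* e^{sL}(x) b)`. -/
def evolved (ω : A →ₗ[ℂ] ℂ) (L : A →L[ℂ] A) (a b : A) (s : ℝ) : A →ₗ[ℂ] ℂ where
  toFun x := ω (star a * NormedSpace.exp ((s : ℂ) • L) x * b)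
  map_add' x y := by simp [mul_add, add_mul]
  map_smul' c x := by simp

theorem evolved_apply (ω : A →ₗ[ℂ] ℂ) (L : A →L[ℂ] A) (a b : A) (s : ℝ) (x : A) :
    evolved ω L a b s x = ω (star a * NormedSpace.exp ((s : ℂ) • L) x * b) := rfl

theorem evolved_zero (ω : A →ₗ[ℂ] ℂ) (L : A →L[ℂ] A) (a b x : A) :
    evolved ω L a b 0 x = ω (star a * x * b) := by
  let _ : NormedAlgebra ℚ (A →L[ℂ] A) := NormedAlgebra.restrictScalars ℚ ℂ _
  rw [evolved_apply, Complex.ofReal_zero, zero_smul ℂ L, NormedSpace.exp_zero]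
  rfl

theorem snorm_evolved_zero (ω : A →ₗ[ℂ] ℂ) (L : A →L[ℂ] A) (b x : A) :
    snorm (evolved ω L b b 0) x = snorm ω (x * b) := by
  rw [snorm, snorm, evolved_zero, star_mul]
  simp only [mul_assoc]

variable {ω : A →ₗ[ℂ] ℂ} (hω : IsPosUnital ω)
include hω

theorem continuous_evolved (L : A →L[ℂ] A) (a b : A) (s : ℝ) : Continuous (evolved ω L a b s) := by
  have := hω.continuous
  show Continuous fun x => ω (star a * NormedSpace.exp ((s : ℂ) • L) x * b)
  fun_prop

theorem hasDerivWithinAt_evolved (L : A →L[ℂ] A) (a b : A) {X : ℝ → A} {X' : A} {S : Set ℝ} {s : ℝ}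
    (hX : HasDerivWithinAt X X' S s) :
    HasDerivWithinAt (fun s => evolved ω L a b s (X s)) (evolved ω L a b s (L (X s) + X')) S s := by
  have h1 := ((hasDerivAt_exp_smul L s).hasDerivWithinAt (s := S))
  have h2 := (((ContinuousLinearMap.restrictScalarsL ℂ A A ℝ ℝ).restrictScalars ℝ).hasFDerivAt
    (x := NormedSpace.exp ((s : ℂ) • L))).comp_hasDerivWithinAt s h1
  have h3 := (HasDerivWithinAt.clm_apply h2 hX)
  have h4 := (h3.const_mul (star a)).mul_const b
  have h5 := ((⟨ω, hω.continuous⟩ : A →L[ℂ] ℂ).restrictScalars ℝ).hasFDerivAt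
    (x := star a * NormedSpace.exp ((s : ℂ) • L) (X s) * b) |>.comp_hasDerivWithinAt s h4
  refine h5.congr_deriv ?_
  have e : NormedSpace.exp ((s : ℂ) • L) (L (X s) + X') =
    (NormedSpace.exp ((s : ℂ) • L) * L) (X s) + NormedSpace.exp ((s : ℂ) • L) X' := map_add _ _ _
  rw [evolved_apply, e]
  rfl

variable {ι : Type*} [Fintype ι] {P : MFParams ι} {K n : ℝ} {V : ι → A} {L : A →L[ℂ] A}
  (h : IsMFSystem P K n V L)
include h

theorem IsMFSystem.isPosUnital_evolved {b : A} (hb : star b * b = 1) {s : ℝ} (hs : 0 ≤ s) :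
    IsPosUnital (evolved ω L b b s) where
  nonneg x := nonneg_of_mem_closure hω (h.cp s hs) b x
  map_one := by rw [evolved_apply, h.exp_one, mul_one, hb, hω.map_one]

theorem IsMFSystem.isCross_evolved {a b : A} (ha : star a * a = 1) (hb : star b * b = 1) {s : ℝ}
    (hs : 0 ≤ s) :
    IsCross (evolved ω L a b s) (evolved ω L a a s) (evolved ω L b b s) where
  left := h.isPosUnital_evolved hω ha hs
  right := h.isPosUnital_evolved hω hb hs
  bound x y := cross_cauchy_schwarz hω (h.cp s hs) a b x y

end Evolved

section Growth
variable {J : Type*} {A : Type*} [CStarAlgebra A] {ι : Type*} [Fintype ι] [DecidableEq ι]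
variable {P : MFParams ι} {K : ℝ} {n : J → ℝ} {V : J → ι → A} {L : J → A →L[ℂ] A}
  {ω : A →ₗ[ℂ] ℂ}

omit [DecidableEq ι] in
theorem hasDerivWithinAt_fluc {n : ℝ} (V : ι → A) {a r : ℝ → ι → ℝ} {a' r' : ι → ℝ} {S : Set ℝ}
    {s : ℝ} (ha : HasDerivWithinAt a a' S s) (hr : HasDerivWithinAt r r' S s) :
    HasDerivWithinAt (fun s => fluc n V (a s) (r s))
      (fluc n V (a s) r' - ((n * (r s ⬝ᵥ a') : ℝ) : ℂ) • 1) S s := by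
  have h1 : ∀ γ, HasDerivWithinAt (fun s => ((r s γ : ℝ) : ℂ)) ((r' γ : ℝ) : ℂ) S s := fun γ =>
    Complex.ofRealCLM.hasFDerivAt.comp_hasDerivWithinAt s (hasDerivWithinAt_pi.1 hr γ)
  have h2 : ∀ γ, HasDerivWithinAt (fun s => ((n * a s γ : ℝ) : ℂ)) ((n * a' γ : ℝ) : ℂ) S s :=
    fun γ => Complex.ofRealCLM.hasFDerivAt.comp_hasDerivWithinAt s
      ((hasDerivWithinAt_pi.1 ha γ).const_mul n)
  have h3 := HasDerivWithinAt.fun_sum (u := Finset.univ) fun γ _ =>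
    (h1 γ).smul (((h2 γ).smul_const (1 : A)).const_sub (V γ))
  refine h3.congr_deriv ?_
  simp only [Finset.sum_add_distrib, smul_neg, smul_smul, ← Finset.sum_smul, Finset.sum_neg_distrib]
  rw [add_comm, ← sub_eq_add_neg, dotProduct, Finset.mul_sum]
  congr 2
  push_cast
  exact Finset.sum_congr rfl fun _ _ => by ring

/-- Uniform bounds on the fluctuations propagate in time, provided that the centring `a` follows the
macroscopic drift in all directions in which the fluctuations have non-zero mean. -/
theorem sBig_evolved (h : ∀ j, IsMFSystem P K (n j) (V j) (L j)) (hω : IsPosUnital ω) {t : ℝ}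
    (ht : 0 ≤ t) {b : J → A} (hb : ∀ j, star (b j) * b j = 1) {a a' : J → ℝ → ι → ℝ}
    (ha : (fun p : J × Set.Icc 0 t => a p.1 p.2) =O[⊤] fun _ => (1 : ℝ))
    (hd : ∀ j, ∀ s ∈ Set.Icc 0 t, HasDerivWithinAt (a j) (a' j s) (Set.Icc 0 t) s)
    (hzero : ∀ j, ∀ s ∈ Set.Icc 0 t, ∑ μ, ((P.meanFieldVF (a j s) μ - a' j s μ : ℝ) : ℂ) *
      evolved ω (L j) (b j) (b j) s (fluc (n j) (V j) (a j s) (Pi.single μ 1)) = 0)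
    (h0 : ∀ μ, SBig (fun _ => ω) (fun j => fluc (n j) (V j) (a j 0) (Pi.single μ 1) * b j)
      fun _ => 1) (μ : ι) :
    SBig (fun p : J × Set.Icc 0 t => evolved ω (L p.1) (b p.1) (b p.1) p.2)
      (fun p => fluc (n p.1) (V p.1) (a p.1 p.2) (Pi.single μ 1)) fun _ => 1 := by
  set F : J → ℝ → ι → A := fun j s μ => fluc (n j) (V j) (a j s) (Pi.single μ 1) with hF
  have hFsa : ∀ j s μ, star (F j s μ) = F j s μ := fun j s μ => (h j).isSelfAdjoint_fluc _ _
  set φ : J → ℝ → A →ₗ[ℂ] ℂ := fun j s => evolved ω (L j) (b j) (b j) s with hφ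
  have hφpos : ∀ j, ∀ s ∈ Set.Icc 0 t, IsPosUnital (φ j s) := fun j s hs =>
    (h j).isPosUnital_evolved hω (hb j) hs.1
  set G : J → ℝ → ℝ := fun j s => ∑ μ, (φ j s (F j s μ * F j s μ)).re with hG
  have hpos : ∀ j, ∀ s ∈ Set.Icc 0 t, ∀ μ, 0 ≤ (φ j s (F j s μ * F j s μ)).re := fun j s hs μ => by
    have := (hφpos j s hs).re_nonneg (F j s μ); rwa [hFsa] at this
  have hG0 : ∀ j, ∀ s ∈ Set.Icc 0 t, 0 ≤ G j s := fun j s hs =>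
    Finset.sum_nonneg fun μ _ => hpos j s hs μ
  set D : J → ℝ → ℂ := fun j s => ∑ μ, φ j s (L j (F j s μ * F j s μ) -
      ((2 * n j * a' j s μ : ℝ) : ℂ) • F j s μ) with hD
  have hderiv : ∀ j, ∀ s ∈ Set.Icc 0 t, HasDerivWithinAt (G j) (D j s).re (Set.Icc 0 t) s := by
    intro j s hs
    have h1 : ∀ μ, HasDerivWithinAt (fun s => F j s μ)
        (-(((n j * a' j s μ : ℝ) : ℂ) • (1 : A))) (Set.Icc 0 t) s := fun μ => by
      refine (hasDerivWithinAt_fluc (V j) (hd j s hs)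
        (hasDerivWithinAt_const s _ (Pi.single μ 1))).congr_deriv ?_
      rw [fluc_zero, single_one_dotProduct, zero_sub]
    have h2 := HasDerivWithinAt.fun_sum (u := Finset.univ) fun μ _ =>
      hasDerivWithinAt_evolved hω (L j) (b j) (b j) ((h1 μ).mul (h1 μ))
    have h3 := Complex.reCLM.hasFDerivAt.comp_hasDerivWithinAt s h2
    refine (h3.congr_deriv ?_).congr_of_eventuallyEq ?_ ?_
    · show (∑ μ, _ : ℂ).re = (D j s).re
      congr 1
      refine Finset.sum_congr rfl fun μ _ => ?_
      show φ j s _ = φ j s _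
      congr 1
      simp only [neg_mul, mul_neg, smul_mul_assoc, mul_smul_comm, one_mul, mul_one]
      push_cast
      module
    · exact Eventually.of_forall fun u => (map_sum Complex.reCLM _ _).symm
    · exact (map_sum Complex.reCLM _ _).symm
  have hbound := isBigO_deriv_secondMoment (J := J × Set.Icc 0 t) (φ := fun p => φ p.1 p.2)
    (fun p => h p.1) (fun p => hφpos p.1 p.2 p.2.2) ha (a' := fun p => a' p.1 p.2)
    (fun p => hzero p.1 p.2 p.2.2)
  obtain ⟨C, hC⟩ := isBigO_top.1 hbound
  have hinit : (fun j => G j 0) =O[⊤] fun _ => (1 : ℝ) := by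
    refine IsBigO.fun_sum fun μ _ => ?_
    have h1 := IsBigO.mul (h0 μ) (h0 μ)
    simp only [mul_one] at h1
    refine IsBigO.trans (IsBigO.of_norm_le fun j => ?_) h1
    have h2 := (hφpos j 0 ⟨le_rfl, ht⟩).sq_snorm (F j 0 μ)
    rw [sq, hFsa, snorm_evolved_zero] at h2
    rw [h2, Real.norm_of_nonneg (hpos j 0 ⟨le_rfl, ht⟩ μ)]
  obtain ⟨C0, hC0⟩ := isBigO_top.1 hinit
  refine isBigO_top.2 ⟨√((C0 + 1) * Real.exp (|C| * t)), fun p => ?_⟩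
  obtain ⟨j, s, hs⟩ := p
  rw [Real.norm_of_nonneg (snorm_nonneg _ _), norm_one, mul_one, snorm]
  refine Real.sqrt_le_sqrt ?_
  have h1 := norm_le_gronwallBound_of_norm_deriv_right_le (f := fun s => G j s + 1)
    (f' := fun s => (D j s).re) (a := 0) (b := t) (δ := C0 + 1) (K := |C|) (ε := 0)
    (fun s hs => (((hderiv j s hs).continuousWithinAt).add continuousWithinAt_const))
    (fun s hs => (((hderiv j s (Set.Ico_subset_Icc_self hs)).mono_of_mem_nhdsWithin
      (Icc_mem_nhdsGE_of_mem hs)).add_const 1))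
    (by
      have h2 := hC0 j
      have h3 := hG0 j 0 ⟨le_rfl, ht⟩
      rw [norm_one, mul_one, Real.norm_of_nonneg h3] at h2
      show ‖G j 0 + 1‖ ≤ _
      rw [Real.norm_of_nonneg (by linarith)]
      linarith)
    (fun s hs => by
      have h2 := hC (j, ⟨s, Set.Ico_subset_Icc_self hs⟩)
      rw [add_zero]
      refine ((Complex.abs_re_le_norm _).trans h2).trans ?_
      exact mul_le_mul_of_nonneg_right (le_abs_self C) (norm_nonneg _)) s hs
  rw [gronwallBound_ε0, sub_zero] at h1
  have hC1 : 0 ≤ C0 + 1 := by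
    have h2 := (norm_nonneg _).trans (hC0 j); rw [norm_one, mul_one] at h2; linarith
  calc _ = (φ j s (F j s μ * F j s μ)).re := by rw [hFsa]
    _ ≤ G j s := Finset.single_le_sum (f := fun μ => (φ j s (F j s μ * F j s μ)).re)
      (fun μ _ => hpos j s hs μ) (Finset.mem_univ μ)
    _ ≤ ‖G j s + 1‖ := (by linarith : G j s ≤ G j s + 1).trans (le_abs_self _)
    _ ≤ (C0 + 1) * Real.exp (|C| * s) := h1
    _ ≤ (C0 + 1) * Real.exp (|C| * t) := by
      gcongr
      exact hs.2

end Growth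

/-! ### Convergence of the macroscopic averages -/

section Drift
variable {J : Type*} {A : Type*} [CStarAlgebra A] {ι : Type*} [Fintype ι] [DecidableEq ι]
variable {P : MFParams ι} {K : ℝ} {n : J → ℝ} {V : J → ι → A} {L : J → A →L[ℂ] A}

/-- If the fluctuations are exactly centred, the deviation of the drift from `meanFieldVF` is
quadratic in the fluctuations, with a factor `1 / n`. -/
theorem isBigO_drift (h : ∀ j, IsMFSystem P K (n j) (V j) (L j)) {φ : J → A →ₗ[ℂ] ℂ}
    (hφ : ∀ j, IsPosUnital (φ j)) {a : J → ι → ℝ}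
    (hF : ∀ μ, SBig φ (fun j => fluc (n j) (V j) (a j) (Pi.single μ 1)) fun _ => 1)
    (hzero : ∀ j μ, φ j (fluc (n j) (V j) (a j) (Pi.single μ 1)) = 0) (α : ι) :
    (fun j => φ j (L j (fluc (n j) (V j) (a j) (Pi.single α 1)) -
      ((n j * P.meanFieldVF (a j) α : ℝ) : ℂ) • 1)) =O[⊤] fun j => (n j)⁻¹ := by
  have hz : ∀ j c, φ j (fluc (n j) (V j) (a j) c) = 0 := fun j c => by
    rw [fluc_eq_sum_single, map_sum]
    exact Finset.sum_eq_zero fun μ _ => by rw [map_smul, hzero, smul_zero]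
  have hX := fun j => (hφ j).isCross
  have hquad : ∀ c c' : ι → ℝ, (fun j => Complex.I / (n j) * φ j (fluc (n j) (V j) (a j) c *
      fluc (n j) (V j) (a j) c')) =O[⊤] fun j => (n j)⁻¹ := fun c c' => by
    have h1 := IsCross.isBigO_star_mul hX
      (sBig_fluc hφ hF (c := fun _ => c) (isBigO_const_const _ one_ne_zero _))
      (sBig_fluc hφ hF (c := fun _ => c') (isBigO_const_const _ one_ne_zero _))
    have h2 : (fun j => Complex.I / (n j : ℂ)) =O[⊤] fun j => (n j)⁻¹ := by
      simpa [div_eq_mul_inv] using (isBigO_ofReal_inv_n (n := n)).const_mul_left Complex.I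
    have h3 := h2.mul h1
    simp only [mul_one, ((h _).isSelfAdjoint_fluc _ _).star_eq] at h3
    exact h3
  have e : ∀ j, φ j (L j (fluc (n j) (V j) (a j) (Pi.single α 1)) -
      ((n j * P.meanFieldVF (a j) α : ℝ) : ℂ) • 1) = ∑ μ, ∑ ν,
      (P.p μ ν * (Complex.I / (n j) * φ j (fluc (n j) (V j) (a j)
          (P.br (Pi.single μ 1) (Pi.single α 1)) * fluc (n j) (V j) (a j) (Pi.single ν 1))) +
        P.q μ ν * (Complex.I / (n j) * φ j (fluc (n j) (V j) (a j) (Pi.single μ 1) *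
          fluc (n j) (V j) (a j) (P.br (Pi.single ν 1) (Pi.single α 1))))) := fun j => by
    rw [(h j).gen_fluc, map_add, hz, zero_add, map_sum]
    refine Finset.sum_congr rfl fun μ _ => ?_
    rw [map_sum]
    refine Finset.sum_congr rfl fun ν _ => ?_
    rw [(h j).commutator_fluc, (h j).commutator_fluc]
    simp only [add_mul, mul_add, smul_mul_assoc, mul_smul_comm, one_mul, mul_one, map_add, map_smul,
      hzero, smul_eq_mul, mul_zero, add_zero]
  simp only [e]
  exact IsBigO.fun_sum fun μ _ => IsBigO.fun_sum fun ν _ =>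
    ((hquad _ _).const_mul_left _).add ((hquad _ _).const_mul_left _)

end Drift

section Mean
variable {A : Type*} [CStarAlgebra A] {ι : Type*} [Fintype ι] [DecidableEq ι]
variable {P : MFParams ι} {K : ℝ}

/-- The averages of the collective operators, divided by `n`, in the state `ω ∘ e^{sL}`. -/
def meanAt (ω : A →ₗ[ℂ] ℂ) (L : A →L[ℂ] A) (n : ℝ) (V : ι → A) (s : ℝ) : ι → ℝ :=
  fun μ => (evolved ω L 1 1 s (V μ)).re / n

theorem contDiff_meanFieldVF (P : MFParams ι) : ContDiff ℝ 1 P.meanFieldVF := by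
  refine contDiff_pi.2 fun α => ?_
  simp only [MFParams.meanFieldVF, dotProduct, MFParams.br_single, MFParams.field]
  fun_prop

variable {ω : A →ₗ[ℂ] ℂ} (hω : IsPosUnital ω)
include hω

section Single
variable {n : ℝ} {V : ι → A} {L : A →L[ℂ] A} (h : IsMFSystem P K n V L)
include h

omit [DecidableEq ι] in
theorem evolved_eq_meanAt {s : ℝ} (hs : 0 ≤ s) (μ : ι) :
    evolved ω L 1 1 s (V μ) = ((n * meanAt ω L n V s μ : ℝ) : ℂ) := by
  have hφ := h.isPosUnital_evolved hω (b := 1) (by simp) hs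
  rw [meanAt, mul_div_cancel₀ _ h.n_pos.ne']
  exact Complex.ext rfl (by rw [Complex.ofReal_im, hφ.im_eq_zero (h.sa μ).star_eq])

theorem evolved_fluc_meanAt {s : ℝ} (hs : 0 ≤ s) (μ : ι) :
    evolved ω L 1 1 s (fluc n V (meanAt ω L n V s) (Pi.single μ 1)) = 0 := by
  have hφ := h.isPosUnital_evolved hω (b := 1) (by simp) hs
  rw [fluc_single, map_sub, map_smul, hφ.map_one, evolved_eq_meanAt hω h hs, smul_eq_mul, mul_one,
    sub_self]

omit [DecidableEq ι] in
theorem norm_meanAt_le (hK : 0 ≤ K) {s : ℝ} (hs : 0 ≤ s) : ‖meanAt ω L n V s‖ ≤ K := by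
  have hφ := h.isPosUnital_evolved hω (b := 1) (by simp) hs
  refine (pi_norm_le_iff_of_nonneg hK).2 fun μ => ?_
  rw [meanAt, norm_div, Real.norm_of_nonneg h.n_pos.le, div_le_iff₀ h.n_pos]
  exact ((Complex.abs_re_le_norm _).trans (hφ.norm_apply_le _)).trans (h.norm_le μ)

theorem hasDerivWithinAt_meanAt (S : Set ℝ) (a : ι → ℝ) (s : ℝ) :
    HasDerivWithinAt (meanAt ω L n V)
      (fun μ => (evolved ω L 1 1 s (L (fluc n V a (Pi.single μ 1)))).re / n) S s := by
  refine hasDerivWithinAt_pi.2 fun μ => ?_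
  have h1 := hasDerivWithinAt_evolved hω L 1 1 (hasDerivWithinAt_const s S (V μ))
  have h2 := (Complex.reCLM.hasFDerivAt.comp_hasDerivWithinAt s h1).div_const n
  refine h2.congr_deriv ?_
  rw [fluc_single, map_sub, map_smul, h.gen_one, smul_zero, sub_zero, add_zero]
  rfl

end Single

variable {n : ℕ → ℝ} {V : ℕ → ι → A} {L : ℕ → A →L[ℂ] A}

/-- The macroscopic averages converge, uniformly on compact time intervals and with rate
`1 / n ^ 2`, to a solution of the mean-field equations. -/
theorem exists_meanField_limit (h : ∀ j, IsMFSystem P K (n j) (V j) (L j))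
    (hn : Tendsto n atTop atTop)
    {a₀ : ι → ℝ} (hmean : ∀ j μ, ω (V j μ) = ((n j * a₀ μ : ℝ) : ℂ))
    (hF : ∀ μ, SBig (fun _ => ω) (fun j => fluc (n j) (V j) a₀ (Pi.single μ 1)) fun _ => 1)
    {t : ℝ} (ht : 0 ≤ t) :
    ∃ a : ℝ → ι → ℝ, a 0 = a₀ ∧ (∀ s ∈ Set.Icc 0 t, ‖a s‖ ≤ |K| ∧
      HasDerivWithinAt a (P.meanFieldVF (a s)) (Set.Icc 0 t) s) ∧
      (fun p : ℕ × Set.Icc 0 t => meanAt ω (L p.1) (n p.1) (V p.1) p.2 - a p.2) =O[⊤]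
        fun p => (n p.1)⁻¹ * (n p.1)⁻¹ := by
  have h' : ∀ j, IsMFSystem P |K| (n j) (V j) (L j) := fun j =>
    ⟨(h j).one_le, (h j).sa, (h j).comm, fun μ => ((h j).norm_le μ).trans
      (mul_le_mul_of_nonneg_right (le_abs_self K) (h j).n_pos.le), (h j).gen, (h j).cp⟩
  have h1 : star (1 : A) * 1 = 1 := by simp
  set m : ℕ → ℝ → ι → ℝ := fun j s => meanAt ω (L j) (n j) (V j) s with hm
  have hm0 : ∀ j, m j 0 = a₀ := fun j => by
    funext μ
    show (evolved ω (L j) 1 1 0 (V j μ)).re / n j = a₀ μ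
    rw [evolved_zero, star_one, one_mul, mul_one, hmean, Complex.ofReal_re,
      mul_div_cancel_left₀ _ (h j).n_pos.ne']
  set m' : ℕ → ℝ → ι → ℝ := fun j s μ => (evolved ω (L j) 1 1 s
    (L j (fluc (n j) (V j) (m j s) (Pi.single μ 1)))).re / n j with hm'
  have hmd : ∀ j, ∀ s ∈ Set.Icc 0 t, HasDerivWithinAt (m j) (m' j s) (Set.Icc 0 t) s :=
    fun j s _ => hasDerivWithinAt_meanAt hω (h j) _ _ s
  have hmK : ∀ j, ∀ s ∈ Set.Icc 0 t, ‖m j s‖ ≤ |K| := fun j s hs =>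
    norm_meanAt_le hω (h' j) (abs_nonneg K) hs.1
  have hmb : (fun p : ℕ × Set.Icc 0 t => m p.1 p.2) =O[⊤] fun _ => (1 : ℝ) :=
    IsBigO.of_bound |K| (Eventually.of_forall fun p => by
      rw [norm_one, mul_one]; exact hmK p.1 p.2 p.2.2)
  have hzero : ∀ j, ∀ s ∈ Set.Icc 0 t, ∀ μ,
      evolved ω (L j) 1 1 s (fluc (n j) (V j) (m j s) (Pi.single μ 1)) = 0 := fun j s hs μ =>
    evolved_fluc_meanAt hω (h j) hs.1 μ
  have hFt := fun μ => sBig_evolved h hω ht (b := fun _ => 1) (fun _ => h1) hmb hmd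
    (fun j s hs => Finset.sum_eq_zero fun μ _ => by rw [hzero j s hs, mul_zero])
    (by simpa only [mul_one, hm0] using hF) μ
  -- The averages solve the mean-field equations up to an error of order `1 / n ^ 2`.
  have hdrift : (fun p : ℕ × Set.Icc 0 t => m' p.1 p.2 - P.meanFieldVF (m p.1 p.2)) =O[⊤]
      fun p => (n p.1)⁻¹ * (n p.1)⁻¹ := by
    refine isBigO_pi.2 fun α => ?_
    have h2 := isBigO_drift (fun p : ℕ × Set.Icc 0 t => h p.1)
      (fun p => (h p.1).isPosUnital_evolved hω h1 p.2.2.1) hFt (fun p μ => hzero p.1 p.2 p.2.2 μ) α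
    have h3 := (isBigO_ofReal_inv_n (n := fun p : ℕ × Set.Icc 0 t => n p.1)).mul h2
    refine IsBigO.trans (IsBigO.of_norm_le fun p => ?_) h3.norm_left
    have hφ := (h p.1).isPosUnital_evolved hω h1 p.2.2.1
    rw [norm_mul, ← Complex.ofReal_inv, Complex.norm_real]
    refine le_trans (le_of_eq ?_) (mul_le_mul_of_nonneg_left (Complex.abs_re_le_norm _)
      (norm_nonneg _))
    rw [← Real.norm_eq_abs, ← norm_mul]
    congr 1
    have hn0 := (h p.1).n_pos.ne'
    rw [map_sub, map_smul, hφ.map_one, smul_eq_mul, mul_one, Complex.sub_re, Complex.ofReal_re]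
    simp only [hm', Pi.sub_apply]
    field_simp
  obtain ⟨K₁, C₁, hK₁, hC₁⟩ := exists_lipschitz_clamp (contDiff_meanFieldVF P) (abs_nonneg K)
  obtain ⟨a, ha0, ha⟩ := exists_solution_of_bounded (fun _ x => P.meanFieldVF (clamp |K| x)) ht a₀
    (fun _ _ => hK₁) (fun _ => continuousOn_const) (fun _ _ => hC₁)
  have hdiff : (fun p : ℕ × Set.Icc 0 t => m p.1 p.2 - a p.2) =O[⊤]
      fun p => (n p.1)⁻¹ * (n p.1)⁻¹ := by
    obtain ⟨C, hC⟩ := isBigO_top.1 hdrift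
    refine isBigO_top.2 ⟨C * (1 / (K₁ + 1 : NNReal) * (Real.exp ((K₁ + 1 : NNReal) * t) - 1)), ?_⟩
    rintro ⟨j, s, hs⟩
    have hIci : ∀ {f : ℝ → ι → ℝ} {f' : ι → ℝ} {s : ℝ}, s ∈ Set.Ico 0 t →
        HasDerivWithinAt f f' (Set.Icc 0 t) s → HasDerivWithinAt f f' (Set.Ici s) s :=
      fun hs hf => hf.mono_of_mem_nhdsWithin (Icc_mem_nhdsGE_of_mem hs)
    have hCn : ∀ s ∈ Set.Icc 0 t, ‖m' j s - P.meanFieldVF (m j s)‖ ≤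
      C * ‖(n j)⁻¹ * (n j)⁻¹‖ := fun s hs => hC (j, ⟨s, hs⟩)
    have hε := (norm_nonneg _).trans (hCn s hs)
    have h2 := dist_le_of_approx_trajectories_ODE (v := fun _ x => P.meanFieldVF (clamp |K| x))
      (K := K₁ + 1) (f := m j) (g := a) (f' := m' j)
      (g' := fun s => P.meanFieldVF (clamp |K| (a s))) (a := 0) (b := t)
      (εf := C * ‖(n j)⁻¹ * (n j)⁻¹‖) (εg := 0) (δ := 0)
      (fun _ => hK₁.weaken (by simp))
      (fun s hs => (hmd j s hs).continuousWithinAt)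
      (fun s hs => hIci hs (hmd j s (Set.Ico_subset_Icc_self hs)))
      (fun s hs => by
        have hs' := Set.Ico_subset_Icc_self hs
        rw [dist_eq_norm, clamp_eq_self (hmK j s hs')]
        exact hCn s hs')
      (fun s hs => (ha s hs).continuousWithinAt)
      (fun s hs => hIci hs (ha s (Set.Ico_subset_Icc_self hs)))
      (fun s _ => (dist_self _).le) (by rw [hm0, ha0, dist_self]) s hs
    rw [dist_eq_norm, gronwallBound_of_K_ne_0 (by positivity)] at h2
    refine h2.trans ?_
    have h3 : Real.exp ((K₁ + 1 : NNReal) * (s - 0)) ≤ Real.exp ((K₁ + 1 : NNReal) * t) := by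
      rw [sub_zero]; gcongr; exact hs.2
    calc _ = C * ‖(n j)⁻¹ * (n j)⁻¹‖ * (1 / (K₁ + 1 : NNReal) *
          (Real.exp ((K₁ + 1 : NNReal) * (s - 0)) - 1)) := by ring
      _ ≤ C * ‖(n j)⁻¹ * (n j)⁻¹‖ * (1 / (K₁ + 1 : NNReal) *
          (Real.exp ((K₁ + 1 : NNReal) * t) - 1)) := by gcongr
      _ = _ := by ring
  have htend : ∀ s (hs : s ∈ Set.Icc 0 t), Tendsto (fun j => m j s) atTop (𝓝 (a s)) := by
    intro s hs
    have h2 : (fun j => m j s - a s) =O[⊤] fun j => (n j)⁻¹ * (n j)⁻¹ :=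
      hdiff.comp_tendsto (k := fun j => (j, (⟨s, hs⟩ : Set.Icc 0 t))) tendsto_top
    have h3 : Tendsto (fun j => (n j)⁻¹ * (n j)⁻¹) atTop (𝓝 0) := by
      simpa using hn.inv_tendsto_atTop.mul hn.inv_tendsto_atTop
    have h4 := ((h2.mono le_top).trans_tendsto h3).add_const (a s)
    simpa using h4
  have haK : ∀ s ∈ Set.Icc 0 t, ‖a s‖ ≤ |K| := fun s hs =>
    le_of_tendsto (htend s hs).norm (Eventually.of_forall fun j => hmK j s hs)
  refine ⟨a, ha0, fun s hs => ⟨haK s hs, ?_⟩, hdiff⟩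
  have := ha s hs
  rwa [clamp_eq_self (haK s hs)] at this

end Mean

/-! ### Transport of the local exponentials -/

section Transport
variable {ι : Type*} [Fintype ι] [DecidableEq ι]

/-- The interval integral is differentiated at the endpoints too, so the integrand has to be
continuous beyond `[0, t]`. -/
theorem exists_continuous_extension {t : ℝ} (ht : 0 ≤ t) {g : ℝ → ℂ}
    (hg : ContinuousOn g (Set.Icc 0 t)) :
    ∃ ρ : ℝ → ℂ, Continuous ρ ∧ ∀ s ∈ Set.Icc 0 t, ρ s = g s :=
  ⟨Set.IccExtend ht (Set.domRestrict (Set.Icc 0 t) g), hg.domRestrict.Icc_extend',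
    fun _ hs => Set.IccExtend_of_mem _ _ hs⟩

namespace MFParams
variable (P : MFParams ι)

theorem br_eq_sum (r c : ι → ℝ) (γ : ι) : P.br r c γ = ∑ i, P.br (Pi.single i 1) c γ * r i := by
  simp only [br_single, Finset.sum_mul]
  rw [br]
  exact Finset.sum_congr rfl fun _ _ => Finset.sum_congr rfl fun _ _ => by ring

theorem labelVF_eq_sum (a r : ι → ℝ) (γ : ι) :
    P.labelVF a r γ = ∑ i, P.labelVF a (Pi.single i 1) γ * r i := by
  simp only [labelVF, neg_mul, Finset.sum_neg_distrib, add_mul, Finset.sum_add_distrib,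
    Finset.sum_mul]
  rw [P.br_eq_sum r, Finset.sum_comm]
  congr 2
  refine Finset.sum_congr rfl fun μ _ => ?_
  simp only [dotProduct, P.br_eq_sum r, Finset.sum_mul, Finset.mul_sum]
  rw [Finset.sum_comm]
  exact Finset.sum_congr rfl fun _ _ => Finset.sum_congr rfl fun _ _ => by ring

theorem continuous_labelVF (r : ι → ℝ) (γ : ι) : Continuous fun a => P.labelVF a r γ := by
  simp only [labelVF, br, field, dotProduct]
  fun_prop

theorem continuous_rate : Continuous fun x : (ι → ℝ) × (ι → ℝ) => P.rate x.1 x.2 := by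
  simp only [rate, labelVF, br, field, dotProduct]
  fun_prop

theorem continuousOn_rate {a r : ℝ → ι → ℝ} {S : Set ℝ} (ha : ContinuousOn a S)
    (hr : ContinuousOn r S) : ContinuousOn (fun s => P.rate (a s) (r s)) S := by
  have h := P.continuous_rate
  generalize P.rate = f at h ⊢
  exact h.comp_continuousOn (ha.prodMk hr)

/-- The label `r` and the scalar factor `f` of a Weyl operator that is transported backwards from
the label `q` at time `t`. -/
theorem exists_transport {t : ℝ} (ht : 0 ≤ t) {a : ℝ → ι → ℝ} (ha : ContinuousOn a (Set.Icc 0 t))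
    (q : ι → ℝ) : ∃ (r : ℝ → ι → ℝ) (f : ℝ → ℂ), r t = q ∧ f 0 = 1 ∧ ∀ s ∈ Set.Icc 0 t,
      f s ≠ 0 ∧ HasDerivWithinAt r (P.labelVF (a s) (r s)) (Set.Icc 0 t) s ∧
      HasDerivWithinAt f (-(P.rate (a s) (r s) * f s)) (Set.Icc 0 t) s := by
  obtain ⟨r, hrt, hr⟩ := exists_linear_solution
    (fun s i γ => P.labelVF (a s) (Pi.single i 1) γ) ht
    (fun i γ => (P.continuous_labelVF _ γ).comp_continuousOn ha) q
  have hr' : ∀ s ∈ Set.Icc 0 t, HasDerivWithinAt r (P.labelVF (a s) (r s)) (Set.Icc 0 t) s :=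
    fun s hs => (hr s hs).congr_deriv (funext fun γ => (P.labelVF_eq_sum _ _ γ).symm)
  have hrc : ContinuousOn r (Set.Icc 0 t) := fun s hs => (hr' s hs).continuousWithinAt
  have hρ : ContinuousOn (fun s => P.rate (a s) (r s)) (Set.Icc 0 t) :=
    P.continuousOn_rate ha hrc
  obtain ⟨ρ, hρc, hρe⟩ := exists_continuous_extension ht hρ
  refine ⟨r, fun s => Complex.exp (-∫ u in (0 : ℝ)..s, ρ u), hrt, by simp, fun s hs =>
    ⟨Complex.exp_ne_zero _, hr' s hs, ?_⟩⟩
  have h1 := (intervalIntegral.integral_hasDerivAt_right (hρc.intervalIntegrable 0 s)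
    (hρc.stronglyMeasurableAtFilter _ _) hρc.continuousAt).neg.cexp
  refine h1.hasDerivWithinAt.congr_deriv ?_
  rw [← hρe s hs]
  show Complex.exp (-∫ u in (0 : ℝ)..s, ρ u) * -ρ s = _
  ring

end MFParams

variable {J : Type*} {A : Type*} [CStarAlgebra A]
variable {P : MFParams ι} {K : ℝ} {n : J → ℝ} {V : J → ι → A} {L : J → A →L[ℂ] A} {ω : A →ₗ[ℂ] ℂ}

/-- The evolution of a local exponential is, up to an error of order `1 / n`, its transport. -/
theorem isBigO_evolved_expI_sub (h : ∀ j, IsMFSystem P K (n j) (V j) (L j)) (hω : IsPosUnital ω)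
    {t : ℝ} (ht : 0 ≤ t) {b b' : J → A} (hb : ∀ j, star (b j) * b j = 1)
    (hb' : ∀ j, star (b' j) * b' j = 1) {a r : ℝ → ι → ℝ} {f : ℝ → ℂ} {M : ℝ}
    (haM : ∀ s ∈ Set.Icc 0 t, ‖a s‖ ≤ M)
    (ha : ∀ s ∈ Set.Icc 0 t, HasDerivWithinAt a (P.meanFieldVF (a s)) (Set.Icc 0 t) s)
    (hr : ∀ s ∈ Set.Icc 0 t, HasDerivWithinAt r (P.labelVF (a s) (r s)) (Set.Icc 0 t) s)
    (hf : ∀ s ∈ Set.Icc 0 t, HasDerivWithinAt f (-(P.rate (a s) (r s) * f s)) (Set.Icc 0 t) s)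
    (hF : ∀ μ, SBig (fun p : J × Set.Icc 0 t => evolved ω (L p.1) (b p.1) (b p.1) p.2)
      (fun p => fluc (n p.1) (V p.1) (a p.2) (Pi.single μ 1)) fun _ => 1)
    (hF' : ∀ μ, SBig (fun p : J × Set.Icc 0 t => evolved ω (L p.1) (b' p.1) (b' p.1) p.2)
      (fun p => fluc (n p.1) (V p.1) (a p.2) (Pi.single μ 1)) fun _ => 1) :
    (fun j => f t * evolved ω (L j) (b j) (b' j) t (expI (fluc (n j) (V j) (a t) (r t))) -
      f 0 * evolved ω (L j) (b j) (b' j) 0 (expI (fluc (n j) (V j) (a 0) (r 0)))) =O[⊤]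
      fun j => (n j)⁻¹ := by
  have hcr : ContinuousOn r (Set.Icc 0 t) := fun s hs => (hr s hs).continuousWithinAt
  have hcf : ContinuousOn f (Set.Icc 0 t) := fun s hs => (hf s hs).continuousWithinAt
  obtain ⟨Mr, hMr⟩ := isCompact_Icc.exists_bound_of_continuousOn hcr
  obtain ⟨Mf, hMf⟩ := isCompact_Icc.exists_bound_of_continuousOn hcf
  have hbdd : ∀ {x : ℝ → ι → ℝ} {M : ℝ}, (∀ s ∈ Set.Icc 0 t, ‖x s‖ ≤ M) →
      (fun p : J × Set.Icc 0 t => x p.2) =O[⊤] fun _ => (1 : ℝ) := fun hx =>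
    IsBigO.of_bound _ (Eventually.of_forall fun p => by
      rw [norm_one, mul_one]; exact hx p.2 p.2.2)
  have hfb : (fun p : J × Set.Icc 0 t => f p.2) =O[⊤] fun _ => (1 : ℝ) :=
    IsBigO.of_bound Mf (Eventually.of_forall fun p => by
      rw [norm_one, mul_one]; exact hMf p.2 p.2.2)
  set R' : J → ℝ → A := fun j s => fluc (n j) (V j) (a s) (P.labelVF (a s) (r s)) -
    ((n j * (r s ⬝ᵥ P.meanFieldVF (a s)) : ℝ) : ℂ) • 1 with hR'
  have hR'sa : ∀ j s, IsSelfAdjoint (R' j s) := fun j s =>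
    ((h j).isSelfAdjoint_fluc _ _).sub (isSelfAdjoint_ofReal_smul (IsSelfAdjoint.one A) _)
  have hex : ∀ j s, ∃ Z : A, s ∈ Set.Icc 0 t →
      HasDerivWithinAt (fun s => expI (fluc (n j) (V j) (a s) (r s)))
        (expI (fluc (n j) (V j) (a s) (r s)) * Z) (Set.Icc 0 t) s ∧
      ‖Z - (Complex.I • R' j s + (1 / 2 : ℂ) • ⁅fluc (n j) (V j) (a s) (r s), R' j s⁆)‖ ≤
        ‖⁅fluc (n j) (V j) (a s) (r s), ⁅fluc (n j) (V j) (a s) (r s), R' j s⁆⁆‖ := fun j s => by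
    by_cases hs : s ∈ Set.Icc 0 t
    · obtain ⟨Z, hZ⟩ := exists_hasDerivWithinAt_expI
        (hasDerivWithinAt_fluc (n := n j) (V j) (ha s hs) (hr s hs))
        ((h j).isSelfAdjoint_fluc _ _) (hR'sa j s)
      exact ⟨Z, fun _ => hZ⟩
    · exact ⟨0, fun h => absurd h hs⟩
  choose Z hZ using hex
  have hcomm : ∀ j s, ⁅fluc (n j) (V j) (a s) (r s), R' j s⁆ =
      ⁅fluc (n j) (V j) (a s) (r s), fluc (n j) (V j) (a s) (P.labelVF (a s) (r s))⁆ :=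
      fun j s => by
    rw [hR', commutator_sub_right, commutator_smul_one_right, sub_zero]
  simp only [hcomm] at hZ
  have hmain := isBigO_gen_expI (J := J × Set.Icc 0 t) (fun p => h p.1)
    (fun p => (h p.1).isCross_evolved hω (hb p.1) (hb' p.1) p.2.2.1) (hbdd haM) (hbdd hMr)
    hF hF' (fun _ => rfl) (fun p => (hZ p.1 p.2 p.2.2).2)
  have hmain' := hfb.mul hmain
  simp only [one_mul] at hmain'
  refine isBigO_sub_of_hasDerivWithinAt (g := fun j => (n j)⁻¹)
    (f := fun j s => f s * evolved ω (L j) (b j) (b' j) s (expI (fluc (n j) (V j) (a s) (r s))))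
    (f' := fun j s => f s * evolved ω (L j) (b j) (b' j) s
      (L j (expI (fluc (n j) (V j) (a s) (r s))) + expI (fluc (n j) (V j) (a s) (r s)) * Z j s -
        P.rate (a s) (r s) • expI (fluc (n j) (V j) (a s) (r s)))) ht (fun j s hs => ?_) hmain'
  refine ((hf s hs).mul (hasDerivWithinAt_evolved hω (L j) (b j) (b' j)
    (hZ j s hs).1)).congr_deriv ?_
  simp only [map_sub, map_smul, smul_eq_mul]
  ring

end Transport

/-! ### The mesoscopic limit -/

section Mesoscopic
variable {A : Type*} [CStarAlgebra A] {ι : Type*} [Fintype ι] [DecidableEq ι]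
variable {P : MFParams ι} {K : ℝ} {n : ℕ → ℝ} {V : ℕ → ι → A} {L : ℕ → A →L[ℂ] A} {ω : A →ₗ[ℂ] ℂ}

theorem isBigO_exp_I_mul_sub_one {J : Type*} {x g : J → ℝ} (hx : x =O[⊤] g) :
    (fun j => Complex.exp (Complex.I * x j) - 1) =O[⊤] g :=
  (IsBigO.of_norm_le fun _ => Real.norm_exp_I_mul_ofReal_sub_one_le).trans hx.norm_left

omit [DecidableEq ι] in
/-- A change of the centring changes fluctuations by numbers. -/
theorem fluc_sub_centre (n : ℝ) (V : ι → A) (a a' c : ι → ℝ) :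
    fluc n V a' c = fluc n V a c + ((n * (c ⬝ᵥ (a - a')) : ℝ) : ℂ) • 1 := by
  rw [fluc_eq, fluc_eq, dotProduct_sub, mul_sub, Complex.ofReal_sub, sub_smul]
  abel

/-- The Weyl relation for products of three local exponentials in the initial state. -/
theorem isBigO_triple_expI (h : ∀ j, IsMFSystem P K (n j) (V j) (L j)) (hω : IsPosUnital ω)
    {a : ι → ℝ} (hF : ∀ μ, SBig (fun _ => ω) (fun j => fluc (n j) (V j) a (Pi.single μ 1))
      fun _ => 1) (r₁ r r₂ : ι → ℝ) :
    (fun j => ω (expI (fluc (n j) (V j) a r₁) * expI (fluc (n j) (V j) a r) *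
        expI (fluc (n j) (V j) a r₂)) -
      Complex.exp (Complex.I * ((P.br r r₁ ⬝ᵥ a + P.br r₂ (r₁ + r) ⬝ᵥ a : ℝ) : ℂ) / 2) *
        ω (expI (fluc (n j) (V j) a (r₁ + r + r₂)))) =O[⊤] fun j => (n j)⁻¹ := by
  have hc : ∀ c : ι → ℝ, (fun _ : ℕ => c) =O[⊤] fun _ => (1 : ℝ) := fun c =>
    isBigO_const_const _ one_ne_zero _
  have hb : ∀ c j, star (expI (fluc (n j) (V j) a c)) * expI (fluc (n j) (V j) a c) = 1 :=
    fun c j => star_expI_mul_self ((h j).isSelfAdjoint_fluc _ _)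
  have h1 := isBigO_expI_mul_expI h
    (fun j => (h j).isCross_evolved hω (a := 1) (by simp) (hb r₂ j) le_rfl)
    (fun j => continuous_evolved hω (L j) 1 _ 0) (hc a) (hc r₁) (hc r) (fun μ => by
      have h2 := sBig_fluc_mul_expI h (fun _ => hω) (hc a) (hc r₂) (hc (Pi.single μ 1)) hF
      simpa only [SBig, snorm_evolved_zero] using h2)
  have h2 := isBigO_expI_mul_expI h (fun _ => hω.isCross) (fun _ => hω.continuous) (hc a)
    (hc (r₁ + r)) (hc r₂) hF
  have h3 := h1.add (h2.const_mul_left (Complex.exp (Complex.I * ((P.br r r₁ ⬝ᵥ a : ℝ) : ℂ) / 2)))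
  refine h3.congr_left fun j => ?_
  simp only [evolved_zero, star_one, one_mul, map_sub, map_smul, smul_eq_mul, mul_sub,
    ← mul_assoc, ← Complex.exp_add]
  push_cast
  ring_nf

/-- The mesoscopic limit for sequences of mean-field systems: macroscopic averages converge, and the
evolution of a product of two local exponentials converges to a multiple of a local exponential. -/
theorem exists_mesoscopic_limit (h : ∀ j, IsMFSystem P K (n j) (V j) (L j)) (hω : IsPosUnital ω)
    (hn : Tendsto n atTop atTop)
    {a₀ : ι → ℝ} (hmean : ∀ j μ, ω (V j μ) = ((n j * a₀ μ : ℝ) : ℂ))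
    (hF : ∀ μ, SBig (fun _ => ω) (fun j => fluc (n j) (V j) a₀ (Pi.single μ 1)) fun _ => 1)
    {t : ℝ} (ht : 0 ≤ t) :
    ∃ a : ι → ℝ, Tendsto (fun j => meanAt ω (L j) (n j) (V j) t) atTop (𝓝 a) ∧
      ∃ (T : (ι → ℝ) → ι → ℝ) (z : (ι → ℝ) → ℂ), (∀ q, z q ≠ 0) ∧ ∀ q q' r₁ r₂,
        Tendsto (fun j => ω (expI (fluc (n j) (V j) a₀ r₁) * NormedSpace.exp ((t : ℂ) • L j)
          (expI (fluc (n j) (V j) (meanAt ω (L j) (n j) (V j) t) q) *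
            expI (fluc (n j) (V j) (meanAt ω (L j) (n j) (V j) t) q')) *
            expI (fluc (n j) (V j) a₀ r₂)) -
          Complex.exp (Complex.I * ((P.br q' q ⬝ᵥ a : ℝ) : ℂ) / 2) * z (q + q') *
            ω (expI (fluc (n j) (V j) a₀ r₁) * expI (fluc (n j) (V j) a₀ (T (q + q'))) *
              expI (fluc (n j) (V j) a₀ r₂))) atTop (𝓝 0) := by
  have htt : t ∈ Set.Icc 0 t := ⟨ht, le_rfl⟩
  have hninv : Tendsto (fun j => (n j)⁻¹) atTop (𝓝 0) := hn.inv_tendsto_atTop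
  obtain ⟨a, ha0, ha, hlim⟩ := exists_meanField_limit hω h hn hmean hF ht
  have hm : (fun j => meanAt ω (L j) (n j) (V j) t - a t) =O[⊤] fun j => (n j)⁻¹ * (n j)⁻¹ :=
    hlim.comp_tendsto (k := fun j => (j, (⟨t, htt⟩ : Set.Icc 0 t))) tendsto_top
  have hc : ContinuousOn a (Set.Icc 0 t) := fun s hs => (ha s hs).2.continuousWithinAt
  choose r f hrt hf0 hrf using fun q => P.exists_transport ht hc q
  refine ⟨a t, ?_, fun q => r q 0, fun q => (f q t)⁻¹, fun q => inv_ne_zero (hrf q t htt).1,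
    fun q q' r₁ r₂ => ?_⟩
  · have h4 := ((hm.mono le_top).trans_tendsto
      (by simpa using hninv.mul hninv : Tendsto (fun j => (n j)⁻¹ * (n j)⁻¹) atTop (𝓝 0))).add_const
      (a t)
    simpa using h4
  have hcst : ∀ c : ι → ℝ, (fun _ : ℕ => c) =O[⊤] fun _ => (1 : ℝ) := fun c =>
    isBigO_const_const _ one_ne_zero _
  set b : (ι → ℝ) → ℕ → A := fun c j => expI (fluc (n j) (V j) a₀ c) with hb
  have hbu : ∀ c j, star (b c j) * b c j = 1 := fun c j =>
    star_expI_mul_self ((h j).isSelfAdjoint_fluc _ _)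
  have hbs : ∀ c j, star (b (-c) j) = b c j := fun c j => by
    rw [hb]
    show star (expI (fluc (n j) (V j) a₀ (-c))) = _
    rw [star_expI ((h j).isSelfAdjoint_fluc _ _), fluc_neg, neg_neg]
  have hFb : ∀ c μ, SBig (fun p : ℕ × Set.Icc 0 t => evolved ω (L p.1) (b c p.1) (b c p.1) p.2)
      (fun p => fluc (n p.1) (V p.1) (a p.2) (Pi.single μ 1)) fun _ => 1 := fun c μ => by
    refine sBig_evolved h hω ht (hbu c) (a := fun _ => a) (a' := fun _ s => P.meanFieldVF (a s))
      (IsBigO.of_bound |K| (Eventually.of_forall fun p => ?_)) (fun _ s hs => (ha s hs).2)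
      (fun j s hs => Finset.sum_eq_zero fun μ _ => by simp) (fun μ => ?_) μ
    · rw [norm_one, mul_one]; exact (ha p.2 p.2.2).1
    · rw [ha0]
      exact sBig_fluc_mul_expI h (fun _ => hω) (hcst a₀) (hcst c) (hcst (Pi.single μ 1)) hF
  have hFt : ∀ μ, SBig (fun j => evolved ω (L j) (b r₂ j) (b r₂ j) t)
      (fun j => fluc (n j) (V j) (a t) (Pi.single μ 1)) fun _ => 1 := fun μ =>
    IsBigO.comp_tendsto (hFb r₂ μ) (k := fun j => (j, (⟨t, htt⟩ : Set.Icc 0 t))) tendsto_top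
  have hcross : ∀ j, IsCross (evolved ω (L j) (b (-r₁) j) (b r₂ j) t)
      (evolved ω (L j) (b (-r₁) j) (b (-r₁) j) t) (evolved ω (L j) (b r₂ j) (b r₂ j) t) :=
    fun j => (h j).isCross_evolved hω (hbu _ j) (hbu _ j) ht
  -- The Weyl relation at time `t`, and the transport of the resulting exponential to time `0`.
  have e1 := isBigO_expI_mul_expI h hcross (fun j => continuous_evolved hω (L j) _ _ t)
    (hcst (a t)) (hcst q) (hcst q') hFt
  have e2 := isBigO_evolved_expI_sub h hω ht (hbu (-r₁)) (hbu r₂) (fun s hs => (ha s hs).1)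
    (fun s hs => (ha s hs).2) (fun s hs => (hrf (q + q') s hs).2.1)
    (fun s hs => (hrf (q + q') s hs).2.2) (hFb (-r₁)) (hFb r₂)
  -- Centring at the exact averages instead of their limits changes a phase by `O(1 / n)`.
  have e3 : (fun j => (Complex.exp (Complex.I * ((n j * ((q + q') ⬝ᵥ
      (a t - meanAt ω (L j) (n j) (V j) t)) : ℝ) : ℂ)) - 1) *
      evolved ω (L j) (b (-r₁) j) (b r₂ j) t (expI (fluc (n j) (V j) (a t) q) *
        expI (fluc (n j) (V j) (a t) q'))) =O[⊤] fun j => (n j)⁻¹ := by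
    have h1 : (fun j => n j * ((q + q') ⬝ᵥ (a t - meanAt ω (L j) (n j) (V j) t))) =O[⊤]
        fun j => (n j)⁻¹ := by
      have h2 : (fun j => (q + q') ⬝ᵥ (a t - meanAt ω (L j) (n j) (V j) t)) =O[⊤]
          fun j => (n j)⁻¹ * (n j)⁻¹ := IsBigO.fun_sum fun i _ =>
        ((isBigO_pi.1 (hm.neg_left.congr_left fun j => neg_sub _ _)) i).const_mul_left _
      refine ((isBigO_refl n ⊤).mul h2).congr_right fun j => ?_
      rw [← mul_assoc, mul_inv_cancel₀ (h j).n_pos.ne', one_mul]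
    have h3 := IsCross.isBigO_right hcross (SBig.of_isBigO (fun j => (hcross j).right)
      ((isBigO_expI fun j => (h j).isSelfAdjoint_fluc (a t) q).mul
        (isBigO_expI fun j => (h j).isSelfAdjoint_fluc (a t) q')))
    have h4 := (isBigO_exp_I_mul_sub_one h1).mul h3
    simpa only [mul_one] using h4
  set w := Complex.exp (Complex.I * ((P.br q' q ⬝ᵥ a t : ℝ) : ℂ) / 2) with hw
  have hft := (hrf (q + q') t htt).1
  refine (((e3.add e1).add (e2.const_mul_left (w * (f (q + q') t)⁻¹))).congr_left
    fun j => ?_).mono le_top |>.trans_tendsto hninv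
  have e4 : expI (fluc (n j) (V j) (meanAt ω (L j) (n j) (V j) t) q) *
      expI (fluc (n j) (V j) (meanAt ω (L j) (n j) (V j) t) q') =
      Complex.exp (Complex.I * ((n j * ((q + q') ⬝ᵥ
        (a t - meanAt ω (L j) (n j) (V j) t)) : ℝ) : ℂ)) •
      (expI (fluc (n j) (V j) (a t) q) * expI (fluc (n j) (V j) (a t) q')) := by
    rw [fluc_sub_centre (n j) (V j) (a t) _ q, fluc_sub_centre (n j) (V j) (a t) _ q',
      expI_add_smul_one, expI_add_smul_one, smul_mul_smul_comm, ← Complex.exp_add, ← mul_add,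
      ← Complex.ofReal_add, ← mul_add, ← add_dotProduct]
  have e5 : ω (b r₁ j * NormedSpace.exp ((t : ℂ) • L j)
      (expI (fluc (n j) (V j) (meanAt ω (L j) (n j) (V j) t) q) *
        expI (fluc (n j) (V j) (meanAt ω (L j) (n j) (V j) t) q')) * b r₂ j) =
      evolved ω (L j) (b (-r₁) j) (b r₂ j) t
        (expI (fluc (n j) (V j) (meanAt ω (L j) (n j) (V j) t) q) *
        expI (fluc (n j) (V j) (meanAt ω (L j) (n j) (V j) t) q')) := by
    rw [evolved_apply, hbs]
  rw [e5, e4, map_smul, map_sub, map_smul, hrt, evolved_zero, hbs, ha0, hf0]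
  simp only [smul_eq_mul, hb]
  field_simp
  ring

end Mesoscopic

/-! ### One-site operators and their sums -/

section Chain
variable {d : ℕ}

theorem norm_pullOp_le {α : Type} (s : Set α) (g : α → α) (hg : Set.InjOn g s) :
    ‖pullOp s g hg‖ ≤ 1 :=
  LinearMap.mkContinuous_norm_le _ zero_le_one _

/-- The adjoint of a matrix unit at a site is the transposed matrix unit. -/
theorem star_pullOp_update (k : ℤ) (a b : Fin d) :
    star (pullOp {η : ℤ → Fin d | η k = a} (fun η => Function.update η k b) (injOn_update k a b)) =
      pullOp {η : ℤ → Fin d | η k = b} (fun η => Function.update η k a) (injOn_update k b a) := by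
  symm
  rw [ContinuousLinearMap.star_eq_adjoint, ContinuousLinearMap.eq_adjoint_iff]
  intro f g
  -- Exchanging the letters `a` and `b` at the site `k` matches the two scalar products termwise.
  set e : (ℤ → Fin d) ≃ (ℤ → Fin d) :=
    { toFun := fun η => Function.update η k (Equiv.swap a b (η k))
      invFun := fun η => Function.update η k (Equiv.swap a b (η k))
      left_inv := fun η => by simp
      right_inv := fun η => by simp } with he
  have he' : ∀ η, e η = Function.update η k (Equiv.swap a b (η k)) := fun η => rfl
  rw [lp.inner_eq_tsum, lp.inner_eq_tsum, ← e.tsum_eq]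
  refine tsum_congr fun η => ?_
  simp only [pullOp_apply, Set.indicator_apply, Set.mem_ofPred_eq, he', Function.update_self,
    Function.update_idem]
  by_cases h : η k = a
  · subst h
    simp [Function.update_eq_self]
  · have h' : Equiv.swap a b (η k) ≠ b := fun h' => h (by
      rw [Equiv.swap_apply_eq_iff, Equiv.swap_apply_right] at h'; exact h')
    simp [h, h']

theorem siteOp_add (k : ℤ) (x y : Matrix (Fin d) (Fin d) ℂ) :
    siteOp k (x + y) = siteOp k x + siteOp k y := by
  simp only [siteOp, Matrix.add_apply, add_smul, Finset.sum_add_distrib]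

theorem siteOp_smul (k : ℤ) (c : ℂ) (x : Matrix (Fin d) (Fin d) ℂ) :
    siteOp k (c • x) = c • siteOp k x := by
  simp only [siteOp, Matrix.smul_apply, smul_eq_mul, mul_smul, Finset.smul_sum]

theorem star_siteOp (k : ℤ) (x : Matrix (Fin d) (Fin d) ℂ) :
    star (siteOp k x) = siteOp k xᴴ := by
  simp only [siteOp, star_sum, star_smul, star_pullOp_update, conjTranspose_apply]
  exact Finset.sum_comm

theorem siteOp_mul (k : ℤ) (x y : Matrix (Fin d) (Fin d) ℂ) :
    siteOp k x * siteOp k y = siteOp k (x * y) := by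
  ext f η
  show siteOp k x (siteOp k y f) η = _
  simp only [siteOp_apply, Function.update_self, Function.update_idem, mul_apply, Finset.sum_mul,
    Finset.mul_sum]
  rw [Finset.sum_comm]
  simp only [mul_assoc]

theorem siteOp_comm {k l : ℤ} (hkl : k ≠ l) (x y : Matrix (Fin d) (Fin d) ℂ) :
    siteOp k x * siteOp l y = siteOp l y * siteOp k x := by
  ext f η
  show siteOp k x (siteOp l y f) η = siteOp l y (siteOp k x f) η
  simp only [siteOp_apply, Function.update_of_ne hkl, Function.update_of_ne hkl.symm,
    Finset.mul_sum]
  rw [Finset.sum_comm]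
  refine Finset.sum_congr rfl fun b _ => Finset.sum_congr rfl fun c _ => ?_
  rw [Function.update_comm hkl]
  ring

theorem norm_siteOp_le (k : ℤ) (x : Matrix (Fin d) (Fin d) ℂ) :
    ‖siteOp k x‖ ≤ ∑ a, ∑ b, ‖x a b‖ := by
  refine (norm_sum_le _ _).trans (Finset.sum_le_sum fun a _ => (norm_sum_le _ _).trans
    (Finset.sum_le_sum fun b _ => ?_))
  rw [norm_smul]
  exact mul_le_of_le_one_right (norm_nonneg _) (norm_pullOp_le _ _ _)

/-- The embedding of the matrices at the site `k`, as a linear map. -/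
def siteₗ (k : ℤ) : Matrix (Fin d) (Fin d) ℂ →ₗ[ℂ] QuasiLocal d where
  toFun := site k
  map_add' x y := Subtype.ext (siteOp_add k x y)
  map_smul' c x := Subtype.ext (siteOp_smul k c x)

theorem star_site (k : ℤ) (x : Matrix (Fin d) (Fin d) ℂ) : star (site k x) = site k xᴴ :=
  Subtype.ext (star_siteOp k x)

theorem site_mul (k : ℤ) (x y : Matrix (Fin d) (Fin d) ℂ) :
    site k x * site k y = site k (x * y) := Subtype.ext (siteOp_mul k x y)

theorem site_comm {k l : ℤ} (hkl : k ≠ l) (x y : Matrix (Fin d) (Fin d) ℂ) :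
    site k x * site l y = site l y * site k x := Subtype.ext (siteOp_comm hkl x y)

theorem norm_site_le (k : ℤ) (x : Matrix (Fin d) (Fin d) ℂ) :
    ‖site k x‖ ≤ ∑ a, ∑ b, ‖x a b‖ := norm_siteOp_le k x

/-- The sum of the copies at the sites `0, …, N - 1`, as a linear map. -/
def totalₗ (N : ℕ) : Matrix (Fin d) (Fin d) ℂ →ₗ[ℂ] QuasiLocal d :=
  ∑ k ∈ Finset.range N, siteₗ (k : ℤ)

theorem totalₗ_apply (N : ℕ) (x : Matrix (Fin d) (Fin d) ℂ) : totalₗ N x = total N x := by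
  simp only [totalₗ, LinearMap.sum_apply]; rfl

theorem star_total (N : ℕ) (x : Matrix (Fin d) (Fin d) ℂ) : star (total N x) = total N xᴴ := by
  rw [total, total, star_sum]
  exact Finset.sum_congr rfl fun k _ => star_site _ _

theorem norm_total_le (N : ℕ) (x : Matrix (Fin d) (Fin d) ℂ) :
    ‖total N x‖ ≤ N * ∑ a, ∑ b, ‖x a b‖ := by
  rw [total]
  calc ‖∑ k ∈ Finset.range N, site (k : ℤ) x‖ ≤ ∑ k ∈ Finset.range N, ‖site (k : ℤ) x‖ :=
        norm_sum_le _ _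
    _ ≤ ∑ k ∈ Finset.range N, ∑ a, ∑ b, ‖x a b‖ :=
        Finset.sum_le_sum fun k _ => norm_site_le (k : ℤ) x
    _ = N * ∑ a, ∑ b, ‖x a b‖ := by rw [Finset.sum_const, Finset.card_range, nsmul_eq_mul]

theorem commutator_total (N : ℕ) (x y : Matrix (Fin d) (Fin d) ℂ) :
    ⁅total N x, total N y⁆ = total N (x * y - y * x) := by
  rw [total, total, commutator_sum_left]
  refine Finset.sum_congr rfl fun k hk => ?_
  rw [commutator_sum_right, Finset.sum_eq_single_of_mem k hk]
  · rw [Ring.lie_def, site_mul, site_mul]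
    exact (map_sub (siteₗ (k : ℤ)) _ _).symm
  · intro l _ hl
    rw [Ring.lie_def, site_comm (by exact_mod_cast hl.symm), sub_self]

theorem apply_site {ω : QuasiLocal d →ₗ[ℂ] ℂ} (h : IsTranslationInvariant ω) (k : ℕ)
    (x : Matrix (Fin d) (Fin d) ℂ) : ω (site (k : ℤ) x) = ω (site 0 x) := by
  induction k with
  | zero => rfl
  | succ k ih => rw [← ih, ← h (site (k : ℤ) x), translation_site]; push_cast; rfl

end Chain

/-! ### The structure constants of a Hermitian basis -/

section Basis
variable {d : ℕ} {v : Fin (d ^ 2) → Matrix (Fin d) (Fin d) ℂ} (hv : IsHermitianOrthonormal v)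

/-- The structure constants `-i Tr([v_α, v_β] v_γ)`, which are real. -/
def structConst (v : Fin (d ^ 2) → Matrix (Fin d) (Fin d) ℂ) (α β γ : Fin (d ^ 2)) : ℝ :=
  (-Complex.I * ((v α * v β - v β * v α) * v γ).trace).re

theorem symplecticMatrix_apply (a : Fin (d ^ 2) → ℝ) (μ ν : Fin (d ^ 2)) :
    symplecticMatrix v a μ ν = ∑ γ, structConst v μ ν γ * a γ := by
  rw [symplecticMatrix, of_apply, Finset.mul_sum, Complex.re_sum]
  refine Finset.sum_congr rfl fun γ _ => ?_
  rw [← mul_assoc, Complex.re_mul_ofReal, structConst]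

theorem structConst_antisymm (α β γ : Fin (d ^ 2)) :
    structConst v β α γ = -structConst v α β γ := by
  rw [structConst, structConst, ← neg_sub (v α * v β), Matrix.neg_mul, trace_neg, mul_neg,
    Complex.neg_re]

theorem symplecticMatrix_antisymm (a : Fin (d ^ 2) → ℝ) (μ ν : Fin (d ^ 2)) :
    symplecticMatrix v a ν μ = -symplecticMatrix v a μ ν := by
  simp only [symplecticMatrix_apply, structConst_antisymm μ ν, neg_mul, Finset.sum_neg_distrib]

theorem dot_symplecticMatrix_comm (a r s : Fin (d ^ 2) → ℝ) :
    r ⬝ᵥ symplecticMatrix v a *ᵥ s = -(s ⬝ᵥ symplecticMatrix v a *ᵥ r) := by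
  have h := symplecticMatrix_antisymm (v := v) a
  generalize symplecticMatrix v a = M at h ⊢
  have h' : Mᵀ = -M := by ext i j; exact h i j
  rw [dotProduct_mulVec, ← mulVec_transpose, h', dotProduct_comm, neg_mulVec, dotProduct_neg]

include hv

theorem ofReal_structConst (α β γ : Fin (d ^ 2)) :
    Complex.I * (structConst v α β γ : ℂ) = ((v α * v β - v β * v α) * v γ).trace := by
  have h1 : star ((v α * v β - v β * v α) * v γ).trace =
      -((v α * v β - v β * v α) * v γ).trace := by
    rw [← trace_conjTranspose, conjTranspose_mul, conjTranspose_sub, conjTranspose_mul,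
      conjTranspose_mul, (hv.isHermitian α).eq, (hv.isHermitian β).eq, (hv.isHermitian γ).eq,
      trace_mul_comm, ← trace_neg, ← neg_mul, neg_sub]
  have h2 : ((v α * v β - v β * v α) * v γ).trace.re = 0 := by
    have := congrArg Complex.re h1
    rw [Complex.star_def, Complex.conj_re, Complex.neg_re] at this
    linarith
  rw [structConst]
  refine Complex.ext ?_ ?_ <;> simp [h2]

/-- The `d ^ 2` orthonormal matrices `v γ` are a basis. -/
theorem eq_sum_trace_smul (x : Matrix (Fin d) (Fin d) ℂ) : x = ∑ γ, (x * v γ).trace • v γ := by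
  have hli : LinearIndependent ℂ v := by
    rw [Fintype.linearIndependent_iff]
    intro c hc γ
    have h1 := congrArg (fun y => (y * v γ).trace) hc
    simpa [Finset.sum_mul, hv.trace_mul, trace_sum] using h1
  have hspan : x ∈ Submodule.span ℂ (Set.range v) := by
    rw [hli.span_eq_top_of_card_eq_finrank' (by simp [Module.finrank_matrix, sq])]
    trivial
  obtain ⟨c, rfl⟩ := (Submodule.mem_span_range_iff_exists_fun ℂ).1 hspan
  refine Finset.sum_congr rfl fun γ _ => ?_
  congr 1
  simp [Finset.sum_mul, hv.trace_mul, trace_sum]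

theorem commutator_basis (α β : Fin (d ^ 2)) :
    v α * v β - v β * v α = ∑ γ, (Complex.I * (structConst v α β γ : ℂ)) • v γ := by
  simp only [ofReal_structConst hv]
  exact eq_sum_trace_smul hv _

theorem total_commutator_basis (N : ℕ) (α β : Fin (d ^ 2)) :
    total N (v α * v β - v β * v α) =
      ∑ γ, (Complex.I * (structConst v α β γ : ℂ)) • total N (v γ) := by
  rw [commutator_basis hv, ← totalₗ_apply, map_sum]
  simp only [map_smul, totalₗ_apply]

end Basis

/-! ### The chain as a mean-field system -/

section ChainSystem
variable {d : ℕ} {v : Fin (d ^ 2) → Matrix (Fin d) (Fin d) ℂ}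

/-- The parameters of the mean-field generator of the chain. -/
def chainParams (v : Fin (d ^ 2) → Matrix (Fin d) (Fin d) ℂ) (ε : Fin (d ^ 2) → ℝ)
    {h C : Matrix (Fin (d ^ 2)) (Fin (d ^ 2)) ℂ} (hh : h.IsHermitian) (hC : C.IsHermitian) :
    MFParams (Fin (d ^ 2)) where
  k := structConst v
  ε := ε
  g μ ν := 2 * (h μ ν).re + (C μ ν).im
  p μ ν := Complex.I * h μ ν + C μ ν / 2
  q μ ν := Complex.I * h μ ν - C μ ν / 2
  add_eq μ ν := by
    rw [← hh.apply ν μ, ← hC.apply ν μ]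
    refine Complex.ext ?_ ?_
    · simp
    · simp; ring

theorem sqrt_cast_mul_self (N : ℕ) : ((√(N : ℝ) : ℝ) : ℂ) * ((√(N : ℝ) : ℝ) : ℂ) = N := by
  rw [← Complex.ofReal_mul, Real.mul_self_sqrt (Nat.cast_nonneg N), Complex.ofReal_natCast]

theorem sqrt_cast_ne_zero {N : ℕ} (hN : N ≠ 0) : ((√(N : ℝ) : ℝ) : ℂ) ≠ 0 :=
  Complex.ofReal_ne_zero.2 (Real.sqrt_ne_zero'.2 (by positivity))

theorem total_eq_smul_collective {N : ℕ} (hN : N ≠ 0) (x : Matrix (Fin d) (Fin d) ℂ) :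
    total N x = ((√(N : ℝ) : ℝ) : ℂ) • collective N x := by
  rw [collective, smul_smul, mul_inv_cancel₀ (sqrt_cast_ne_zero hN), one_smul]

theorem meanField_eq_smul_collective (N : ℕ) (x : Matrix (Fin d) (Fin d) ℂ) :
    meanField N x = ((√(N : ℝ) : ℝ) : ℂ)⁻¹ • collective N x := by
  rw [collective, smul_smul, ← mul_inv, sqrt_cast_mul_self, meanField]

theorem isSelfAdjoint_collective (N : ℕ) {x : Matrix (Fin d) (Fin d) ℂ} (hx : x.IsHermitian) :
    IsSelfAdjoint (collective N x) := by
  rw [IsSelfAdjoint, collective, star_smul, star_total, hx.eq, ← Complex.ofReal_inv,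
    Complex.star_def, Complex.conj_ofReal]

theorem hamiltonian_eq {N : ℕ} (hN : N ≠ 0) (ε : Fin (d ^ 2) → ℝ)
    (h : Matrix (Fin (d ^ 2)) (Fin (d ^ 2)) ℂ) :
    hamiltonian v ε h N = (∑ μ, ((ε μ : ℂ) * ((√(N : ℝ) : ℝ) : ℂ)) • collective N (v μ)) +
      ∑ μ, ∑ ν, h μ ν • (collective N (v μ) * collective N (v ν)) := by
  rw [hamiltonian]
  congr 1
  · exact Finset.sum_congr rfl fun μ _ => by rw [total_eq_smul_collective hN, smul_smul]
  · refine Finset.sum_congr rfl fun μ _ => Finset.sum_congr rfl fun ν _ => ?_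
    rw [total_eq_smul_collective hN, total_eq_smul_collective hN, smul_mul_smul_comm,
      sqrt_cast_mul_self, smul_smul ((N : ℂ)⁻¹), inv_mul_cancel₀ (Nat.cast_ne_zero.2 hN), one_smul]

theorem lindbladian_eq {N : ℕ} (hN : N ≠ 0) (ε : Fin (d ^ 2) → ℝ)
    (h C : Matrix (Fin (d ^ 2)) (Fin (d ^ 2)) ℂ) (X : QuasiLocal d) :
    lindbladian v ε h C N X =
      ∑ μ, (Complex.I * ε μ * ((√(N : ℝ) : ℝ) : ℂ)) • ⁅collective N (v μ), X⁆ + ∑ μ, ∑ ν,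
      ((Complex.I * h μ ν + C μ ν / 2) • (⁅collective N (v μ), X⁆ * collective N (v ν)) +
        (Complex.I * h μ ν - C μ ν / 2) • (collective N (v μ) * ⁅collective N (v ν), X⁆)) := by
  set V : Fin (d ^ 2) → QuasiLocal d := fun μ => collective N (v μ)
  rw [lindbladian_apply, hamiltonian_eq hN]
  have e1 : Complex.I • (((∑ μ, ((ε μ : ℂ) * ((√(N : ℝ) : ℝ) : ℂ)) • V μ) +
      ∑ μ, ∑ ν, h μ ν • (V μ * V ν)) * X - X * ((∑ μ, ((ε μ : ℂ) * ((√(N : ℝ) : ℝ) : ℂ)) • V μ) +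
      ∑ μ, ∑ ν, h μ ν • (V μ * V ν))) =
      ∑ μ, (Complex.I * ε μ * ((√(N : ℝ) : ℝ) : ℂ)) • ⁅V μ, X⁆ + ∑ μ, ∑ ν,
      (Complex.I * h μ ν) • (⁅V μ, X⁆ * V ν + V μ * ⁅V ν, X⁆) := by
    rw [add_mul, mul_add, add_sub_add_comm, smul_add]
    congr 1
    · simp only [Finset.sum_mul, Finset.mul_sum, ← Finset.sum_sub_distrib, Finset.smul_sum,
        smul_mul_assoc, mul_smul_comm, ← smul_sub, smul_smul, Ring.lie_def, mul_assoc]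
    · simp only [Finset.sum_mul, Finset.mul_sum, ← Finset.sum_sub_distrib, Finset.smul_sum,
        smul_mul_assoc, mul_smul_comm, ← smul_sub, smul_smul, Ring.lie_def]
      refine Finset.sum_congr rfl fun μ _ => Finset.sum_congr rfl fun ν _ => ?_
      congr 1
      noncomm_ring
  rw [e1, add_assoc]
  congr 1
  simp only [← Finset.sum_add_distrib]
  refine Finset.sum_congr rfl fun μ _ => Finset.sum_congr rfl fun ν _ => ?_
  have e2 : X * V ν - V ν * X = -⁅V ν, X⁆ := by rw [Ring.lie_def, neg_sub]
  have e3 : V μ * X - X * V μ = ⁅V μ, X⁆ := by rw [Ring.lie_def]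
  show _ + (C μ ν / 2) • ((V μ * X - X * V μ) * V ν + V μ * (X * V ν - V ν * X)) = _
  rw [e2, e3, mul_neg]
  module

open scoped MatrixOrder Matrix.Norms.L2Operator in
/-- The dynamics is a limit of Kraus maps: with `C = G* G` the generator has the Lindblad form
`x ↦ K* x + x K + ∑ i, B_i* x B_i` with `B_i = ∑ ν, G_{iν} V_ν`. -/
theorem dynamics_mem_closure [Nontrivial (QuasiLocal d)] (hv : IsHermitianOrthonormal v)
    {N : ℕ} (hN : N ≠ 0) (ε : Fin (d ^ 2) → ℝ)
    {h C : Matrix (Fin (d ^ 2)) (Fin (d ^ 2)) ℂ} (hh : h.IsHermitian) (hC : C.PosSemidef)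
    {t : ℝ} (ht : 0 ≤ t) : dynamics v ε h C N t ∈ closure (krausMaps (QuasiLocal d)) := by
  obtain ⟨G, rfl⟩ := CStarAlgebra.nonneg_iff_eq_star_mul_self.1 hC.nonneg
  rw [star_eq_conjTranspose] at *
  set V : Fin (d ^ 2) → QuasiLocal d := fun μ => collective N (v μ) with hV
  have hVsa : ∀ μ, star (V μ) = V μ := fun μ => isSelfAdjoint_collective N (hv.isHermitian μ)
  set H := hamiltonian v ε h N with hH
  have hHsa : star H = H := by
    rw [hH, hamiltonian_eq hN, star_add, star_sum, star_sum]
    congr 1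
    · refine Finset.sum_congr rfl fun μ _ => ?_
      rw [star_smul, ← Complex.ofReal_mul, Complex.star_def, Complex.conj_ofReal]
      congr 1
      exact hVsa μ
    · simp only [star_sum, star_smul, star_mul]
      rw [Finset.sum_comm]
      refine Finset.sum_congr rfl fun μ _ => Finset.sum_congr rfl fun ν _ => ?_
      rw [hh.apply]
      exact congrArg _ (congrArg₂ _ (hVsa μ) (hVsa ν))
  set B : Fin (d ^ 2) → QuasiLocal d := fun i => ∑ ν, G i ν • V ν with hB
  have hBs : ∀ i, star (B i) = ∑ μ, star (G i μ) • V μ := fun i => by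
    simp only [hB, star_sum, star_smul, hVsa]
  have hsum : ∀ X, ∑ i, star (B i) * X * B i =
      ∑ μ, ∑ ν, (Gᴴ * G) μ ν • (V μ * X * V ν) := fun X => by
    have e : ∀ i, star (B i) * X * B i =
        ∑ μ, ∑ ν, (star (G i μ) * G i ν) • (V μ * X * V ν) := fun i => by
      rw [hBs]
      simp only [hB, Finset.sum_mul, Finset.mul_sum, smul_mul_assoc, mul_smul_comm]
      rw [Finset.sum_comm]
      simp only [Finset.smul_sum, smul_smul, mul_comm (G i _)]
    simp only [e, mul_apply, Finset.sum_smul, conjTranspose_apply]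
    rw [Finset.sum_comm]
    exact Finset.sum_congr rfl fun μ _ => Finset.sum_comm
  set D := ∑ i, star (B i) * B i with hD
  have hDsa : star D = D := by simp only [hD, star_sum, star_mul, star_star]
  have hDeq : D = ∑ μ, ∑ ν, (Gᴴ * G) μ ν • (V μ * V ν) := by
    have := hsum 1
    simpa only [mul_one] using this
  refine exp_mem_closure_krausMaps (-(Complex.I • H) - (1 / 2 : ℂ) • D) B _ (fun X => ?_) ht
  rw [lindbladian_apply, hsum, star_sub, star_neg, star_smul, star_smul, hHsa, hDsa, hDeq]
  have e1 : star (1 / 2 : ℂ) = 1 / 2 := by simp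
  have e2 : star Complex.I = -Complex.I := Complex.conj_I
  have e3 : ∑ μ, ∑ ν, ((Gᴴ * G) μ ν / 2) •
        ((collective N (v μ) * X - X * collective N (v μ)) * collective N (v ν) +
          collective N (v μ) * (X * collective N (v ν) - collective N (v ν) * X)) =
      ∑ μ, ∑ ν, (Gᴴ * G) μ ν • (V μ * X * V ν) -
        (1 / 2 : ℂ) • ((∑ μ, ∑ ν, (Gᴴ * G) μ ν • (V μ * V ν)) * X) -
        (1 / 2 : ℂ) • (X * ∑ μ, ∑ ν, (Gᴴ * G) μ ν • (V μ * V ν)) := by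
    simp only [Finset.sum_mul, Finset.mul_sum, Finset.smul_sum, ← Finset.sum_sub_distrib,
      smul_mul_assoc, mul_smul_comm]
    refine Finset.sum_congr rfl fun μ _ => Finset.sum_congr rfl fun ν _ => ?_
    simp only [hV, sub_mul, mul_sub, mul_assoc]
    module
  rw [e1, e2, e3]
  simp only [sub_mul, mul_sub, mul_neg, smul_mul_assoc, mul_smul_comm, smul_sub, neg_smul,
    neg_neg]
  abel

/-- The chain of `N` sites is a mean-field system with `n = √N`. -/
theorem isMFSystem_chain [Nontrivial (QuasiLocal d)] (hv : IsHermitianOrthonormal v)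
    {N : ℕ} (hN : N ≠ 0) (ε : Fin (d ^ 2) → ℝ)
    {h C : Matrix (Fin (d ^ 2)) (Fin (d ^ 2)) ℂ} (hh : h.IsHermitian) (hC : C.PosSemidef) :
    IsMFSystem (chainParams v ε hh hC.isHermitian) (∑ μ, ∑ a, ∑ b, ‖v μ a b‖) (√(N : ℝ))
      (fun μ => collective N (v μ)) (lindbladian v ε h C N) where
  one_le := by
    rw [Real.one_le_sqrt]
    exact_mod_cast Nat.one_le_iff_ne_zero.2 hN
  sa μ := isSelfAdjoint_collective N (hv.isHermitian μ)
  comm α β := by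
    rw [collective, collective, commutator_smul_left, commutator_smul_right, commutator_total,
      total_commutator_basis hv]
    simp only [Finset.smul_sum, collective, smul_smul]
    refine Finset.sum_congr rfl fun γ _ => ?_
    congr 1
    show _ = Complex.I / _ * ((structConst v α β γ : ℂ) * _)
    rw [div_eq_mul_inv]
    ring
  norm_le μ := by
    have h1 : (0 : ℝ) < √(N : ℝ) := Real.sqrt_pos.2 (by positivity)
    have h2 : ∑ a, ∑ b, ‖v μ a b‖ ≤ ∑ μ, ∑ a, ∑ b, ‖v μ a b‖ :=
      Finset.single_le_sum (f := fun μ => ∑ a, ∑ b, ‖v μ a b‖) (fun _ _ => by positivity)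
        (Finset.mem_univ μ)
    have h3 : ‖(((√(N : ℝ) : ℝ) : ℂ))⁻¹‖ = (√(N : ℝ))⁻¹ := by
      rw [norm_inv, Complex.norm_real, Real.norm_of_nonneg h1.le]
    rw [collective, norm_smul, h3]
    calc (√(N : ℝ))⁻¹ * ‖total N (v μ)‖ ≤ (√(N : ℝ))⁻¹ * (N * ∑ a, ∑ b, ‖v μ a b‖) := by
          gcongr; exact norm_total_le N (v μ)
      _ = (√(N : ℝ))⁻¹ * (√(N : ℝ) * √(N : ℝ)) * ∑ a, ∑ b, ‖v μ a b‖ := by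
          rw [Real.mul_self_sqrt (Nat.cast_nonneg N)]; ring
      _ = (∑ a, ∑ b, ‖v μ a b‖) * √(N : ℝ) := by rw [inv_mul_cancel_left₀ h1.ne', mul_comm]
      _ ≤ _ := by gcongr
  gen X := lindbladian_eq hN ε h C X
  cp _ hs := dynamics_mem_closure hv hN ε hh hC hs

end ChainSystem

/-! ### The Gaussian state of the limit -/

namespace GaussianState
variable {p : ℕ} (Q : GaussianState p)

theorem expect_smul (c : ℂ) (X : Q.Space →L[ℂ] Q.Space) : Q.expect (c • X) = c * Q.expect X := by
  rw [expect, _root_.smul_apply, inner_smul_right]; rfl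

theorem expect_weyl_triple (r₁ r r₂ : Fin p → ℝ) :
    Q.expect (Q.weyl r₁ * Q.weyl r * Q.weyl r₂) =
      Complex.exp (-(Complex.I / 2) *
        ((r₁ ⬝ᵥ Q.symp *ᵥ r + (r₁ + r) ⬝ᵥ Q.symp *ᵥ r₂ : ℝ) : ℂ)) *
      Complex.exp (-(((r₁ + r + r₂) ⬝ᵥ Q.cov *ᵥ (r₁ + r + r₂) : ℝ) : ℂ) / 2) := by
  rw [weyl_mul, smul_mul_assoc, weyl_mul, smul_smul, expect_smul, expect_weyl, ← Complex.exp_add,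
    ← mul_add, ← Complex.ofReal_add]

theorem weyl_ne_zero (r : Fin p → ℝ) : Q.weyl r ≠ 0 := fun h => by
  have h1 := Q.expect_weyl r
  rw [h, expect, _root_.zero_apply, inner_zero_right] at h1
  exact Complex.exp_ne_zero _ h1.symm

/-- An operator is determined by its matrix elements between Weyl operators, as the vacuum is
cyclic. -/
theorem eq_of_expect_eq {X Y : Q.Space →L[ℂ] Q.Space}
    (h : ∀ r₁ r₂, Q.expect (Q.weyl r₁ * X * Q.weyl r₂) = Q.expect (Q.weyl r₁ * Y * Q.weyl r₂)) :
    X = Y := by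
  have e : ∀ (Z : Q.Space →L[ℂ] Q.Space) r₁ r₂, Q.expect (Q.weyl r₁ * Z * Q.weyl r₂) =
      ⟪Q.weyl (-r₁) Q.vacuum, Z (Q.delta r₂ : Q.Space)⟫_ℂ := fun Z r₁ r₂ => by
    rw [← Q.star_weyl r₁, ContinuousLinearMap.star_eq_adjoint,
      ContinuousLinearMap.adjoint_inner_left, ← weyl_vacuum]
    rfl
  refine Q.ext_delta fun s => Q.cyclic.eq_of_inner_right ℂ fun x hx => ?_
  induction hx using Submodule.span_induction with
  | mem x hx =>
    obtain ⟨r, rfl⟩ := hx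
    have := h (-r) s
    rwa [e, e, neg_neg] at this
  | zero => simp
  | add x y _ _ hx hy => rw [inner_add_left, inner_add_left, hx, hy]
  | smul c x _ hx => rw [inner_smul_left, inner_smul_left, hx]

theorem weyl_mem_fluctuationAlgebra (c : ℂ) (r : Fin p → ℝ) :
    c • Q.weyl r ∈ Q.fluctuationAlgebra :=
  subset_closure ⟨_, Submodule.smul_mem _ _ (Submodule.subset_span ⟨r, rfl⟩), rfl⟩

end GaussianState

/-- Limits of Gram matrices of self-adjoint elements are positive semidefinite. -/
theorem posSemidef_of_tendsto {A : Type*} [CStarAlgebra A] {ω : A →ₗ[ℂ] ℂ} (hω : IsPosUnital ω)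
    {ι : Type*} [Fintype ι] {F : ℕ → ι → A} (hF : ∀ j i, star (F j i) = F j i) {M : Matrix ι ι ℂ}
    (hM : ∀ i k, Tendsto (fun j => ω (F j i * F j k)) atTop (𝓝 (M i k))) : M.PosSemidef := by
  refine PosSemidef.of_dotProduct_mulVec_nonneg ?_ fun x => ?_
  · ext i k
    refine tendsto_nhds_unique ((hM k i).star) ((hM i k).congr fun j => ?_)
    show _ = starRingEnd ℂ (ω (F j k * F j i))
    rw [← hω.map_star, star_mul, hF, hF]
  · have h1 : Tendsto (fun j => ω (star (∑ k, x k • F j k) * ∑ k, x k • F j k)) atTop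
        (𝓝 (star x ⬝ᵥ M *ᵥ x)) := by
      have e : ∀ j, ω (star (∑ k, x k • F j k) * ∑ k, x k • F j k) =
          ∑ i, star (x i) * ∑ k, ω (F j i * F j k) * x k := fun j => by
        simp only [star_sum, star_smul, hF, Finset.sum_mul, Finset.mul_sum, smul_mul_assoc,
          mul_smul_comm, map_sum, map_smul, smul_eq_mul]
        rw [Finset.sum_comm]
        refine Finset.sum_congr rfl fun i _ => Finset.sum_congr rfl fun k _ => ?_
        ring
      simp only [e, dotProduct, mulVec]
      exact tendsto_finsetSum _ fun i _ => (tendsto_finsetSum _ fun k _ =>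
        (hM i k).mul_const _).const_mul _
    exact ge_of_tendsto' h1 fun j => hω.nonneg _

/-! ### Fluctuations of the chain -/

section ChainLimit
variable {d : ℕ} {v : Fin (d ^ 2) → Matrix (Fin d) (Fin d) ℂ}

/-- Local fluctuations are centred collective operators, whatever functional `φ` is used for the
centring; at positive times `φ` is `ω ∘ γ_t`. -/
theorem localFluct_eq {N : ℕ} (hN : N ≠ 0) {φ : QuasiLocal d → ℂ} {a : Fin (d ^ 2) → ℝ}
    {μ : Fin (d ^ 2)}
    (hφ : ∑ k ∈ Finset.range N, φ (site (k : ℤ) (v μ)) = ((N * a μ : ℝ) : ℂ)) :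
    localFluct φ N (v μ) = fluc (√(N : ℝ)) (fun μ => collective N (v μ)) a (Pi.single μ 1) := by
  have hs := sqrt_cast_ne_zero hN
  rw [fluc_single, localFluct, Finset.sum_sub_distrib, ← Finset.sum_smul, hφ, smul_sub, smul_smul]
  congr 2
  push_cast
  rw [← sqrt_cast_mul_self, ← mul_assoc, inv_mul_cancel_left₀ hs]

theorem localWeyl_eq {N : ℕ} (hN : N ≠ 0) {φ : QuasiLocal d → ℂ} {a : Fin (d ^ 2) → ℝ}
    (hφ : ∀ μ, ∑ k ∈ Finset.range N, φ (site (k : ℤ) (v μ)) = ((N * a μ : ℝ) : ℂ))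
    (r : Fin (d ^ 2) → ℝ) :
    localWeyl v φ N r = expI (fluc (√(N : ℝ)) (fun μ => collective N (v μ)) a r) := by
  rw [localWeyl, expI, fluc_eq_sum_single]
  simp only [localFluct_eq hN (hφ _)]

/-- The commutator of two fluctuations is governed by the symplectic matrix. -/
theorem chainParams_br_dotProduct (ε : Fin (d ^ 2) → ℝ)
    {h C : Matrix (Fin (d ^ 2)) (Fin (d ^ 2)) ℂ} (hh : h.IsHermitian) (hC : C.IsHermitian)
    (r s a : Fin (d ^ 2) → ℝ) :
    (chainParams v ε hh hC).br r s ⬝ᵥ a = r ⬝ᵥ symplecticMatrix v a *ᵥ s := by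
  simp only [dotProduct, mulVec, MFParams.br, symplecticMatrix_apply, Finset.sum_mul,
    Finset.mul_sum]
  rw [Finset.sum_comm]
  refine Finset.sum_congr rfl fun α _ => ?_
  rw [Finset.sum_comm]
  refine Finset.sum_congr rfl fun μ _ => Finset.sum_congr rfl fun γ _ => ?_
  show r α * s μ * structConst v α μ γ * a γ = _
  ring

theorem IsState.isPosUnital {ω : QuasiLocal d →ₗ[ℂ] ℂ} (hω : IsState ω) : IsPosUnital ω :=
  ⟨hω.nonneg, hω.map_one⟩

theorem IsState.nontrivial {ω : QuasiLocal d →ₗ[ℂ] ℂ} (hω : IsState ω) :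
    Nontrivial (QuasiLocal d) :=
  ⟨1, 0, fun h => by simpa [h] using hω.map_one⟩

section State
variable (hv : IsHermitianOrthonormal v) {ω : QuasiLocal d →ₗ[ℂ] ℂ} (hω : IsState ω)
  (htrans : IsTranslationInvariant ω)
include hv hω htrans

theorem sum_apply_site (N : ℕ) (μ : Fin (d ^ 2)) :
    ∑ k ∈ Finset.range N, ω (site (k : ℤ) (v μ)) = ((N * initialAverages v ω μ : ℝ) : ℂ) := by
  have h1 : ω (site 0 (v μ)) = (initialAverages v ω μ : ℂ) :=
    Complex.ext rfl (by
      rw [Complex.ofReal_im, hω.isPosUnital.im_eq_zero (by rw [star_site, (hv.isHermitian μ).eq])])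
  simp [apply_site htrans, h1]

theorem apply_collective {N : ℕ} (hN : N ≠ 0) (μ : Fin (d ^ 2)) :
    ω (collective N (v μ)) = ((√(N : ℝ) * initialAverages v ω μ : ℝ) : ℂ) := by
  rw [collective, map_smul, total, map_sum, sum_apply_site hv hω htrans, smul_eq_mul]
  push_cast
  rw [← sqrt_cast_mul_self, mul_assoc, inv_mul_cancel_left₀ (sqrt_cast_ne_zero hN)]

theorem localWeyl_eq_expI {N : ℕ} (hN : N ≠ 0) (r : Fin (d ^ 2) → ℝ) : localWeyl v ω N r =
    expI (fluc (√(N : ℝ)) (fun μ => collective N (v μ)) (initialAverages v ω) r) :=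
  localWeyl_eq hN (sum_apply_site hv hω htrans N) r

variable (ε : Fin (d ^ 2) → ℝ) {h C : Matrix (Fin (d ^ 2)) (Fin (d ^ 2)) ℂ} (hh : h.IsHermitian)
  (hC : C.PosSemidef)
include ε hh hC

/-- The two-point functions of the fluctuations converge to the matrix of the Gaussian state: the
symmetric part by assumption, the antisymmetric part by the commutation relations. The generator
only serves to view the chain as a mean-field system. -/
theorem tendsto_twoPoint {S : Matrix (Fin (d ^ 2)) (Fin (d ^ 2)) ℝ} (hS : NormalFluctuations v ω S)
    (μ ν : Fin (d ^ 2)) : Tendsto (fun j : ℕ => ω (localFluct ω (j + 1) (v μ) *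
      localFluct ω (j + 1) (v ν))) atTop (𝓝 ((S μ ν : ℂ) + Complex.I / 2 *
        (symplecticMatrix v (initialAverages v ω) μ ν : ℂ))) := by
  have := hω.nontrivial
  have h1 := ((tendsto_add_atTop_iff_nat 1).2 (hS.covariance μ ν)).add_const
    (Complex.I / 2 * (symplecticMatrix v (initialAverages v ω) μ ν : ℂ))
  refine h1.congr fun j => ?_
  have hN : j + 1 ≠ 0 := j.succ_ne_zero
  have hsys := isMFSystem_chain hv hN ε hh hC
  have hcomm := congrArg ω
    (hsys.commutator_fluc (initialAverages v ω) (Pi.single μ 1) (Pi.single ν 1))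
  have hz : ∀ c, ω (fluc (√((j + 1 : ℕ) : ℝ)) (fun μ => collective (j + 1) (v μ))
      (initialAverages v ω) c) = 0 := fun c => by
    rw [fluc, map_sum]
    refine Finset.sum_eq_zero fun γ _ => ?_
    rw [map_smul, map_sub, map_smul, apply_collective hv hω htrans hN, hω.map_one, smul_eq_mul,
      smul_eq_mul, mul_one, sub_self, mul_zero]
  rw [map_add, map_smul, hz, smul_zero, zero_add, map_smul, hω.map_one, chainParams_br_dotProduct,
    single_one_dotProduct, mulVec_single_one, smul_eq_mul, mul_one, Ring.lie_def, map_sub] at hcomm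
  have hF := fun μ => localFluct_eq (v := v) hN (sum_apply_site hv hω htrans (j + 1) μ)
  rw [map_add, hF, hF]
  have e : (symplecticMatrix v (initialAverages v ω)).col ν μ =
    symplecticMatrix v (initialAverages v ω) μ ν := rfl
  rw [e] at hcomm
  linear_combination (-1 / 2 : ℂ) * hcomm

omit ε hh hC in
theorem sBig_fluc_chain {S : Matrix (Fin (d ^ 2)) (Fin (d ^ 2)) ℝ} (hS : NormalFluctuations v ω S)
    (μ : Fin (d ^ 2)) : SBig (fun _ : ℕ => ω) (fun j => fluc (√((j + 1 : ℕ) : ℝ))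
      (fun μ => collective (j + 1) (v μ)) (initialAverages v ω) (Pi.single μ 1)) fun _ => 1 := by
  obtain ⟨B, hB⟩ := ((tendsto_add_atTop_iff_nat 1).2 (hS.covariance μ μ)).norm.bddAbove_range
  refine isBigO_top.2 ⟨√B, fun j => ?_⟩
  have hN : j + 1 ≠ 0 := j.succ_ne_zero
  have hsa : star (localFluct ω (j + 1) (v μ)) = localFluct ω (j + 1) (v μ) := by
    rw [localFluct_eq hN (sum_apply_site hv hω htrans (j + 1) μ), fluc_single]
    exact ((isSelfAdjoint_collective _ (hv.isHermitian μ)).sub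
      (isSelfAdjoint_ofReal_smul (IsSelfAdjoint.one _) _)).star_eq
  beta_reduce
  rw [norm_one, mul_one, Real.norm_of_nonneg (snorm_nonneg _ _), snorm,
    ← localFluct_eq hN (sum_apply_site hv hω htrans (j + 1) μ), hsa]
  refine Real.sqrt_le_sqrt ((Complex.re_le_norm _).trans ?_)
  have h1 := hB ⟨j, rfl⟩
  beta_reduce at h1
  rwa [map_add, add_self_div_two] at h1

/-- Matrix elements of local exponentials between local exponentials converge to those of the Weyl
operators. -/
theorem tendsto_localWeyl_triple {Q : GaussianState (d ^ 2)}
    (hsymp : Q.symp = symplecticMatrix v (initialAverages v ω)) (hS : NormalFluctuations v ω Q.cov)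
    (r₁ r r₂ : Fin (d ^ 2) → ℝ) :
    Tendsto (fun j : ℕ => ω (localWeyl v ω (j + 1) r₁ * localWeyl v ω (j + 1) r *
      localWeyl v ω (j + 1) r₂)) atTop (𝓝 (Q.expect (Q.weyl r₁ * Q.weyl r * Q.weyl r₂))) := by
  have := hω.nontrivial
  have h1 := isBigO_triple_expI
    (fun j : ℕ => isMFSystem_chain hv (N := j + 1) (Nat.succ_ne_zero j) ε hh hC)
    hω.isPosUnital (sBig_fluc_chain hv hω htrans hS) r₁ r r₂
  have hn : Tendsto (fun j : ℕ => (√((j + 1 : ℕ) : ℝ))⁻¹) atTop (𝓝 0) :=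
    (Real.tendsto_sqrt_atTop.comp
      (tendsto_natCast_atTop_atTop.comp (tendsto_add_atTop_nat 1))).inv_tendsto_atTop
  have h2 := (h1.mono le_top).trans_tendsto hn
  have h3 := ((tendsto_add_atTop_iff_nat 1).2 (hS.gaussian (r₁ + r + r₂))).const_mul
    (Complex.exp (-(Complex.I / 2) * ((r₁ ⬝ᵥ Q.symp *ᵥ r + (r₁ + r) ⬝ᵥ Q.symp *ᵥ r₂ : ℝ) : ℂ)))
  have h4 := h2.add h3
  rw [zero_add, ← GaussianState.expect_weyl_triple] at h4
  refine h4.congr fun j => ?_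
  have hN : j + 1 ≠ 0 := j.succ_ne_zero
  have e : Complex.I * (((chainParams v ε hh hC.isHermitian).br r r₁ ⬝ᵥ initialAverages v ω +
      (chainParams v ε hh hC.isHermitian).br r₂ (r₁ + r) ⬝ᵥ initialAverages v ω : ℝ) : ℂ) / 2 =
      -(Complex.I / 2) * ((r₁ ⬝ᵥ Q.symp *ᵥ r + (r₁ + r) ⬝ᵥ Q.symp *ᵥ r₂ : ℝ) : ℂ) := by
    rw [chainParams_br_dotProduct, chainParams_br_dotProduct, ← hsymp, Q.dot_symp_comm r r₁,
      Q.dot_symp_comm r₂]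
    push_cast
    ring
  simp only [localWeyl_eq_expI hv hω htrans hN, e]
  ring

end State

end ChainLimit

/-! ### Failure of linearity, and the theorem -/

/-- If a linear map sends the products of Weyl operators to multiples of them as in the mesoscopic
dynamics, then the two symplectic forms agree. -/
theorem GaussianState.symp_eq_of_linear {p : ℕ} (Q : GaussianState p) {M : Matrix (Fin p) (Fin p) ℝ}
    {Φ : (Fin p → ℝ) → (Fin p → ℝ) → (Q.Space →L[ℂ] Q.Space)} (hΦ0 : ∀ r s, Φ r s ≠ 0)
    (hM : ∀ r s, s ⬝ᵥ M *ᵥ r = -(r ⬝ᵥ M *ᵥ s))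
    (hΦ : ∀ r s, Φ r s = Complex.exp (Complex.I * ((s ⬝ᵥ (M *ᵥ r) : ℝ) : ℂ)) • Φ s r)
    (L : (Q.Space →L[ℂ] Q.Space) →ₗ[ℂ] (Q.Space →L[ℂ] Q.Space))
    (hL : ∀ r s, L (Q.weyl r * Q.weyl s) = Φ r s) : M = Q.symp := by
  have h1 : ∀ r s, Complex.exp (Complex.I * ((r ⬝ᵥ (M - Q.symp) *ᵥ s : ℝ) : ℂ)) = 1 := fun r s => by
    have e1 : Q.weyl r * Q.weyl s =
        Complex.exp (-Complex.I * ((r ⬝ᵥ Q.symp *ᵥ s : ℝ) : ℂ)) • (Q.weyl s * Q.weyl r) := by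
      rw [Q.weyl_mul, Q.weyl_mul, smul_smul, ← Complex.exp_add, add_comm s r, Q.dot_symp_comm s r]
      congr 2
      push_cast
      ring
    have e2 := hL r s
    rw [e1, map_smul, hL, hΦ r s, hM r s] at e2
    have e3 := smul_left_injective ℂ (hΦ0 s r) e2
    rw [sub_mulVec, dotProduct_sub, Complex.ofReal_sub, mul_sub, Complex.exp_sub,
      div_eq_one_iff_eq (Complex.exp_ne_zero _)]
    have e4 := congrArg (fun x => x⁻¹) e3
    simp only [← Complex.exp_neg] at e4
    rw [neg_mul, neg_neg, Complex.ofReal_neg, mul_neg, neg_neg] at e4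
    exact e4.symm
  rw [← sub_eq_zero]
  ext i j
  by_contra hD
  -- Rescaling the labels makes the phase equal to `exp (i π) = -1`.
  have h2 := h1 ((Real.pi / (M - Q.symp) i j) • Pi.single i 1) (Pi.single j 1)
  have e : ((Real.pi / (M - Q.symp) i j) • (Pi.single i 1 : Fin p → ℝ)) ⬝ᵥ
      (M - Q.symp) *ᵥ Pi.single j 1 = Real.pi := by
    rw [smul_dotProduct, single_one_dotProduct, mulVec_single_one, smul_eq_mul]
    exact div_mul_cancel₀ _ hD
  rw [e, mul_comm, Complex.exp_pi_mul_I] at h2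
  norm_num at h2

end SpinChain

end

open SpinChain in
theorem proposition1 {d : ℕ}
    (v : Fin (d ^ 2) → Matrix (Fin d) (Fin d) ℂ) (hv : SpinChain.IsHermitianOrthonormal v)
    (ε : Fin (d ^ 2) → ℝ) (h C : Matrix (Fin (d ^ 2)) (Fin (d ^ 2)) ℂ)
    (hh : h.IsHermitian) (hC : C.PosSemidef)
    (ω : SpinChain.QuasiLocal d →ₗ[ℂ] ℂ) (hω : SpinChain.IsState ω)
    (htrans : SpinChain.IsTranslationInvariant ω) (hclust : SpinChain.L1Clustering ω)
    (S : Matrix (Fin (d ^ 2)) (Fin (d ^ 2)) ℝ) (hS : SpinChain.NormalFluctuations v ω S)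
    (t : ℝ) (ht : 0 ≤ t) :
    -- the macroscopic averages at time `t`
    ∃ ωt : Fin (d ^ 2) → ℝ,
      (∀ α, Tendsto
        (fun N : ℕ => ω (SpinChain.dynamics v ε h C N t (SpinChain.meanField N (v α))))
        atTop (𝓝 (ωt α : ℂ))) ∧
      -- the commutators of fluctuations at time `t` tend to the symplectic matrix at time `t`
      (∀ μ ν, Tendsto
        (fun N : ℕ => -Complex.I * ω (SpinChain.dynamics v ε h C N t
          (SpinChain.meanField N (v μ * v ν - v ν * v μ))))
        atTop (𝓝 (SpinChain.symplecticMatrix v ωt μ ν : ℂ))) ∧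
      -- the Gaussian state of the quantum fluctuations at time `0`
      ∃ Q : SpinChain.GaussianState (d ^ 2),
        Q.symp = SpinChain.symplecticMatrix v (SpinChain.initialAverages v ω) ∧ Q.cov = S ∧
        -- the mesoscopic dynamics `Φ r s = Φ_t [W(r) W(s)]` of products of two Weyl operators
        ∃ Φ : (Fin (d ^ 2) → ℝ) → (Fin (d ^ 2) → ℝ) → (Q.Space →L[ℂ] Q.Space),
          (∀ r s Y, SpinChain.IsMesoscopicLimit v ω Q
            (fun N => SpinChain.dynamics v ε h C N t
              (SpinChain.localWeylAt v ε h C ω t N r * SpinChain.localWeylAt v ε h C ω t N s)) Y ↔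
            Y = Φ r s) ∧
          (∀ r s, Φ r s = Complex.exp (Complex.I *
            ((s ⬝ᵥ (SpinChain.symplecticMatrix v ωt *ᵥ r) : ℝ) : ℂ)) • Φ s r) ∧
          (SpinChain.symplecticMatrix v ωt ≠
              SpinChain.symplecticMatrix v (SpinChain.initialAverages v ω) →
            ¬ ∃ L : (Q.Space →L[ℂ] Q.Space) →ₗ[ℂ] (Q.Space →L[ℂ] Q.Space),
              ∀ r s, L (Q.weyl r * Q.weyl s) = Φ r s) := by
  have hnt := hω.nontrivial
  have hω' := hω.isPosUnital
  have hsys : ∀ j : ℕ, IsMFSystem (chainParams v ε hh hC.isHermitian) (∑ μ, ∑ a, ∑ b, ‖v μ a b‖)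
      (√((j + 1 : ℕ) : ℝ)) (fun μ => collective (j + 1) (v μ)) (lindbladian v ε h C (j + 1)) :=
    fun j => isMFSystem_chain hv (N := j + 1) (Nat.succ_ne_zero j) ε hh hC
  have hn : Tendsto (fun j : ℕ => √((j + 1 : ℕ) : ℝ)) atTop atTop :=
    Real.tendsto_sqrt_atTop.comp (tendsto_natCast_atTop_atTop.comp (tendsto_add_atTop_nat 1))
  obtain ⟨ωt, hlim, T, z, hz, hmeso⟩ := exists_mesoscopic_limit hsys hω' hn
    (fun j μ => apply_collective hv hω htrans (N := j + 1) (Nat.succ_ne_zero j) μ)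
    (sBig_fluc_chain hv hω htrans hS) ht
  have hdyn : ∀ N x, ω (dynamics v ε h C N t x) = evolved ω (lindbladian v ε h C N) 1 1 t x :=
    fun N x => by rw [evolved_apply, star_one, one_mul, mul_one]; rfl
  have hα : ∀ α, Tendsto (fun N : ℕ => ω (dynamics v ε h C N t (meanField N (v α)))) atTop
      (𝓝 (ωt α : ℂ)) := fun α => by
    refine (tendsto_add_atTop_iff_nat 1).1 ?_
    refine ((Complex.continuous_ofReal.tendsto _).comp (tendsto_pi_nhds.1 hlim α)).congr fun j => ?_
    have hN : j + 1 ≠ 0 := j.succ_ne_zero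
    rw [meanField_eq_smul_collective, hdyn, map_smul, smul_eq_mul,
      evolved_eq_meanAt hω' (hsys j) ht α, Complex.ofReal_mul,
      inv_mul_cancel_left₀ (sqrt_cast_ne_zero hN)]
    rfl
  refine ⟨ωt, hα, fun μ ν => ?_, ?_⟩
  · have h1 := tendsto_finsetSum Finset.univ fun γ (_ : γ ∈ Finset.univ) =>
      (hα γ).const_mul (structConst v μ ν γ : ℂ)
    rw [symplecticMatrix_apply]
    push_cast
    refine h1.congr fun N => ?_
    rw [meanField, total_commutator_basis hv, Finset.smul_sum, map_sum, map_sum, Finset.mul_sum]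
    refine Finset.sum_congr rfl fun γ _ => ?_
    rw [smul_comm, map_smul, map_smul, smul_eq_mul, meanField, ← mul_assoc, ← mul_assoc, neg_mul,
      Complex.I_mul_I, neg_neg, one_mul]
  have hpos : (Matrix.of fun i j => (S i j : ℂ) + Complex.I / 2 *
      (symplecticMatrix v (initialAverages v ω) i j : ℂ)).PosSemidef :=
    posSemidef_of_tendsto hω' (F := fun j i => localFluct ω (j + 1) (v i)) (fun j i => by
      rw [localFluct_eq (Nat.succ_ne_zero j) (sum_apply_site hv hω htrans (j + 1) i)]
      exact (hsys j).isSelfAdjoint_fluc _ _) (tendsto_twoPoint hv hω htrans ε hh hC hS)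
  obtain ⟨Q, hsymp, hcov⟩ : ∃ Q : GaussianState (d ^ 2),
      Q.symp = symplecticMatrix v (initialAverages v ω) ∧ Q.cov = S := ⟨⟨_, S, hpos⟩, rfl, rfl⟩
  subst hcov
  set Φ : (Fin (d ^ 2) → ℝ) → (Fin (d ^ 2) → ℝ) → (Q.Space →L[ℂ] Q.Space) := fun r s =>
    (Complex.exp (Complex.I * ((s ⬝ᵥ symplecticMatrix v ωt *ᵥ r : ℝ) : ℂ) / 2) * z (r + s)) •
      Q.weyl (T (r + s)) with hΦ
  have hphase : ∀ r s, Φ r s = Complex.exp (Complex.I *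
      ((s ⬝ᵥ (symplecticMatrix v ωt *ᵥ r) : ℝ) : ℂ)) • Φ s r := fun r s => by
    simp only [hΦ, smul_smul, ← mul_assoc, ← Complex.exp_add, add_comm s r]
    rw [dot_symplecticMatrix_comm ωt r s]
    congr 3
    push_cast
    ring
  have hmesoΦ : ∀ r s, IsMesoscopicLimit v ω Q (fun N => dynamics v ε h C N t
      (localWeylAt v ε h C ω t N r * localWeylAt v ε h C ω t N s)) (Φ r s) := fun r s => by
    refine ⟨Q.weyl_mem_fluctuationAlgebra _ _, fun r₁ r₂ => (tendsto_add_atTop_iff_nat 1).1 ?_⟩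
    have h1 := (hmeso r s r₁ r₂).add
      ((tendsto_localWeyl_triple hv hω htrans ε hh hC hsymp hS r₁ (T (r + s)) r₂).const_mul
        (Complex.exp (Complex.I * ((s ⬝ᵥ symplecticMatrix v ωt *ᵥ r : ℝ) : ℂ) / 2) * z (r + s)))
    rw [zero_add, ← GaussianState.expect_smul, ← smul_mul_assoc, ← mul_smul_comm] at h1
    refine h1.congr fun j => ?_
    have hN : j + 1 ≠ 0 := j.succ_ne_zero
    have hWt : ∀ q, localWeylAt v ε h C ω t (j + 1) q =
        expI (fluc (√((j + 1 : ℕ) : ℝ)) (fun μ => collective (j + 1) (v μ))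
          (meanAt ω (lindbladian v ε h C (j + 1)) (√((j + 1 : ℕ) : ℝ))
            (fun μ => collective (j + 1) (v μ)) t) q) := fun q => by
      refine localWeyl_eq hN (fun μ => ?_) q
      simp only [hdyn]
      rw [← map_sum]
      show evolved _ _ _ _ _ (total (j + 1) (v μ)) = _
      rw [total_eq_smul_collective hN, map_smul, evolved_eq_meanAt hω' (hsys j) ht μ, smul_eq_mul,
        Complex.ofReal_mul, ← mul_assoc, sqrt_cast_mul_self]
      push_cast
      rfl
    simp only [localWeyl_eq_expI hv hω htrans hN, hWt, chainParams_br_dotProduct]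
    rw [sub_add_cancel]
    rfl
  refine ⟨Q, hsymp, rfl, Φ, fun r s Y => ⟨fun hY => ?_, fun hY => hY ▸ hmesoΦ r s⟩, hphase,
    fun hne hL => ?_⟩
  · exact Q.eq_of_expect_eq fun r₁ r₂ =>
      tendsto_nhds_unique (hY.tendsto r₁ r₂) ((hmesoΦ r s).tendsto r₁ r₂)
  · obtain ⟨L, hL⟩ := hL
    refine hne ((Q.symp_eq_of_linear (fun r s => ?_) (fun r s => dot_symplecticMatrix_comm ωt s r)
      hphase L hL).trans hsymp)
    exact smul_ne_zero (mul_ne_zero (Complex.exp_ne_zero _) (hz _)) (Q.weyl_ne_zero _)
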